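/- **Setting.** Let $n\ge 0$ and let $G(s)\in\mathbb C(s)^{n\times n}$ be strictly proper with left coprime factorization $G=D^{-1}N$, $D,N\in\mathbb C[s]^{n\times n}$, and McMillan degree $\delta=\deg\det D$. Embed $\mathrm{Grass}(n,\mathbb C^{2n})$ in $\mathbb P^{M}$, $M=\binom{2n}{n}-1$, by Plücker coordinates, and let $LG(n)\subset\mathbb P^{M}$ (the complex Lagrangian Grassmann manifold) be the Zariski closure of $\{\operatorname{rowsp}[F\ \,I_n] : F=F^t\in\mathbb C^{n\times n}\}$. Let $p_i(s)$ be the cofactors of the Plücker coordinates $f_i$ of $\operatorname{rowsp}[F_1\ F_2]$ in $$\det\begin{pmatrix}D(s)&N(s)\\F_1&F_2\end{pmatrix}=\sum_i p_i(s)f_i ,$$ and put $\varphi_z(s)=\sum_i p_i(s)z_i$ and $\mathcal Z=\{z\in\mathbb P^{M}:\varphi_z=0\}$. If $G(s)^t=G(s)$ (symmetric case) let $\chi:LG(n)\setminus\mathcal Z\to\mathbb P^{\delta}$ send $z$ to the point with homogeneous coordinates the coefficients of $1,s,\dots,s^{\delta}$ in $\varphi_z$; if $G(-s)^t=G(s)$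 (Hamiltonian case) let $\chi':LG(n)\setminus\mathcal Z\to\mathbb P^{\delta/2}$ send $z$ to the point given by the coefficients of $1,s^2,\dots,s^{\delta}$ in $\varphi_z$. A map $S\to\mathbb P(W)$, $S\subset\mathbb P(V)$, is called a *central projection with center* $\mathbb P(E)$, $E\subset V$ a linear subspace, if it is $[v]\mapsto[Lv]$ for a linear map $L:V\to W$ with kernel $E$ and $Lv\neq0$ for all $[v]\in S$; that is, if it is the restriction of the projection $\mathbb P(V)\setminus\mathbb P(E)\to\mathbb P(V/E)$ followed by a linear embedding $\mathbb P(V/E)\to\mathbb P(W)$. The degree of a projective variety of dimension $r$ is $r!$ times the leading coefficient of its Hilbert polynomial. The multiplicity of a point $x$ in a fiber of $\chi$ or $\chi'$ is the length of the local ring of the scheme-theoretic fiber at $x$. **Theorem.** The Hilbert polynomial of $LG(n)$ has degree $\dim LG(n)=\binom{n+1}{2}$, and: 1. *(Symmetric case.)* All $\varphi_z$ have degree at most $\delta$, and $\chi$ is well defined and is a central projection with center $\mathcal Z$. If $\mathcal Z\cap LG(n)=\emptyset$ and $\dim LG(n)=\binom{n+1}{2}=\delta$, then $\chi$ is surjective,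 and every fiber of $\chi$ is finite and has exactly $\deg LG(n)$ points, counted with multiplicity. 2. *(Hamiltonian case.)* $\delta$ is even, all $\varphi_z$ have degree at most $\delta$, and $\varphi_z(-s)=\varphi_z(s)$ for $z\in LG(n)$. The linear space $\mathcal Z'$ of all $z$ for which the even part of $\varphi_z$ vanishes satisfies $\mathcal Z'\cap LG(n)=\mathcal Z\cap LG(n)$, and $\chi'$ is well defined on $LG(n)\setminus\mathcal Z$ and is a central projection with center $\mathcal Z'$. If $\mathcal Z\cap LG(n)=\emptyset$ and $\dim LG(n)=\binom{n+1}{2}=\delta/2$, then $\chi'$ is surjective, and every fiber of $\chi'$ is finite and has exactly $\deg LG(n)$ points, counted with multiplicity. -/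

import Mathlib

open Polynomial Matrix
open scoped LinearAlgebra.Projectivization

noncomputable section

namespace SymmetricPoles

/-! ### Transfer functions -/

/-- The substitution `s ↦ -s` on rational functions. -/
def negArg : RatFunc ℂ ≃+* RatFunc ℂ :=
  IsFractionRing.ringEquivOfRingEquiv
    (Polynomial.algEquivAevalNegX (R := ℂ)).toRingEquiv

/-- `G(s)ᵗ = G(s)`. -/
def IsSymmetricTransfer {n : ℕ} (G : Matrix (Fin n) (Fin n) (RatFunc ℂ)) : Prop :=
  Gᵀ = G

/-- `G(-s)ᵗ = G(s)`. -/
def IsHamiltonianTransfer {n : ℕ} (G : Matrix (Fin n) (Fin n) (RatFunc ℂ)) : Prop :=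
  (G.map negArg)ᵀ = G

/-- Every entry vanishes at infinity (the degree of the zero polynomial is `⊥`). -/
def IsStrictlyProper {n : ℕ} (G : Matrix (Fin n) (Fin n) (RatFunc ℂ)) : Prop :=
  ∀ i j, (G i j).num.degree < (G i j).denom.degree

/-- `G = D⁻¹ N` with `D`, `N` left coprime polynomial matrices (Bezout identity). -/
structure IsLeftCoprimeFactorization {n : ℕ} (G : Matrix (Fin n) (Fin n) (RatFunc ℂ))
    (D N : Matrix (Fin n) (Fin n) ℂ[X]) : Prop where
  det_ne_zero : D.det ≠ 0
  mul_eq : D.map (algebraMap ℂ[X] (RatFunc ℂ)) * G = N.map (algebraMap ℂ[X] (RatFunc ℂ))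
  coprime : ∃ P Q : Matrix (Fin n) (Fin n) ℂ[X], D * P + N * Q = 1

/-- The McMillan degree of a strictly proper `G` is the degree of `det D` in a left coprime
factorization `G = D⁻¹ N`. -/
def HasMcMillanDegree {n : ℕ} (G : Matrix (Fin n) (Fin n) (RatFunc ℂ)) (δ : ℕ) : Prop :=
  ∃ D N, IsLeftCoprimeFactorization G D N ∧ D.det.natDegree = δ

/-! ### Projective varieties over `ℂ` -/

section Projective

variable {ι : Type} [Fintype ι] [DecidableEq ι]

/-- The homogeneous prime ideal of a point of projective space: all polynomials that vanish on
the line through the origin which the point is. -/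
def pointIdeal (x : ℙ ℂ (ι → ℂ)) : Ideal (MvPolynomial ι ℂ) :=
  RingHom.ker
    (MvPolynomial.aeval (fun i => C (x.rep i) * X) : MvPolynomial ι ℂ →ₐ[ℂ] ℂ[X]).toRingHom

instance (x : ℙ ℂ (ι → ℂ)) : (pointIdeal x).IsPrime := by
  exact RingHom.ker_isPrime _

/-- The homogeneous ideal of a subset of projective space. -/
def homogeneousIdeal (S : Set (ℙ ℂ (ι → ℂ))) : Ideal (MvPolynomial ι ℂ) :=
  ⨅ x ∈ S, pointIdeal x

/-- The Zariski closure of a subset of projective space. -/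
def zariskiClosure (S : Set (ℙ ℂ (ι → ℂ))) : Set (ℙ ℂ (ι → ℂ)) :=
  {x | homogeneousIdeal S ≤ pointIdeal x}

/-- The Hilbert function of the homogeneous coordinate ring of `S`. -/
def hilbertFunction (S : Set (ℙ ℂ (ι → ℂ))) (k : ℕ) : ℕ :=
  Module.finrank ℂ ((MvPolynomial.homogeneousSubmodule ι ℂ k).map
    (Ideal.Quotient.mkₐ ℂ (homogeneousIdeal S)).toLinearMap)

def IsHilbertPolynomial (S : Set (ℙ ℂ (ι → ℂ))) (P : ℚ[X]) : Prop :=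
  ∀ᶠ k : ℕ in Filter.atTop, P.eval (k : ℚ) = hilbertFunction S k

/-- `S` has dimension `r` and degree `d`: its Hilbert polynomial has degree `r` and leading
coefficient `d / r!`. -/
def HasDimensionAndDegree (S : Set (ℙ ℂ (ι → ℂ))) (r d : ℕ) : Prop :=
  ∃ P : ℚ[X], IsHilbertPolynomial S P ∧ P.degree = r ∧
    (Nat.factorial r : ℚ) * P.leadingCoeff = d

/-- The set of points of the projective linear subspace given by the linear subspace `E`. -/
def projectiveLocus (E : Submodule ℂ (ι → ℂ)) : Set (ℙ ℂ (ι → ℂ)) :=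
  {x | x.submodule ≤ E}

/-- The map `f : S → ℙ(W)` is the restriction to `S` of the central projection with center `E`
given by the linear map `L` (that is, by the linear forms which are the components of `L`):
the common zero space of the forms is `E`, and `f [v] = [L v]`, which makes sense for all
points of `S`. Equivalently, `f` is the canonical projection `ℙ(V) ∖ ℙ(E) → ℙ(V / E)`
followed by the linear embedding `ℙ(V / E) → ℙ(W)` that `L` induces. -/
def IsCentralProjection {W : Type} [AddCommGroup W] [Module ℂ W]
    (L : (ι → ℂ) →ₗ[ℂ] W) (E : Submodule ℂ (ι → ℂ))
    (S : Set (ℙ ℂ (ι → ℂ))) (f : S → ℙ ℂ W) : Prop :=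
  LinearMap.ker L = E ∧
  ∀ (v : ι → ℂ) (hv : v ≠ 0) (hS : Projectivization.mk ℂ v hv ∈ S),
    ∃ h : L v ≠ 0, f ⟨Projectivization.mk ℂ v hv, hS⟩ = Projectivization.mk ℂ (L v) h

/-- A linear form on `ℂ^ι` as a homogeneous polynomial of degree one. -/
def linearForm (g : (ι → ℂ) →ₗ[ℂ] ℂ) : MvPolynomial ι ℂ :=
  ∑ i, MvPolynomial.C (g (Pi.single i 1)) * MvPolynomial.X i

/-- The ideal of the fiber over `y` of the projection `[v] ↦ [L v]`: it is generated by the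
pullbacks `g ∘ L` of the linear forms `g` that vanish at `y`. -/
def fiberIdeal {W : Type} [AddCommGroup W] [Module ℂ W]
    (L : (ι → ℂ) →ₗ[ℂ] W) (y : ℙ ℂ W) : Ideal (MvPolynomial ι ℂ) :=
  Ideal.span {q | ∃ g : W →ₗ[ℂ] ℂ, g y.rep = 0 ∧ q = linearForm (g ∘ₗ L)}

/-- The multiplicity of the point `x` in the (scheme-theoretic) fiber over `y` of the projection
`[v] ↦ [L v]` restricted to `S`: the length of `A / (I(S) + I(fiber)) A`, where `A` is the
localization of the polynomial ring at the homogeneous prime ideal of `x`. -/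
def fiberMultiplicity {W : Type} [AddCommGroup W] [Module ℂ W]
    (S : Set (ℙ ℂ (ι → ℂ))) (L : (ι → ℂ) →ₗ[ℂ] W) (y : ℙ ℂ W) (x : ℙ ℂ (ι → ℂ)) : ℕ∞ :=
  Module.length (Localization.AtPrime (pointIdeal x))
    (Localization.AtPrime (pointIdeal x) ⧸
      (homogeneousIdeal S ⊔ fiberIdeal L y).map
        (algebraMap (MvPolynomial ι ℂ) (Localization.AtPrime (pointIdeal x))))

end Projective

/-! ### The Lagrangian Grassmannian -/

/-- `n`-element subsets of the `2n` columns; there are `N + 1 = binom(2n, n)` of them. -/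
abbrev PluckerIndex (n : ℕ) : Type := {s : Finset (Fin (n + n)) // s.card = n}

/-- The block matrix `[A B]`. -/
def rowBlock {n : ℕ} {R : Type} (A B : Matrix (Fin n) (Fin n) R) :
    Matrix (Fin n) (Fin (n + n)) R :=
  (Matrix.fromCols A B).submatrix id finSumFinEquiv.symm

/-- The Plücker coordinates of the row space of an `n × 2n` matrix. -/
def plucker {n : ℕ} {R : Type} [CommRing R] (M : Matrix (Fin n) (Fin (n + n)) R) :
    PluckerIndex n → R :=
  fun I => (M.submatrix id (I.1.orderEmbOfFin I.2)).det

/-- The points `rowsp [F I]`, `F` symmetric, in the Plücker embedding. (The Plücker vector is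
never zero here, since its last coordinate is `1`.) -/
def symmetricChart (n : ℕ) : Set (ℙ ℂ (PluckerIndex n → ℂ)) :=
  {x | ∃ F : Matrix (Fin n) (Fin n) ℂ, Fᵀ = F ∧
    ∃ h : plucker (rowBlock F 1) ≠ 0, x = Projectivization.mk ℂ (plucker (rowBlock F 1)) h}

/-- The complex Lagrangian Grassmann manifold `LG(n) ⊆ ℙ^N`. -/
def LG (n : ℕ) : Set (ℙ ℂ (PluckerIndex n → ℂ)) := zariskiClosure (symmetricChart n)

/-! ### The characteristic maps -/

/-- The square matrix with upper half `A` and lower half `B`. -/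
def stack {n : ℕ} {R : Type} (A B : Matrix (Fin n) (Fin (n + n)) R) :
    Matrix (Fin (n + n)) (Fin (n + n)) R :=
  (Matrix.fromRows A B).submatrix finSumFinEquiv.symm id

/-- The matrix whose rows are the unit vectors `e_i`, `i ∈ I`, in increasing order. -/
def unitRows {n : ℕ} (I : PluckerIndex n) : Matrix (Fin n) (Fin (n + n)) ℂ[X] :=
  Matrix.of fun i j => if j = I.1.orderEmbOfFin I.2 i then 1 else 0

/-- The cofactor `p_I(s)` of the Plücker coordinate `f_I` of `rowsp [F₁ F₂]` in
`det [D N; F₁ F₂]`: the value of this determinant at the coordinate subspace whose only nonzero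
Plücker coordinate is `f_I = 1`. See `det_stack`. -/
def cofactorPoly {n : ℕ} (D N : Matrix (Fin n) (Fin n) ℂ[X]) (I : PluckerIndex n) : ℂ[X] :=
  (stack (rowBlock D N) (unitRows I)).det

theorem stack_castAdd {n : ℕ} {R : Type} (A F : Matrix (Fin n) (Fin (n + n)) R) (i : Fin n)
    (k : Fin (n + n)) : stack A F (Fin.castAdd n i) k = A i k := by
  simp only [stack, Matrix.submatrix_apply, finSumFinEquiv_symm_apply_castAdd, id,
    Matrix.fromRows_apply_inl]

theorem stack_natAdd {n : ℕ} {R : Type} (A F : Matrix (Fin n) (Fin (n + n)) R) (i : Fin n)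
    (k : Fin (n + n)) : stack A F (Fin.natAdd n i) k = F i k := by
  simp only [stack, Matrix.submatrix_apply, finSumFinEquiv_symm_apply_natAdd, id,
    Matrix.fromRows_apply_inr]

theorem stack_update {n : ℕ} {R : Type} [DecidableEq (Fin n)]
    (A F : Matrix (Fin n) (Fin (n + n)) R) (i : Fin n) (x : Fin (n + n) → R) :
    stack A (F.updateRow i x) = (stack A F).updateRow (Fin.natAdd n i) x := by
  ext j k
  refine Fin.addCases (fun j => ?_) (fun j => ?_) j
  · rw [Matrix.updateRow_ne, stack_castAdd, stack_castAdd]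
    intro h
    have := congrArg Fin.val h
    simp only [Fin.val_castAdd, Fin.val_natAdd] at this
    omega
  · rw [stack_natAdd]
    by_cases h : j = i
    · subst h; rw [Matrix.updateRow_self, Matrix.updateRow_self]
    · rw [Matrix.updateRow_ne h, Matrix.updateRow_ne, stack_natAdd]
      intro h'
      apply h
      have := congrArg Fin.val h'
      simp only [Fin.val_natAdd] at this
      exact Fin.ext (by omega)

/-- `det [A; F]` as an alternating map of the rows of `F`. -/
def lowerDet {n : ℕ} (A : Matrix (Fin n) (Fin (n + n)) ℂ[X]) :
    (Fin (n + n) → ℂ[X]) [⋀^Fin n]→ₗ[ℂ[X]] ℂ[X] where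
  toFun F := (stack A (Matrix.of F)).det
  map_update_add' F i x y := by
    have h (z : Fin (n + n) → ℂ[X]) : Matrix.of (Function.update F i z) =
        (Matrix.of F).updateRow i z := rfl
    simp only [h, stack_update, Matrix.det_updateRow_add]
  map_update_smul' F i c x := by
    have h (z : Fin (n + n) → ℂ[X]) : Matrix.of (Function.update F i z) =
        (Matrix.of F).updateRow i z := rfl
    simp only [h, stack_update, Matrix.det_updateRow_smul, smul_eq_mul]
  map_eq_zero_of_eq' F i j hij hne := by
    refine Matrix.det_zero_of_row_eq (i := Fin.natAdd n i) (j := Fin.natAdd n j) ?_ ?_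
    · intro h'
      apply hne
      have := congrArg Fin.val h'
      simp only [Fin.val_natAdd] at this
      exact Fin.ext (by omega)
    · funext k
      rw [stack_natAdd, stack_natAdd, Matrix.of_apply, Matrix.of_apply, hij]

theorem plucker_unitRows {n : ℕ} (I J : PluckerIndex n) :
    plucker (unitRows I) J = if J = I then 1 else 0 := by
  split_ifs with h
  · subst h
    have : (unitRows J).submatrix id (J.1.orderEmbOfFin J.2) = 1 := by
      ext i j
      simp [unitRows, Matrix.one_apply, eq_comm]
    simp [plucker, this]
  · obtain ⟨i, hi⟩ : ∃ i, I.1.orderEmbOfFin I.2 i ∉ J.1 := by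
      by_contra! hc
      apply h
      apply Subtype.ext
      refine (Finset.eq_of_subset_of_card_le (fun x hx => ?_) (by rw [I.2, J.2])).symm
      have : x ∈ Set.range (I.1.orderEmbOfFin I.2) := by simpa using hx
      obtain ⟨i, rfl⟩ := this
      exact hc i
    refine Matrix.det_eq_zero_of_row_eq_zero i fun j => ?_
    simp only [unitRows, Matrix.submatrix_apply, Matrix.of_apply, id]
    rw [if_neg]
    intro h
    exact hi (h ▸ Finset.orderEmbOfFin_mem _ _ _)

theorem alternating_sum_apply {n : ℕ} {κ : Type} (t : Finset κ)
    (f : κ → (Fin (n + n) → ℂ[X]) [⋀^Fin n]→ₗ[ℂ[X]] ℂ[X]) (v : Fin n → Fin (n + n) → ℂ[X]) :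
    (∑ k ∈ t, f k) v = ∑ k ∈ t, f k v := by
  classical
  induction t using Finset.induction_on with
  | empty => simp
  | insert a t ha ih => rw [Finset.sum_insert ha, Finset.sum_insert ha, AlternatingMap.add_apply, ih]

/-- The Laplace expansion `det [A; F] = ∑ p_I f_I`. -/
theorem det_stack {n : ℕ} (D N : Matrix (Fin n) (Fin n) ℂ[X])
    (F : Matrix (Fin n) (Fin (n + n)) ℂ[X]) :
    (stack (rowBlock D N) F).det = ∑ I, plucker F I * cofactorPoly D N I := by
  have key : lowerDet (rowBlock D N) = ∑ I : PluckerIndex n, cofactorPoly D N I •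
      (Matrix.detRowAlternating (R := ℂ[X]) (n := Fin n)).compLinearMap
        (LinearMap.funLeft ℂ[X] ℂ[X] (I.1.orderEmbOfFin I.2)) := by
    refine Module.Basis.ext_alternating (Pi.basisFun ℂ[X] (Fin (n + n))) fun v hv => ?_
    have hcard : (Finset.univ.image v).card = n := by
      rw [Finset.card_image_of_injective _ hv]; simp
    let I : PluckerIndex n := ⟨Finset.univ.image v, hcard⟩
    have hmem : ∀ i, ∃ j, I.1.orderEmbOfFin I.2 j = v i := by
      intro i
      have : v i ∈ Set.range (I.1.orderEmbOfFin I.2) := by simp [I]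
      exact this
    choose σ hσ using hmem
    have hinj : Function.Injective σ := fun a b hab => hv (by rw [← hσ a, ← hσ b, hab])
    let e : Equiv.Perm (Fin n) := Equiv.ofBijective σ (Finite.injective_iff_bijective.mp hinj)
    let u : Fin n → Fin (n + n) → ℂ[X] := fun i j => unitRows I i j
    have hrows : (fun i => Pi.basisFun ℂ[X] (Fin (n + n)) (v i)) = u ∘ e := by
      funext i k
      change Pi.basisFun ℂ[X] (Fin (n + n)) (v i) k =
        if k = I.1.orderEmbOfFin I.2 (σ i) then 1 else 0
      rw [hσ, Pi.basisFun_apply, Pi.single_apply]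
    rw [hrows, AlternatingMap.map_perm, AlternatingMap.map_perm]
    congr 1
    have : ∀ J : PluckerIndex n, (cofactorPoly D N J •
      (Matrix.detRowAlternating (R := ℂ[X]) (n := Fin n)).compLinearMap
        (LinearMap.funLeft ℂ[X] ℂ[X] (J.1.orderEmbOfFin J.2))) u =
        cofactorPoly D N J * plucker (unitRows I) J := fun J => rfl
    rw [alternating_sum_apply]
    simp only [this, plucker_unitRows, mul_ite, mul_one, mul_zero, Finset.sum_ite_eq',
      Finset.mem_univ, if_true]
    rfl
  have h := congrArg (fun f => f (fun i j => F i j)) key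
  rw [alternating_sum_apply] at h
  exact h.trans (Finset.sum_congr rfl fun I _ => mul_comm _ _)

/-- The linear map `z ↦ ∑ p_I(s) z_I`. -/
def charPoly {n : ℕ} (D N : Matrix (Fin n) (Fin n) ℂ[X]) :
    (PluckerIndex n → ℂ) →ₗ[ℂ] ℂ[X] :=
  ∑ I, (LinearMap.proj I).smulRight (cofactorPoly D N I)

/-- The center `Z = {z | ∑ p_I(s) z_I = 0}`, as a linear subspace of `ℂ^(N+1)`. -/
def center {n : ℕ} (D N : Matrix (Fin n) (Fin n) ℂ[X]) : Submodule ℂ (PluckerIndex n → ℂ) :=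
  LinearMap.ker (charPoly D N)

/-- The coefficients of `1, s, …, s^δ` in `∑ p_I(s) z_I`. -/
def coeffMap {n : ℕ} (δ : ℕ) (D N : Matrix (Fin n) (Fin n) ℂ[X]) :
    (PluckerIndex n → ℂ) →ₗ[ℂ] (Fin (δ + 1) → ℂ) :=
  LinearMap.pi fun k => Polynomial.lcoeff ℂ (k : ℕ) ∘ₗ charPoly D N

/-- The coefficients of `1, s², s⁴, …, s^(2⌊δ/2⌋)` in `∑ p_I(s) z_I`. -/
def evenCoeffMap {n : ℕ} (δ : ℕ) (D N : Matrix (Fin n) (Fin n) ℂ[X]) :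
    (PluckerIndex n → ℂ) →ₗ[ℂ] (Fin (δ / 2 + 1) → ℂ) :=
  LinearMap.pi fun k => Polynomial.lcoeff ℂ (2 * (k : ℕ)) ∘ₗ charPoly D N

/-- The linear subspace on which the even part of `∑ p_I(s) z_I` vanishes. -/
def evenCenter {n : ℕ} (D N : Matrix (Fin n) (Fin n) ℂ[X]) :
    Submodule ℂ (PluckerIndex n → ℂ) :=
  LinearMap.ker (LinearMap.pi fun k : ℕ => Polynomial.lcoeff ℂ (2 * k) ∘ₗ charPoly D N)

/-- The point of `ℙ^m` with homogeneous coordinates `w` (arbitrary if `w = 0`). -/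
def toPoint {m : ℕ} (w : Fin (m + 1) → ℂ) : ℙ ℂ (Fin (m + 1) → ℂ) :=
  open Classical in
  if h : w = 0 then Projectivization.mk ℂ (fun _ => 1) (fun h0 => one_ne_zero (congrFun h0 0))
  else Projectivization.mk ℂ w h

/-- `LG(n) ∖ Z`. -/
def regularLocus {n : ℕ} (D N : Matrix (Fin n) (Fin n) ℂ[X]) :
    Set (ℙ ℂ (PluckerIndex n → ℂ)) :=
  LG n \ projectiveLocus (center D N)

/-- The characteristic map `χ : LG(n) ∖ Z → ℙ^δ`. -/
def chi {n : ℕ} (δ : ℕ) (D N : Matrix (Fin n) (Fin n) ℂ[X]) (x : regularLocus D N) :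
    ℙ ℂ (Fin (δ + 1) → ℂ) :=
  toPoint (coeffMap δ D N x.1.rep)

/-- The characteristic map `χ' : LG(n) ∖ Z → ℙ^(δ/2)`, given by the even part. -/
def chiEven {n : ℕ} (δ : ℕ) (D N : Matrix (Fin n) (Fin n) ℂ[X]) (x : regularLocus D N) :
    ℙ ℂ (Fin (δ / 2 + 1) → ℂ) :=
  toPoint (evenCoeffMap δ D N x.1.rep)

/-- Each fiber of `f : S → ℙ(W)`, where `f` is given by the linear map `L`, is a finite set
whose points, counted with multiplicity as points of the fiber in `T`, number `d`. -/
def FibersHaveCount {ι : Type} [Fintype ι] [DecidableEq ι] {W : Type} [AddCommGroup W]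
    [Module ℂ W] (T S : Set (ℙ ℂ (ι → ℂ))) (L : (ι → ℂ) →ₗ[ℂ] W) (f : S → ℙ ℂ W) (d : ℕ) :
    Prop :=
  ∀ y : ℙ ℂ W, {x : S | f x = y}.Finite ∧
    ∑ᶠ x ∈ {x : S | f x = y}, fiberMultiplicity T L y x.1 = (d : ℕ∞)

end SymmetricPoles

end

open SymmetricPoles

noncomputable section

set_option linter.unusedSectionVars false

namespace SymmetricPoles

/-! ### Homogeneous ideals of a polynomial ring -/

section HomogeneousIdeals

open MvPolynomial

attribute [local instance] MvPolynomial.gradedAlgebra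

variable {ι : Type}

/-! The geometric core is `surjective_and_fibersHaveCount`: if an `r`-dimensional projective variety
is covered by affine spaces, a linear projection to `ℙ^r` defined everywhere on it is onto and has
`deg` points in each fiber. The fiber over `y` is cut out by the `r`-dimensional space of linear
forms that come from hyperplanes through `y`. One further form, not vanishing at `y`, makes the
intersection empty, so the fiber is finite. On a chart the fiber is therefore a quotient of finite
dimension of a polynomial ring in `r` variables, and its ideal has depth `r` (`hasDepth_of_finite`).

Since a complex vector space is not a finite union of proper subspaces, the `r` forms can be chosen
one after another so that each is a nonzerodivisor on all charts simultaneously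
(`exists_notMem_forall_regular`). `HasDepth.sup_span` guarantees that enough depth is left after
every choice. A cut replaces the Hilbert polynomial `P(k)` by `P(k) - P(k-1)`, so after `r` cuts the
constant `r!` times the leading coefficient remains, which is the degree (`quotDim_section`). For a
finite scheme this constant is the sum of the local lengths, by a filtration whose factors are
coordinate rings of points, up to irrelevant factors (`finsum_localLength`). Positivity of the
degree gives surjectivity.

For `LG(n)` the charts are `F ↦ rowsp [F I + FB]` with `B` symmetric (`lagrangianCover`). They cover
because points of the closure are decomposable (`exists_plucker_eq_smul`) and every `n`-dimensional
subspace is transversal to some `rowsp [I B]` (`exists_symmetric_det_ne_zero`). Polynomials on one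
chart bound the Hilbert function on both sides by multiples of `k^r`, which gives dimension and
degree (`exists_dimension_degree_LG`).

On the systems side, the determinant at `[A B]` is `det D · det (B - A G)`. The valuation at
infinity then bounds its degree by `deg det D`. In the Hamiltonian case both factors have a definite
parity at `[F I]`, `F` symmetric: the second by transposition, the first because `D(-s)ᵗ` is the
denominator of a right coprime factorization of `G` (`negSubst_det`). A symmetric `F` whose
polynomial is nonzero at `s = 0` excludes odd `δ`. The odd coefficients are then linear forms
vanishing on the chart, hence on `LG(n)`. -/

/-- Homogeneous ideals of `ℂ[z_i : i ∈ ι]`. -/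
abbrev IsHomog (I : Ideal (MvPolynomial ι ℂ)) : Prop :=
  I.IsHomogeneous (homogeneousSubmodule ι ℂ)

theorem IsHomog.component_mem {I : Ideal (MvPolynomial ι ℂ)} (hI : IsHomog I)
    {f : MvPolynomial ι ℂ} (hf : f ∈ I) (k : ℕ) : homogeneousComponent k f ∈ I :=
  homogeneousComponent_mem_of_mem hI hf k

theorem isHomog_of_component_mem {I : Ideal (MvPolynomial ι ℂ)}
    (h : ∀ f ∈ I, ∀ k, homogeneousComponent k f ∈ I) : IsHomog I := by
  intro k f hf
  have := h f hf k
  rwa [← decomposition.decompose'_apply] at this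

theorem mem_of_components {I : Ideal (MvPolynomial ι ℂ)} {f : MvPolynomial ι ℂ}
    (h : ∀ k, homogeneousComponent k f ∈ I) : f ∈ I := by
  rw [← sum_homogeneousComponent f]
  exact Ideal.sum_mem _ fun k _ => h k

theorem component_mul_add {f g : MvPolynomial ι ℂ} {e : ℕ} (hf : f.IsHomogeneous e) (k : ℕ) :
    homogeneousComponent (k + e) (g * f) = homogeneousComponent k g * f := by
  conv_lhs => rw [← sum_homogeneousComponent g, Finset.sum_mul, map_sum]
  have h1 : ∀ i, homogeneousComponent (k + e) (homogeneousComponent i g * f) =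
      if i = k then homogeneousComponent k g * f else 0 := by
    intro i
    rw [homogeneousComponent_of_mem ((homogeneousComponent_isHomogeneous i g).mul hf)]
    by_cases h : i = k
    · subst h; simp
    · rw [if_neg h, if_neg]; omega
  simp only [h1, Finset.sum_ite_eq', Finset.mem_range]
  split_ifs with h
  · rfl
  · rw [homogeneousComponent_eq_zero k g (by omega), zero_mul]

theorem isHomog_sup_span {I : Ideal (MvPolynomial ι ℂ)} (hI : IsHomog I)
    {f : MvPolynomial ι ℂ} {e : ℕ} (hf : f.IsHomogeneous e) : IsHomog (I ⊔ Ideal.span {f}) :=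
  hI.sup (Ideal.homogeneous_span _ _ fun x hx => by
    rw [Set.mem_singleton_iff] at hx; exact ⟨e, by subst hx; exact hf⟩)

theorem isHomog_span {s : Set (MvPolynomial ι ℂ)} {e : ℕ} (hs : ∀ f ∈ s, f.IsHomogeneous e) :
    IsHomog (Ideal.span s) :=
  Ideal.homogeneous_span _ _ fun x hx => ⟨e, hs x hx⟩

/-- The ideal quotient `(I : f)` by a homogeneous element is homogeneous. -/
theorem isHomog_colon {I : Ideal (MvPolynomial ι ℂ)} (hI : IsHomog I)
    {f : MvPolynomial ι ℂ} {e : ℕ} (hf : f.IsHomogeneous e) : IsHomog (I.colon {f}) := by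
  refine isHomog_of_component_mem fun g hg k => ?_
  rw [Submodule.mem_colon_singleton, smul_eq_mul] at hg ⊢
  rw [← component_mul_add hf]
  exact hI.component_mem hg _

/-- A form of degree `k + e` in `I + (f)` is congruent modulo `I` to a multiple of `f`. -/
theorem exists_component_of_mem_sup {I : Ideal (MvPolynomial ι ℂ)} (hI : IsHomog I)
    {f h : MvPolynomial ι ℂ} {e k : ℕ} (hf : f.IsHomogeneous e) (hh : h.IsHomogeneous (k + e))
    (hmem : h ∈ I ⊔ Ideal.span {f}) :
    ∃ g : MvPolynomial ι ℂ, g.IsHomogeneous k ∧ h - g * f ∈ I := by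
  obtain ⟨i, hi, c, hc, rfl⟩ := Submodule.mem_sup.mp hmem
  obtain ⟨c, rfl⟩ := Ideal.mem_span_singleton'.mp hc
  refine ⟨homogeneousComponent k c, homogeneousComponent_isHomogeneous _ _, ?_⟩
  have := homogeneousComponent_of_mem (m := k + e) hh
  rw [if_pos rfl, map_add, component_mul_add hf] at this
  rw [← this, add_sub_cancel_right]
  exact hI.component_mem hi _

end HomogeneousIdeals

/-! ### Hilbert functions -/

section HilbertFunctions

open MvPolynomial

attribute [local instance] MvPolynomial.gradedAlgebra

variable {ι : Type}

/-- The Hilbert function of `ℂ[z] / I`. -/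
def quotDim (I : Ideal (MvPolynomial ι ℂ)) (k : ℕ) : ℕ :=
  Module.finrank ℂ ((homogeneousSubmodule ι ℂ k).map (Ideal.Quotient.mkₐ ℂ I).toLinearMap)

variable [Finite ι]

instance finite_homogeneousSubmodule (k : ℕ) : Module.Finite ℂ (homogeneousSubmodule ι ℂ k) :=
  Module.Finite.iff_fg.mpr (homogeneousSubmodule_fg ι ℂ k)

theorem finrank_map_add_finrank_inf_ker {V W : Type*} [AddCommGroup V] [Module ℂ V]
    [AddCommGroup W] [Module ℂ W] (g : V →ₗ[ℂ] W) (T : Submodule ℂ V) [Module.Finite ℂ T] :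
    Module.finrank ℂ (T.map g) + Module.finrank ℂ (T ⊓ LinearMap.ker g : Submodule ℂ V) =
      Module.finrank ℂ T := by
  rw [← (g.domRestrict T).finrank_range_add_finrank_ker, LinearMap.range_domRestrict,
    LinearMap.ker_domRestrict, add_right_inj, ← Submodule.map_comap_subtype]
  exact (LinearEquiv.finrank_eq (Submodule.equivMapOfInjective T.subtype
    T.injective_subtype _)).symm

theorem ker_mkₐ_toLinearMap (I : Ideal (MvPolynomial ι ℂ)) :
    LinearMap.ker (Ideal.Quotient.mkₐ ℂ I).toLinearMap = I.restrictScalars ℂ := by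
  ext f
  simp [Ideal.Quotient.eq_zero_iff_mem]

theorem quotDim_add (I : Ideal (MvPolynomial ι ℂ)) (k : ℕ) :
    quotDim I k + Module.finrank ℂ
      (homogeneousSubmodule ι ℂ k ⊓ I.restrictScalars ℂ : Submodule ℂ (MvPolynomial ι ℂ)) =
      Module.finrank ℂ (homogeneousSubmodule ι ℂ k) := by
  rw [← ker_mkₐ_toLinearMap]
  exact finrank_map_add_finrank_inf_ker _ _

theorem quotDim_eq_zero {I : Ideal (MvPolynomial ι ℂ)} {k : ℕ}
    (h : ∀ f : MvPolynomial ι ℂ, f.IsHomogeneous k → f ∈ I) : quotDim I k = 0 := by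
  have h1 := quotDim_add I k
  rw [inf_eq_left.mpr (show homogeneousSubmodule ι ℂ k ≤ I.restrictScalars ℂ from h)] at h1
  omega

theorem mem_of_quotDim_eq_zero {I : Ideal (MvPolynomial ι ℂ)} {k : ℕ} (h : quotDim I k = 0)
    {f : MvPolynomial ι ℂ} (hf : f.IsHomogeneous k) : f ∈ I := by
  have h1 := quotDim_add I k
  rw [h, zero_add] at h1
  have := Submodule.eq_of_le_of_finrank_eq inf_le_left h1
  exact (inf_eq_left.mp this) hf

/-- The exact sequence `0 → A/(I : f) → A/I → A/(I + (f)) → 0` in a fixed degree. -/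
theorem quotDim_sup_span {I P : Ideal (MvPolynomial ι ℂ)} (hI : IsHomog I)
    {f : MvPolynomial ι ℂ} {e k : ℕ} (hf : f.IsHomogeneous e)
    (hP : ∀ g : MvPolynomial ι ℂ, g.IsHomogeneous k → (g ∈ P ↔ g * f ∈ I)) :
    quotDim (I ⊔ Ideal.span {f}) (k + e) + quotDim P k = quotDim I (k + e) := by
  set I' := I ⊔ Ideal.span {f} with hI'
  set m := (Ideal.Quotient.mkₐ ℂ I).toLinearMap with hm
  have h1 := quotDim_add I' (k + e)
  have h2 := quotDim_add I (k + e)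
  have h3 := quotDim_add P k
  have : Module.Finite ℂ (homogeneousSubmodule ι ℂ (k + e) ⊓ I'.restrictScalars ℂ : Submodule ℂ (MvPolynomial ι ℂ)) :=
    Submodule.finiteDimensional_inf_left _ _
  have h4 := finrank_map_add_finrank_inf_ker m (homogeneousSubmodule ι ℂ (k + e) ⊓ I'.restrictScalars ℂ)
  have h5 := finrank_map_add_finrank_inf_ker (m ∘ₗ LinearMap.mulRight ℂ f) (homogeneousSubmodule ι ℂ k)
  have h6 : homogeneousSubmodule ι ℂ (k + e) ⊓ I'.restrictScalars ℂ ⊓ LinearMap.ker m =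
      homogeneousSubmodule ι ℂ (k + e) ⊓ I.restrictScalars ℂ := by
    rw [hm, ker_mkₐ_toLinearMap, inf_assoc]
    congr 1
    exact inf_eq_right.mpr (fun x hx => Ideal.mem_sup_left hx)
  have h7 : homogeneousSubmodule ι ℂ k ⊓ LinearMap.ker (m ∘ₗ LinearMap.mulRight ℂ f) = homogeneousSubmodule ι ℂ k ⊓ P.restrictScalars ℂ := by
    ext g
    simp only [Submodule.mem_inf, LinearMap.mem_ker, LinearMap.comp_apply, hm,
      AlgHom.toLinearMap_apply, Ideal.Quotient.mkₐ_eq_mk, Ideal.Quotient.eq_zero_iff_mem,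
      LinearMap.mulRight_apply, Submodule.restrictScalars_mem]
    exact and_congr_right fun hg => (hP g hg).symm
  -- Modulo `I`, the part of `I + (f)` in degree `k + e` consists of the multiples of `f` by forms
  -- of degree `k`.
  have h8 : (homogeneousSubmodule ι ℂ (k + e) ⊓ I'.restrictScalars ℂ).map m =
      (homogeneousSubmodule ι ℂ k).map (m ∘ₗ LinearMap.mulRight ℂ f) := by
    ext x
    constructor
    · rintro ⟨h, ⟨hh1, hh2⟩, rfl⟩
      obtain ⟨g, hg, hgf⟩ := exists_component_of_mem_sup hI hf hh1 hh2
      refine ⟨g, hg, ?_⟩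
      simp only [hm, LinearMap.comp_apply, AlgHom.toLinearMap_apply, Ideal.Quotient.mkₐ_eq_mk,
        LinearMap.mulRight_apply]
      exact (Ideal.Quotient.eq.mpr hgf).symm
    · rintro ⟨g, hg, rfl⟩
      exact ⟨g * f, ⟨IsHomogeneous.mul hg hf,
        Ideal.mem_sup_right (Ideal.mul_mem_left _ _ (Ideal.mem_span_singleton_self f))⟩, rfl⟩
  rw [h6, h8] at h4
  rw [h7] at h5
  omega

/-- Forms of degree `≥ k` are products of forms of degree `k` in the ideal generated by them. -/
theorem mem_of_forall_isHomogeneous_le {I : Ideal (MvPolynomial ι ℂ)} {k m : ℕ} (hkm : k ≤ m)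
    (h : ∀ f : MvPolynomial ι ℂ, f.IsHomogeneous k → f ∈ I) {f : MvPolynomial ι ℂ}
    (hf : f.IsHomogeneous m) : f ∈ I := by
  obtain ⟨j, rfl⟩ := Nat.exists_eq_add_of_le hkm
  have h1 : f ∈ homogeneousSubmodule ι ℂ (k + j) := hf
  rw [← homogeneousSubmodule_one_pow, pow_add, homogeneousSubmodule_one_pow] at h1
  refine Submodule.mul_induction_on h1 (fun a ha b _ => ?_) fun a b ha hb => Ideal.add_mem _ ha hb
  exact Ideal.mul_mem_right _ _ (h a ha)

/-- If every variable is in the radical of `I`, all forms of large degree are in `I`. -/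
theorem exists_forall_mem_of_X_mem_radical {I : Ideal (MvPolynomial ι ℂ)}
    (h : ∀ i, (X i : MvPolynomial ι ℂ) ∈ I.radical) :
    ∃ N, ∀ k, N ≤ k → ∀ f : MvPolynomial ι ℂ, f.IsHomogeneous k → f ∈ I := by
  have h1 : Ideal.span (Set.range (X : ι → MvPolynomial ι ℂ)) ≤ I.radical := by
    rw [Ideal.span_le]; rintro _ ⟨i, rfl⟩; exact h i
  obtain ⟨N, hN⟩ := Ideal.exists_pow_le_of_le_radical_of_fg h1 (IsNoetherian.noetherian _)
  refine ⟨N, fun k hk f hf => mem_of_forall_isHomogeneous_le hk (fun g hg => hN ?_) hf⟩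
  have hg' : g ∈ homogeneousSubmodule ι ℂ N := hg
  rw [← homogeneousSubmodule_one_pow, homogeneousSubmodule_one_eq_span_X] at hg'
  have : (Submodule.span ℂ (Set.range (X : ι → MvPolynomial ι ℂ))) ^ N ≤
      ((Ideal.span (Set.range (X : ι → MvPolynomial ι ℂ))) ^ N).restrictScalars ℂ := by
    clear hN hg hg' hk
    induction N with
    | zero => simp
    | succ N ih =>
      rw [pow_succ, Submodule.mul_le]
      intro a ha b hb
      rw [Submodule.restrictScalars_mem, pow_succ]
      refine Ideal.mul_mem_mul (ih ha) ?_
      exact Submodule.span_le_restrictScalars ℂ (MvPolynomial ι ℂ) _ hb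
  exact this hg'

/-- If every product of a variable power with `K` lies in `I`, then `K` and `I` agree in large
degrees. -/
theorem exists_forall_mem_of_torsion {I K : Ideal (MvPolynomial ι ℂ)} (hK : IsHomog K)
    (h : ∀ i, (X i : MvPolynomial ι ℂ) ∈ (I.colon (K : Set (MvPolynomial ι ℂ))).radical) :
    ∃ N, ∀ k, N ≤ k → ∀ f : MvPolynomial ι ℂ, f.IsHomogeneous k → f ∈ K → f ∈ I := by
  obtain ⟨N, hN⟩ := exists_forall_mem_of_X_mem_radical h
  obtain ⟨s, hs⟩ := (IsNoetherian.noetherian K : K.FG)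
  -- In an expansion of `f` in the generators, the degree `k` part pairs a generator component of
  -- degree `j` with a coefficient component of degree `k - j`. The bound makes `k - j` at least
  -- `N`.
  refine ⟨N + s.sup totalDegree, fun k hk f hf hfK => ?_⟩
  have hc := homogeneousComponent_of_mem (m := k) hf
  rw [if_pos rfl] at hc
  rw [← hs] at hfK
  obtain ⟨c, -, rfl⟩ := Submodule.mem_span_finset.mp hfK
  rw [← hc, map_sum]
  refine Ideal.sum_mem _ fun g hg => ?_
  rw [smul_eq_mul]
  rw [← sum_homogeneousComponent g, Finset.mul_sum, map_sum, sum_homogeneousComponent g]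
  refine Ideal.sum_mem _ fun j hj => ?_
  have hj' : j ≤ s.sup totalDegree := by
    have := Finset.le_sup (f := totalDegree) hg
    rw [Finset.mem_range] at hj
    omega
  obtain ⟨i, rfl⟩ := Nat.exists_eq_add_of_le (show j ≤ k by omega)
  rw [add_comm j i, component_mul_add (homogeneousComponent_isHomogeneous _ _)]
  have h1 := hN i (by omega) _ (homogeneousComponent_isHomogeneous i (c g))
  rw [Submodule.mem_colon] at h1
  exact h1 _ (hK.component_mem (hs ▸ Submodule.subset_span hg) _)

end HilbertFunctions

/-! ### Generic elements avoiding zero divisors -/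

/-- A vector space mapping to finitely many Noetherian rings contains a vector outside a given
proper subspace that is a nonzerodivisor modulo given ideals, as soon as no nonzero residue class
is annihilated by the whole space. -/
theorem exists_notMem_forall_regular {J : Type*} [Finite J] {S : J → Type*}
    [∀ j, CommRing (S j)] [∀ j, Algebra ℂ (S j)] [∀ j, IsNoetherianRing (S j)] {V : Type*}
    [AddCommGroup V] [Module ℂ V] (φ : ∀ j, V →ₗ[ℂ] S j) (a : ∀ j, Ideal (S j))
    (h : ∀ j, ∀ z, z ∉ a j → ∃ v, φ j v * z ∉ a j) (W : Submodule ℂ V) (hW : W ≠ ⊤) :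
    ∃ v, v ∉ W ∧ ∀ j z, φ j v * z ∈ a j → z ∈ a j := by
  by_contra! hcon
  have hfin : ∀ j, Finite (associatedPrimes (S j) (S j ⧸ a j)) := fun j =>
    (associatedPrimes.finite (S j) (S j ⧸ a j)).to_subtype
  -- If the claim fails, `V` is the union of `W` and the preimages of the finitely many associated
  -- primes, so one of these subspaces is all of `V`. For an associated prime this says that `V`
  -- annihilates a nonzero residue class.
  let p : Option (Σ j, associatedPrimes (S j) (S j ⧸ a j)) → Subspace ℂ V := fun o =>
    match o with
    | none => W
    | some ⟨j, P⟩ => (P.1.restrictScalars ℂ).comap (φ j)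
  have hcov : ⋃ i, (p i : Set V) = Set.univ := by
    rw [Set.eq_univ_iff_forall]
    intro v
    rw [Set.mem_iUnion]
    by_cases hv : v ∈ W
    · exact ⟨none, hv⟩
    obtain ⟨j, z, hz, hz'⟩ := hcon v hv
    have h1 : φ j v ∈ ⋃ P ∈ associatedPrimes (S j) (S j ⧸ a j), (P : Set (S j)) := by
      rw [biUnion_associatedPrimes_eq_zero_divisors]
      refine ⟨Ideal.Quotient.mk _ z, fun h0 => hz' (Ideal.Quotient.eq_zero_iff_mem.mp h0), ?_⟩
      rw [← Ideal.Quotient.mk_eq_mk, ← Submodule.Quotient.mk_smul]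
      exact Ideal.Quotient.eq_zero_iff_mem.mpr hz
    rw [Set.mem_iUnion₂] at h1
    obtain ⟨P, hP, hvP⟩ := h1
    exact ⟨some ⟨j, P, hP⟩, hvP⟩
  obtain ⟨i, hi⟩ := Subspace.exists_eq_top_of_iUnion_eq_univ hcov
  match i, hi with
  | none, hi => exact hW hi
  | some ⟨j, P, hP⟩, hi =>
    rw [AssociatedPrimes.mem_iff, isAssociatedPrime_iff] at hP
    obtain ⟨hprime, z, hz⟩ := hP
    obtain ⟨z, rfl⟩ := Ideal.Quotient.mk_surjective z
    have hmem : ∀ s : S j, s ∈ P ↔ s * z ∈ a j := fun s => by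
      rw [hz, Submodule.mem_colon_singleton, Submodule.mem_bot, ← Ideal.Quotient.eq_zero_iff_mem]
      rfl
    have hza : z ∉ a j := fun hza => hprime.ne_top
      ((Ideal.eq_top_iff_one _).mpr ((hmem 1).mpr (by rwa [one_mul])))
    obtain ⟨v, hv⟩ := h j z hza
    have hv' : v ∈ p (some ⟨j, P, hP⟩) := hi ▸ Submodule.mem_top
    exact hv ((hmem _).mp hv')

/-! ### Differences of polynomials -/

/-- Monomials suffice by additivity, and Bernoulli polynomials satisfy `B_{n+1}(x+1) - B_{n+1}(x) =
(n+1) x^n`. -/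
theorem exists_antidifference (Q : ℚ[X]) :
    ∃ P : ℚ[X], ∀ x : ℚ, P.eval (x + 1) - P.eval x = Q.eval x := by
  induction Q using Polynomial.induction_on' with
  | add Q₁ Q₂ h₁ h₂ =>
    obtain ⟨P₁, h₁⟩ := h₁
    obtain ⟨P₂, h₂⟩ := h₂
    refine ⟨P₁ + P₂, fun x => ?_⟩
    rw [eval_add, eval_add, eval_add, ← h₁, ← h₂]
    ring
  | monomial n c =>
    refine ⟨Polynomial.C (c / (n + 1 : ℕ)) * Polynomial.bernoulli (n + 1), fun x => ?_⟩
    have h := Polynomial.bernoulli_eval_one_add (n + 1) x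
    rw [add_comm 1 x] at h
    have hn : ((n + 1 : ℕ) : ℚ) ≠ 0 := by positivity
    simp only [eval_mul, eval_C, h, eval_monomial, Nat.add_sub_cancel]
    field_simp
    ring

/-- The coefficients of `P(x - 1)` are Hasse derivatives of `P` at `-1`. From index `m` on these
have degree at most one, so only two terms matter. This describes the effect of a hyperplane section
on the Hilbert polynomial. -/
theorem coeff_sub_taylor {P : ℚ[X]} {m : ℕ} (hP : P.natDegree ≤ m + 1) :
    (P - taylor (-1) P).natDegree ≤ m ∧
      (P - taylor (-1) P).coeff m = (m + 1) * P.coeff (m + 1) := by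
  have hc : ∀ j, m + 1 < j → P.coeff j = 0 := fun j hj => coeff_eq_zero_of_natDegree_lt (by omega)
  have hd : ∀ i, m ≤ i → (hasseDeriv i P).natDegree < 2 := by
    intro i hi
    have := natDegree_hasseDeriv_le P i
    omega
  constructor
  · rw [natDegree_le_iff_coeff_eq_zero]
    intro i hi
    rw [coeff_sub, taylor_coeff, eval_eq_sum_range' (hd i hi.le), Finset.sum_range_succ,
      Finset.sum_range_one, hasseDeriv_coeff, hasseDeriv_coeff, hc (1 + i) (by omega)]
    simp
  · rw [coeff_sub, taylor_coeff, eval_eq_sum_range' (hd m le_rfl), Finset.sum_range_succ,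
      Finset.sum_range_one, hasseDeriv_coeff, hasseDeriv_coeff, add_comm 1 m, zero_add,
      Nat.choose_self, Nat.choose_succ_self_right]
    push_cast
    ring

/-! ### The Hilbert polynomial -/

section HilbertPolynomial

open MvPolynomial

attribute [local instance] MvPolynomial.gradedAlgebra

variable {ι : Type} [Finite ι]

/-- The projective Nullstellensatz. -/
theorem exists_forall_mem_of_zeros {I : Ideal (MvPolynomial ι ℂ)}
    (h : ∀ c : ι → ℂ, (∀ f ∈ I, eval c f = 0) → c = 0) :
    ∃ N, ∀ k, N ≤ k → ∀ f : MvPolynomial ι ℂ, f.IsHomogeneous k → f ∈ I := by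
  refine exists_forall_mem_of_X_mem_radical fun i => ?_
  rw [← vanishingIdeal_zeroLocus_eq_radical (K := ℂ)]
  intro c hc
  have := h c fun f hf => by
    have := hc f hf
    rwa [← MvPolynomial.coe_aeval_eq_eval]
  simp [this]

/-- If multiplication by the linear form `u` is injective on `A/I` in large degrees, the Hilbert
function of `A/(I + (u))` is the difference of that of `A/I`. -/
theorem quotDim_sup_linear {I : Ideal (MvPolynomial ι ℂ)} (hI : IsHomog I) {u : MvPolynomial ι ℂ}
    (hu : u.IsHomogeneous 1) {k : ℕ}
    (h : ∀ f : MvPolynomial ι ℂ, f.IsHomogeneous k → u * f ∈ I → f ∈ I) :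
    quotDim (I ⊔ Ideal.span {u}) (k + 1) + quotDim I k = quotDim I (k + 1) :=
  quotDim_sup_span hI hu fun g hg =>
    ⟨fun hgI => Ideal.mul_mem_right _ _ hgI, fun hgu => h g hg (by rwa [mul_comm])⟩

/-- The largest homogeneous ideal which agrees with `I` in all large degrees. -/
theorem exists_saturation {I : Ideal (MvPolynomial ι ℂ)} (hI : IsHomog I) :
    ∃ K : Ideal (MvPolynomial ι ℂ), IsHomog K ∧ I ≤ K ∧
      (∃ N, ∀ k, N ≤ k → ∀ f : MvPolynomial ι ℂ, f.IsHomogeneous k → f ∈ K → f ∈ I) ∧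
      ∀ z, z ∉ K → ∃ u : MvPolynomial ι ℂ, u.IsHomogeneous 1 ∧ u * z ∉ K := by
  obtain ⟨K, ⟨hK, hIK, N, hN⟩, hmax⟩ := set_has_maximal_iff_noetherian.mpr
    (inferInstance : IsNoetherian (MvPolynomial ι ℂ) (MvPolynomial ι ℂ))
    {K : Ideal (MvPolynomial ι ℂ) | IsHomog K ∧ I ≤ K ∧
      ∃ N, ∀ k, N ≤ k → ∀ f : MvPolynomial ι ℂ, f.IsHomogeneous k → f ∈ K → f ∈ I}
    ⟨I, hI, le_rfl, 0, fun _ _ _ _ h => h⟩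
  refine ⟨K, hK, hIK, ⟨N, hN⟩, fun z hz => ?_⟩
  by_contra! hcon
  obtain ⟨e, he⟩ : ∃ e, homogeneousComponent e z ∉ K := by
    by_contra! h
    exact hz (mem_of_components h)
  have hze := homogeneousComponent_isHomogeneous e z
  have hu : ∀ u : MvPolynomial ι ℂ, u.IsHomogeneous 1 →
      u ∈ K.colon {homogeneousComponent e z} := fun u hu => by
    rw [Submodule.mem_colon_singleton, smul_eq_mul, mul_comm]
    have := hK.component_mem (hcon u hu) (e + 1)
    rwa [mul_comm, component_mul_add hu] at this
  -- If every linear form sends `z` into `K`, adjoining the component `z_e` adds nothing in degrees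
  -- above `e`. The enlarged ideal still agrees with `I` in large degrees, against maximality.
  refine hmax (K ⊔ Ideal.span {homogeneousComponent e z})
    ⟨isHomog_sup_span hK hze, hIK.trans le_sup_left, N + e + 1, fun k hk f hf hfK => ?_⟩ ?_
  · obtain ⟨j, rfl⟩ := Nat.exists_eq_add_of_le (show e ≤ k by omega)
    rw [add_comm e j] at hf
    obtain ⟨g, hg, hgf⟩ := exists_component_of_mem_sup hK hze hf hfK
    have h1 := mem_of_forall_isHomogeneous_le (show 1 ≤ j by omega) hu hg
    rw [Submodule.mem_colon_singleton, smul_eq_mul] at h1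
    refine hN _ (by omega) f hf ?_
    have := K.add_mem hgf h1
    rwa [sub_add_cancel] at this
  · refine lt_of_le_of_ne le_sup_left fun h => he ?_
    rw [h]
    exact Ideal.mem_sup_right (Ideal.mem_span_singleton_self _)

/-- The Hilbert function of a homogeneous ideal is eventually polynomial. -/
theorem exists_hilbert_polynomial (I : Ideal (MvPolynomial ι ℂ)) (hI : IsHomog I) :
    ∃ P : ℚ[X], ∀ᶠ k : ℕ in Filter.atTop, P.eval (k : ℚ) = quotDim I k := by
  induction hn : quotDim I 1 using Nat.strong_induction_on generalizing I with
  | _ n ih =>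
  by_cases hn0 : n = 0
  · refine ⟨0, Filter.eventually_atTop.mpr ⟨1, fun k hk => ?_⟩⟩
    rw [quotDim_eq_zero fun f hf => mem_of_forall_isHomogeneous_le hk
      (fun g hg => mem_of_quotDim_eq_zero (hn.trans hn0) hg) hf]
    simp
  obtain ⟨K, hK, hIK, ⟨N, hN⟩, hreg⟩ := exists_saturation hI
  -- The form `u` must be regular modulo the saturation, so that multiplication by it is injective
  -- in large degrees. It must also lie outside `I`, so that the induction on the dimension in
  -- degree one proceeds.
  obtain ⟨u, huI, hu⟩ := exists_notMem_forall_regular (J := Unit) (S := fun _ => MvPolynomial ι ℂ)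
    (φ := fun _ => (homogeneousSubmodule ι ℂ 1).subtype) (fun _ => K)
    (fun _ z hz => by
      obtain ⟨u, hu, huz⟩ := hreg z hz
      exact ⟨⟨u, hu⟩, huz⟩)
    ((I.restrictScalars ℂ).comap (homogeneousSubmodule ι ℂ 1).subtype) (fun htop => by
      apply hn0
      rw [← hn]
      refine quotDim_eq_zero fun f hf => ?_
      have : (⟨f, hf⟩ : homogeneousSubmodule ι ℂ 1) ∈
        (I.restrictScalars ℂ).comap (homogeneousSubmodule ι ℂ 1).subtype := htop ▸ Submodule.mem_top
      exact this)
  obtain ⟨u, hu1⟩ := u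
  have huI : u ∉ I := huI
  have hu : ∀ z, u * z ∈ K → z ∈ K := hu ()
  -- In degree zero `(I : u)` agrees with `I`, because a nonzero constant multiple of `u` is not in
  -- `I`. Hence dividing by `u` lowers the dimension in degree one by that in degree zero, which is
  -- nonzero.
  have hlt : quotDim (I ⊔ Ideal.span {u}) 1 < n := by
    have h1 := quotDim_sup_span (P := I) (k := 0) hI hu1 (fun g hg => by
      obtain ⟨c, rfl⟩ : ∃ c, g = MvPolynomial.C c := by
        have := homogeneousComponent_of_mem (m := 0) hg
        rw [if_pos rfl, homogeneousComponent_zero] at this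
        exact ⟨_, this.symm⟩
      by_cases hc : c = 0
      · simp [hc]
      · refine ⟨fun h => Ideal.mul_mem_right _ _ h, fun h => absurd ?_ huI⟩
        have := Ideal.mul_mem_left I (MvPolynomial.C c⁻¹) h
        rwa [← mul_assoc, ← map_mul, inv_mul_cancel₀ hc, map_one, one_mul] at this)
    have h2 : quotDim I 0 ≠ 0 := fun h0 => huI (by
      have := mem_of_quotDim_eq_zero h0 (isHomogeneous_one ι ℂ)
      rw [(Ideal.eq_top_iff_one I).mpr this]
      trivial)
    rw [zero_add] at h1
    omega
  obtain ⟨Q, hQ⟩ := ih _ hlt _ (isHomog_sup_span hI hu1) rfl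
  obtain ⟨M, hM⟩ := Filter.eventually_atTop.mp hQ
  -- The shift appears because `H(k+1) - H(k)` is the Hilbert function of the section at `k + 1`,
  -- while the antidifference is taken at `k`.
  obtain ⟨P, hP⟩ := exists_antidifference (Q.comp (Polynomial.X + 1))
  have hstep : ∀ k, max N M ≤ k →
      (quotDim I (k + 1) : ℚ) - P.eval ((k + 1 : ℕ) : ℚ) = quotDim I k - P.eval (k : ℚ) := by
    intro k hk
    have h1 := quotDim_sup_linear hI hu1 (k := k) fun f hf huf =>
      hN k (le_trans (le_max_left _ _) hk) f hf (hu f (hIK huf))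
    have h2 := hM (k + 1) (by omega)
    have h3 := hP k
    rw [eval_comp, Polynomial.eval_add, Polynomial.eval_X, eval_one] at h3
    push_cast at h2 ⊢
    rw [← h1]
    push_cast
    linarith
  refine ⟨P + Polynomial.C ((quotDim I (max N M) : ℚ) - P.eval ((max N M : ℕ) : ℚ)),
    Filter.eventually_atTop.mpr ⟨max N M, fun k hk => ?_⟩⟩
  rw [Polynomial.eval_add, Polynomial.eval_C]
  induction k, hk using Nat.le_induction with
  | base => ring
  | succ k hk ih' =>
    have := hstep k hk
    linarith

end HilbertPolynomial

/-! ### Depth -/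

theorem exists_forall_regular {J : Type*} [Finite J] {S : J → Type*}
    [∀ j, CommRing (S j)] [∀ j, Algebra ℂ (S j)] [∀ j, IsNoetherianRing (S j)] {V : Type*}
    [AddCommGroup V] [Module ℂ V] (φ : ∀ j, V →ₗ[ℂ] S j) (a : ∀ j, Ideal (S j))
    (h : ∀ j, ∀ z, z ∉ a j → ∃ v, φ j v * z ∉ a j) :
    ∃ v, ∀ j z, φ j v * z ∈ a j → z ∈ a j := by
  rcases subsingleton_or_nontrivial V with hV | hV
  · refine ⟨0, fun j z _ => ?_⟩
    by_contra hz
    obtain ⟨v, hv⟩ := h j z hz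
    rw [Subsingleton.elim v 0, map_zero, zero_mul] at hv
    exact hv (a j).zero_mem
  · obtain ⟨v, -, hv⟩ := exists_notMem_forall_regular φ a h ⊥ bot_ne_top
    exact ⟨v, hv⟩

/-- `J` contains a regular sequence of length `k` on `S/a` (with `S/(a + J) = 0` allowed). -/
def HasDepth {S : Type*} [CommRing S] (J : Ideal S) : ℕ → Ideal S → Prop
  | 0, _ => True
  | k + 1, a => ∃ x ∈ J, (∀ z, x * z ∈ a → z ∈ a) ∧ HasDepth J k (a ⊔ Ideal.span {x})

/-! ### Exchanging elements of regular sequences -/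

section Exchange

variable {S : Type*} [CommRing S]

theorem exists_eq_of_mem_sup_span {a : Ideal S} {x z : S} (h : z ∈ a ⊔ Ideal.span {x}) :
    ∃ c, z - x * c ∈ a := by
  obtain ⟨i, hi, c, hc, rfl⟩ := Submodule.mem_sup.mp h
  obtain ⟨c, rfl⟩ := Ideal.mem_span_singleton'.mp hc
  exact ⟨c, by rwa [mul_comm x c, add_sub_cancel_right]⟩

theorem mem_sup_span_of_sub_mem {a : Ideal S} {x z c : S} (h : z - x * c ∈ a) :
    z ∈ a ⊔ Ideal.span {x} := by
  rw [← sub_add_cancel z (x * c)]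
  exact Ideal.add_mem _ (Ideal.mem_sup_left h)
    (Ideal.mem_sup_right (Ideal.mul_mem_right _ _ (Ideal.mem_span_singleton_self x)))

/-- A relation `x z ≡ w m` modulo `a` forces `m ≡ x m'` by regularity of `w` modulo `a + (x)`.
Cancelling `x` then gives `z ≡ w m'`. -/
theorem regular_swap {a : Ideal S} {x w : S} (hx : ∀ z, x * z ∈ a → z ∈ a)
    (hwx : ∀ z, w * z ∈ a ⊔ Ideal.span {x} → z ∈ a ⊔ Ideal.span {x}) (z : S)
    (hz : x * z ∈ a ⊔ Ideal.span {w}) : z ∈ a ⊔ Ideal.span {w} := by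
  obtain ⟨m, hm⟩ := exists_eq_of_mem_sup_span hz
  have h1 : w * m - x * z ∈ a := by
    rw [← neg_sub]; exact a.neg_mem hm
  obtain ⟨m', hm'⟩ := exists_eq_of_mem_sup_span (hwx m (mem_sup_span_of_sub_mem h1))
  refine mem_sup_span_of_sub_mem (c := m') (hx _ ?_)
  have h2 := a.add_mem hm (a.mul_mem_left w hm')
  convert h2 using 1
  ring

/-- Elements annihilated by `J` can be transported between `S/(a + (y))` and `S/(a + (x))`;
abstractly both describe `Ext¹(S/J, S/a)` when `x` and `y` lie in `J`. If `J` kills `z` modulo `a +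
(y)`, write `x z ≡ y w`. Then `J` kills `w` modulo `a + (x)`, so `x'` forces `w ≡ x w'`, and
cancelling `x` gives `z ≡ y w'`. -/
theorem exists_mul_notMem_sup {J a : Ideal S} {x y x' : S} (hxJ : x ∈ J)
    (hx : ∀ z, x * z ∈ a → z ∈ a) (hy : ∀ z, y * z ∈ a → z ∈ a) (hxJ' : x' ∈ J)
    (hx' : ∀ z, x' * z ∈ a ⊔ Ideal.span {x} → z ∈ a ⊔ Ideal.span {x}) (z : S)
    (hz : z ∉ a ⊔ Ideal.span {y}) : ∃ v ∈ J, v * z ∉ a ⊔ Ideal.span {y} := by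
  by_contra! hcon
  obtain ⟨w, hw⟩ := exists_eq_of_mem_sup_span (hcon x hxJ)
  have hJw : ∀ v ∈ J, v * w ∈ a ⊔ Ideal.span {x} := fun v hv => by
    obtain ⟨t, ht⟩ := exists_eq_of_mem_sup_span (hcon v hv)
    refine mem_sup_span_of_sub_mem (c := t) (hy _ ?_)
    have := a.sub_mem (a.mul_mem_left x ht) (a.mul_mem_left v hw)
    convert this using 1
    ring
  obtain ⟨w', hw'⟩ := exists_eq_of_mem_sup_span (hx' w (hJw x' hxJ'))
  refine hz (mem_sup_span_of_sub_mem (c := w') (hx _ ?_))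
  have := a.add_mem hw (a.mul_mem_left y hw')
  convert this using 1
  ring

/-- Dividing by an arbitrary regular element of `J` decreases the depth by at most one. -/
theorem HasDepth.sup_span [Algebra ℂ S] [IsNoetherianRing S] {J : Ideal S} {k : ℕ} {a : Ideal S}
    (h : HasDepth J (k + 1) a) {y : S} (hyJ : y ∈ J) (hy : ∀ z, y * z ∈ a → z ∈ a) :
    HasDepth J k (a ⊔ Ideal.span {y}) := by
  induction k generalizing a y with
  | zero => trivial
  | succ k ih =>
    obtain ⟨x, hxJ, hx, hd⟩ := h
    obtain ⟨x', hxJ', hx', hd'⟩ := id hd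
    -- An element `w` regular modulo all three ideals links the given sequence to `y`: first `w`
    -- replaces `x` as the leading element, then `y` replaces `w`. Each exchange is an instance of
    -- the induction hypothesis after a swap.
    let b : Fin 3 → Ideal S := ![a, a ⊔ Ideal.span {x}, a ⊔ Ideal.span {y}]
    obtain ⟨⟨w, hwJ⟩, hw⟩ := exists_forall_regular (J := Fin 3) (S := fun _ => S)
      (fun _ => (J.restrictScalars ℂ).subtype) b (fun j z hz => by
        fin_cases j
        · exact ⟨⟨x, hxJ⟩, fun h => hz (hx z h)⟩
        · exact ⟨⟨x', hxJ'⟩, fun h => hz (hx' z h)⟩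
        · obtain ⟨v, hv, hvz⟩ := exists_mul_notMem_sup hxJ hx hy hxJ' hx' z hz
          exact ⟨⟨v, hv⟩, hvz⟩)
    have hw0 : ∀ z, w * z ∈ a → z ∈ a := hw 0
    have hw1 : ∀ z, w * z ∈ a ⊔ Ideal.span {x} → z ∈ a ⊔ Ideal.span {x} := hw 1
    have hw2 : ∀ z, w * z ∈ a ⊔ Ideal.span {y} → z ∈ a ⊔ Ideal.span {y} := hw 2
    have hwJ : w ∈ J := hwJ
    have h1 : HasDepth J (k + 1) (a ⊔ Ideal.span {w}) := by
      refine ⟨x, hxJ, regular_swap hx hw1, ?_⟩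
      rw [sup_right_comm]
      exact ih hd hwJ hw1
    refine ⟨w, hwJ, hw2, ?_⟩
    rw [sup_right_comm]
    exact ih h1 hyJ (regular_swap hy hw2)

end Exchange

/-! ### Depth of ideals of finite codimension in polynomial rings -/

section PolynomialDepth

variable {σ : Type} [Finite σ]

theorem mem_map_C_of_monic_mul_mem {A : Type*} [CommRing A] {a : Ideal A} {G f : A[X]}
    (hG : G.Monic) (h : G * f ∈ a.map (Polynomial.C : A →+* A[X])) :
    f ∈ a.map (Polynomial.C : A →+* A[X]) := by
  have hker : RingHom.ker (Polynomial.mapRingHom (Ideal.Quotient.mk a)) =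
      a.map (Polynomial.C : A →+* A[X]) := by
    rw [Polynomial.ker_mapRingHom, Ideal.mk_ker]
  rw [← hker, RingHom.mem_ker, map_mul] at h
  rw [← hker, RingHom.mem_ker]
  have hm : (Polynomial.mapRingHom (Ideal.Quotient.mk a) G).Monic := hG.map _
  exact hm.mul_right_eq_zero_iff.mp h

/-- Singling out the variable `s` turns the ring into `A[X]`, with the ideal extended from `A`.
Modulo this ideal the monic polynomial `g s` remains monic, hence a nonzerodivisor. -/
theorem univariate_regular {s : σ} {t : Finset σ} (hs : s ∉ t) {g : σ → ℂ[X]} (hg : (g s).Monic)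
    {f : MvPolynomial σ ℂ}
    (hf : Polynomial.aeval (MvPolynomial.X s) (g s) * f ∈
      Ideal.span ((fun i => Polynomial.aeval (MvPolynomial.X i : MvPolynomial σ ℂ) (g i)) '' t)) :
    f ∈ Ideal.span
      ((fun i => Polynomial.aeval (MvPolynomial.X i : MvPolynomial σ ℂ) (g i)) '' t) := by
  classical
  let e : MvPolynomial σ ℂ ≃ₐ[ℂ] (MvPolynomial {x // x ≠ s} ℂ)[X] :=
    (MvPolynomial.renameEquiv ℂ (Equiv.optionSubtypeNe s).symm).trans
      (MvPolynomial.optionEquivLeft ℂ _)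
  have he1 : e (MvPolynomial.X s) = Polynomial.X := by simp [e]
  have he2 : ∀ i (hi : i ≠ s), e (MvPolynomial.X i) =
      Polynomial.C (MvPolynomial.X ⟨i, hi⟩) := fun i hi => by
    simp [e, Equiv.optionSubtypeNe_symm_of_ne hi]
  let a₀ : Ideal (MvPolynomial {x // x ≠ s} ℂ) := Ideal.span
    ((fun i => Polynomial.aeval (MvPolynomial.X i : MvPolynomial {x // x ≠ s} ℂ) (g i)) ''
      {i | i.1 ∈ t})
  have he3 : ∀ i (hi : i ≠ s), e (Polynomial.aeval (MvPolynomial.X i) (g i)) =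
      Polynomial.C (Polynomial.aeval (MvPolynomial.X ⟨i, hi⟩) (g i)) := fun i hi => by
    rw [← Polynomial.aeval_algHom_apply, he2 i hi]
    exact Polynomial.aeval_algHom_apply (Polynomial.CAlgHom (R := ℂ)) _ _
  have h1 : Ideal.span
      ((fun i => Polynomial.aeval (MvPolynomial.X i : MvPolynomial σ ℂ) (g i)) '' t) ≤
      (a₀.map Polynomial.C).comap e := by
    rw [Ideal.span_le]
    rintro _ ⟨i, hi, rfl⟩
    have his : i ≠ s := fun h => hs (h ▸ hi)
    rw [SetLike.mem_coe, Ideal.mem_comap]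
    rw [he3 i his]
    exact Ideal.mem_map_of_mem _ (Ideal.subset_span ⟨⟨i, his⟩, hi, rfl⟩)
  have h2 : a₀.map Polynomial.C ≤ (Ideal.span ((fun i =>
      Polynomial.aeval (MvPolynomial.X i : MvPolynomial σ ℂ) (g i)) '' t)).comap e.symm := by
    rw [Ideal.map_span, Ideal.span_le]
    rintro _ ⟨_, ⟨⟨i, his⟩, hi, rfl⟩, rfl⟩
    rw [SetLike.mem_coe, Ideal.mem_comap]
    rw [← he3 i his, AlgEquiv.symm_apply_apply]
    exact Ideal.subset_span ⟨i, hi, rfl⟩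
  have h3 := h1 hf
  rw [Ideal.mem_comap, map_mul, ← Polynomial.aeval_algHom_apply, he1] at h3
  have hmon : (Polynomial.aeval (Polynomial.X : (MvPolynomial {x // x ≠ s} ℂ)[X]) (g s)).Monic := by
    have : Polynomial.aeval (Polynomial.X : (MvPolynomial {x // x ≠ s} ℂ)[X]) (g s) =
        (g s).map (algebraMap ℂ _) := by
      rw [Polynomial.aeval_def, Polynomial.map]
      rfl
    rw [this]
    exact hg.map _
  have h4 := h2 (mem_map_C_of_monic_mul_mem hmon h3)
  rwa [Ideal.mem_comap, AlgEquiv.symm_apply_apply] at h4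

/-- An ideal of finite codimension in a polynomial ring in `m` variables has depth `m`. -/
theorem hasDepth_of_finite (J : Ideal (MvPolynomial σ ℂ))
    (hJ : Module.Finite ℂ (MvPolynomial σ ℂ ⧸ J)) : HasDepth J (Nat.card σ) ⊥ := by
  classical
  have := Fintype.ofFinite σ
  -- Each variable is integral over `ℂ` modulo `J`, so `J` contains a monic polynomial in each
  -- single variable. These polynomials form the regular sequence.
  have hint : ∀ i : σ, ∃ g : ℂ[X], g.Monic ∧ Polynomial.aeval (MvPolynomial.X i) g ∈ J := fun i => by
    obtain ⟨g, hg, hg0⟩ := Algebra.IsIntegral.isIntegral (R := ℂ)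
      (Ideal.Quotient.mkₐ ℂ J (MvPolynomial.X i))
    refine ⟨g, hg, ?_⟩
    rw [← Polynomial.aeval_def, Polynomial.aeval_algHom_apply] at hg0
    exact Ideal.Quotient.eq_zero_iff_mem.mp hg0
  choose g hg hgJ using hint
  have key : ∀ (k : ℕ) (t : Finset σ), k + t.card = Nat.card σ → HasDepth J k (Ideal.span
      ((fun i => Polynomial.aeval (MvPolynomial.X i : MvPolynomial σ ℂ) (g i)) '' t)) := by
    intro k
    induction k with
    | zero => exact fun _ _ => trivial
    | succ k ih =>
      intro t ht
      obtain ⟨s, hs⟩ : ∃ s, s ∉ t := by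
        by_contra! h
        have h1 : t = Finset.univ := Finset.eq_univ_iff_forall.mpr h
        rw [h1, Finset.card_univ, Nat.card_eq_fintype_card] at ht
        omega
      refine ⟨_, hgJ s, fun z hz => univariate_regular hs (hg s) hz, ?_⟩
      have h1 := ih (insert s t) ?_
      · rwa [Finset.coe_insert, Set.image_insert_eq, Ideal.span_insert, sup_comm] at h1
      rw [Finset.card_insert_of_notMem hs]
      omega
  have := key (Nat.card σ) ∅ (by simp)
  simpa using this

end PolynomialDepth

/-! ### Lengths of local rings -/

section LocalLength

variable {A : Type*} [CommRing A] (p : Ideal A) [p.IsPrime]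

/-- The length of the localization of `A/Q` at `p`. -/
def localLength (Q : Ideal A) : ℕ∞ :=
  Module.length (Localization.AtPrime p)
    (Localization.AtPrime p ⧸ Q.map (algebraMap A (Localization.AtPrime p)))

theorem localLength_top : localLength p ⊤ = 0 := by
  rw [localLength, Module.length_eq_zero_iff, Ideal.map_top]
  exact Ideal.Quotient.subsingleton_iff.mpr rfl

variable {p}

/-- Since `g` becomes a unit at `p`, the element `f` already lies in the localization of `Q`. -/
theorem localLength_sup_span_of_notMem {Q : Ideal A} {f g : A} (hg : g ∉ p) (hgf : g * f ∈ Q) :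
    localLength p (Q ⊔ Ideal.span {f}) = localLength p Q := by
  have : (Q ⊔ Ideal.span {f}).map (algebraMap A (Localization.AtPrime p)) =
      Q.map (algebraMap A (Localization.AtPrime p)) := by
    rw [Ideal.map_sup, Ideal.map_span, Set.image_singleton, sup_eq_left, Ideal.span_le,
      Set.singleton_subset_iff, SetLike.mem_coe]
    have hu : IsUnit (algebraMap A (Localization.AtPrime p) g) :=
      IsLocalization.map_units (Localization.AtPrime p) (⟨g, hg⟩ : p.primeCompl)
    rw [← Ideal.unit_mul_mem_iff_mem _ hu, ← map_mul]
    exact Ideal.mem_map_of_mem _ hgf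
  rw [localLength, localLength, this]

/-- Multiplication by `f` gives `0 → A/p → A/Q → A/(Q + (f)) → 0`. Localized at `p`, the first term
is the residue field, of length one. -/
theorem localLength_of_colon_eq {Q : Ideal A} {f : A} (hp : ∀ g, g ∈ p ↔ g * f ∈ Q) :
    localLength p Q = 1 + localLength p (Q ⊔ Ideal.span {f}) := by
  set B := Localization.AtPrime p with hB
  set q : Ideal B := Q.map (algebraMap A B) with hq
  set m := IsLocalRing.maximalIdeal B with hm
  have hm' : m = p.map (algebraMap A B) := (Localization.AtPrime.map_eq_maximalIdeal).symm
  have hF : algebraMap A B f ∉ q := by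
    intro h
    rw [hq, IsLocalization.algebraMap_mem_map_algebraMap_iff p.primeCompl] at h
    obtain ⟨g, hg, hgf⟩ := h
    exact hg ((hp g).mpr hgf)
  have hle : m ≤ Submodule.comap (LinearMap.mulRight B (algebraMap A B f)) q := by
    rw [hm', Ideal.map_le_iff_le_comap]
    intro g hg
    rw [Ideal.mem_comap, Submodule.mem_comap, LinearMap.mulRight_apply, ← map_mul]
    exact Ideal.mem_map_of_mem _ ((hp g).mp hg)
  have hqq : (q : Submodule B B) ≤ (Q ⊔ Ideal.span {f}).map (algebraMap A B) :=
    Ideal.map_mono le_sup_left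
  have h1 := Module.length_eq_add_of_exact
    (Submodule.mapQ m q (LinearMap.mulRight B (algebraMap A B f)) hle)
    (Submodule.factor hqq) ?_ (Submodule.factor_surjective hqq) ?_
  · have h2 : Module.length B (B ⧸ m) = 1 := by
      have : IsSimpleModule B (B ⧸ m) :=
        isSimpleModule_iff_isCoatom.mpr (Ideal.isMaximal_def.mp inferInstance)
      exact Module.length_eq_one B _
    rw [h2] at h1
    exact h1
  · rw [injective_iff_map_eq_zero]
    intro b hb
    obtain ⟨b, rfl⟩ := Submodule.Quotient.mk_surjective _ b
    rw [Submodule.mapQ_apply, Submodule.Quotient.mk_eq_zero, LinearMap.mulRight_apply] at hb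
    rw [Submodule.Quotient.mk_eq_zero, hm, IsLocalRing.mem_maximalIdeal, mem_nonunits_iff]
    exact fun hu => hF ((Ideal.unit_mul_mem_iff_mem _ hu).mp hb)
  · intro b
    obtain ⟨b, rfl⟩ := Submodule.Quotient.mk_surjective _ b
    have h2 : Submodule.factor hqq (Submodule.Quotient.mk b) = 0 ↔
        b ∈ q ⊔ Ideal.span {algebraMap A B f} := by
      rw [← Submodule.mkQ_apply, Submodule.factor_mk, Submodule.mkQ_apply,
        Submodule.Quotient.mk_eq_zero, Ideal.map_sup, Ideal.map_span, Set.image_singleton]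
    rw [h2]
    constructor
    · intro h
      obtain ⟨c, hc⟩ := exists_eq_of_mem_sup_span h
      refine ⟨Submodule.Quotient.mk c, ?_⟩
      rw [Submodule.mapQ_apply, LinearMap.mulRight_apply, eq_comm, Submodule.Quotient.eq, mul_comm]
      exact hc
    · rintro ⟨c, hc⟩
      obtain ⟨c, rfl⟩ := Submodule.Quotient.mk_surjective _ c
      rw [Submodule.mapQ_apply, LinearMap.mulRight_apply, eq_comm, Submodule.Quotient.eq,
        mul_comm] at hc
      exact mem_sup_span_of_sub_mem hc

end LocalLength

/-! ### Ideals of points -/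

section Points

open MvPolynomial

attribute [local instance] MvPolynomial.gradedAlgebra

variable {ι : Type} [Fintype ι] [DecidableEq ι]

/-- The algebra `R` is arbitrary because `t` is used as a scalar, as the variable of `ℂ[X]` and as
the residue class of a linear form. -/
theorem aeval_mul_of_isHomogeneous {R : Type*} [CommRing R] [Algebra ℂ R] (v : ι → ℂ) (t : R)
    {f : MvPolynomial ι ℂ} {k : ℕ} (hf : f.IsHomogeneous k) :
    MvPolynomial.aeval (fun i => algebraMap ℂ R (v i) * t) f =
      algebraMap ℂ R (MvPolynomial.eval v f) * t ^ k := by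
  rw [MvPolynomial.aeval_def, eval₂_eq', MvPolynomial.eval_eq', map_sum, Finset.sum_mul]
  refine Finset.sum_congr rfl fun d hd => ?_
  have hdk : ∑ i, d i = k := by
    rw [hf.degree_eq_sum_deg_support hd]
    refine (Finset.sum_subset (Finset.subset_univ _) fun i _ hi => ?_).symm
    simpa using hi
  simp only [mul_pow, Finset.prod_mul_distrib, Finset.prod_pow_eq_pow_sum, hdk, map_mul, map_prod,
    map_pow, mul_assoc]

theorem mem_pointIdeal_iff {x : ℙ ℂ (ι → ℂ)} {f : MvPolynomial ι ℂ} {k : ℕ}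
    (hf : f.IsHomogeneous k) : f ∈ pointIdeal x ↔ MvPolynomial.eval x.rep f = 0 := by
  have h : f ∈ pointIdeal x ↔
      MvPolynomial.aeval (fun i => Polynomial.C (x.rep i) * Polynomial.X) f = (0 : ℂ[X]) := Iff.rfl
  rw [h]
  have h2 := aeval_mul_of_isHomogeneous x.rep (Polynomial.X : ℂ[X]) hf
  rw [Polynomial.algebraMap_apply] at h2
  have h3 : (fun i => Polynomial.C (x.rep i) * Polynomial.X) =
      fun i => algebraMap ℂ ℂ[X] (x.rep i) * Polynomial.X := rfl
  rw [h3, h2, mul_eq_zero_iff_right (pow_ne_zero _ Polynomial.X_ne_zero)]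
  simp

theorem eval_smul_of_isHomogeneous {v : ι → ℂ} (c : ℂ) {f : MvPolynomial ι ℂ} {k : ℕ}
    (hf : f.IsHomogeneous k) :
    MvPolynomial.eval (c • v) f = c ^ k * MvPolynomial.eval v f := by
  have := aeval_mul_of_isHomogeneous v c hf
  rw [Algebra.algebraMap_self, RingHom.id_apply, mul_comm] at this
  rw [← this, aeval_eq_eval]
  congr 2
  funext i
  simp [mul_comm]

theorem mem_pointIdeal_mk_iff {v : ι → ℂ} (hv : v ≠ 0) {f : MvPolynomial ι ℂ} {k : ℕ}
    (hf : f.IsHomogeneous k) :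
    f ∈ pointIdeal (Projectivization.mk ℂ v hv) ↔ MvPolynomial.eval v f = 0 := by
  rw [mem_pointIdeal_iff hf]
  obtain ⟨a, ha⟩ := Projectivization.exists_smul_eq_mk_rep ℂ v hv
  rw [← ha, Units.smul_def, eval_smul_of_isHomogeneous _ hf,
    mul_eq_zero_iff_left (pow_ne_zero _ a.ne_zero)]

theorem isHomog_pointIdeal (x : ℙ ℂ (ι → ℂ)) : IsHomog (pointIdeal x) := by
  refine isHomog_of_component_mem fun f hf k => ?_
  have hf' : MvPolynomial.aeval (fun i => algebraMap ℂ ℂ[X] (x.rep i) * Polynomial.X) f = 0 := hf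
  rw [mem_pointIdeal_iff (homogeneousComponent_isHomogeneous k f)]
  rw [← sum_homogeneousComponent f, map_sum] at hf'
  simp only [aeval_mul_of_isHomogeneous _ _ (homogeneousComponent_isHomogeneous _ f)] at hf'
  have h := congrArg (fun q => Polynomial.coeff q k) hf'
  simp only [Polynomial.finsetSum_coeff, Polynomial.algebraMap_apply, Algebra.algebraMap_self,
    RingHom.id_apply, Polynomial.coeff_C_mul_X_pow, Finset.sum_ite_eq, Finset.mem_range,
    Polynomial.coeff_zero] at h
  split_ifs at h with hk
  · exact h
  · rw [homogeneousComponent_eq_zero k f (by omega), map_zero]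

theorem isHomog_homogeneousIdeal (S : Set (ℙ ℂ (ι → ℂ))) : IsHomog (homogeneousIdeal S) :=
  Ideal.IsHomogeneous.iInf₂ fun x _ => isHomog_pointIdeal x

theorem exists_X_notMem_pointIdeal (x : ℙ ℂ (ι → ℂ)) :
    ∃ i, (MvPolynomial.X i : MvPolynomial ι ℂ) ∉ pointIdeal x := by
  by_contra! h
  refine x.rep_nonzero (funext fun i => ?_)
  have := (mem_pointIdeal_iff (isHomogeneous_X ℂ i)).mp (h i)
  simpa using this

/-- The linear forms `x_i X_j - x_j X_i` lie in the ideal of `x`; their vanishing at `y` makes the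
two vectors proportional. -/
theorem eq_of_pointIdeal_le {x y : ℙ ℂ (ι → ℂ)} (h : pointIdeal x ≤ pointIdeal y) : x = y := by
  have h1 : ∀ i j, x.rep i * y.rep j = x.rep j * y.rep i := by
    intro i j
    have hh : (MvPolynomial.C (x.rep i) * MvPolynomial.X j -
        MvPolynomial.C (x.rep j) * MvPolynomial.X i : MvPolynomial ι ℂ).IsHomogeneous 1 :=
      (isHomogeneous_C_mul_X _ _).sub (isHomogeneous_C_mul_X _ _)
    have h2 := h ((mem_pointIdeal_iff hh).mpr (by simp [mul_comm]))
    rw [mem_pointIdeal_iff hh] at h2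
    simpa [sub_eq_zero] using h2
  obtain ⟨i, hi⟩ : ∃ i, x.rep i ≠ 0 := by
    by_contra! h0
    exact x.rep_nonzero (funext h0)
  rw [← x.mk_rep, ← y.mk_rep, Projectivization.mk_eq_mk_iff']
  have hyi : y.rep i ≠ 0 := by
    intro hy
    refine y.rep_nonzero (funext fun j => ?_)
    have := h1 i j
    rw [hy, mul_zero, mul_eq_zero] at this
    exact this.resolve_left hi
  refine ⟨x.rep i / y.rep i, funext fun j => ?_⟩
  have := h1 i j
  rw [Pi.smul_apply, smul_eq_mul]
  field_simp
  rw [this, mul_comm]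

/-- Evaluation at a representative identifies the degree `k` part with `ℂ`; it is onto because a
power of a nonvanishing coordinate does not vanish. -/
theorem quotDim_pointIdeal (x : ℙ ℂ (ι → ℂ)) (k : ℕ) : quotDim (pointIdeal x) k = 1 := by
  have h1 := quotDim_add (pointIdeal x) k
  have h2 := finrank_map_add_finrank_inf_ker (MvPolynomial.aeval (R := ℂ) x.rep).toLinearMap
    (homogeneousSubmodule ι ℂ k)
  have h3 : homogeneousSubmodule ι ℂ k ⊓ (pointIdeal x).restrictScalars ℂ =
      homogeneousSubmodule ι ℂ k ⊓
        LinearMap.ker (MvPolynomial.aeval (R := ℂ) x.rep).toLinearMap := by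
    ext f
    simp only [Submodule.mem_inf, mem_homogeneousSubmodule, Submodule.restrictScalars_mem,
      LinearMap.mem_ker, AlgHom.toLinearMap_apply, aeval_eq_eval]
    exact and_congr_right fun hf => mem_pointIdeal_iff hf
  have h4 : (homogeneousSubmodule ι ℂ k).map
      (MvPolynomial.aeval (R := ℂ) x.rep).toLinearMap = ⊤ := by
    obtain ⟨i, hi⟩ := exists_X_notMem_pointIdeal x
    have hne : MvPolynomial.eval x.rep (MvPolynomial.X i ^ k) ≠ 0 := fun h0 => hi
      (Ideal.IsPrime.mem_of_pow_mem inferInstance k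
        ((mem_pointIdeal_iff (isHomogeneous_X_pow i k)).mpr h0))
    rw [eq_top_iff]
    intro c _
    refine ⟨(c / MvPolynomial.eval x.rep (MvPolynomial.X i ^ k)) • MvPolynomial.X i ^ k,
      Submodule.smul_mem _ _ (isHomogeneous_X_pow i k), ?_⟩
    rw [map_smul, AlgHom.toLinearMap_apply, aeval_eq_eval, smul_eq_mul, div_mul_cancel₀ _ hne]
  rw [h3] at h1
  rw [h4, finrank_top, Module.finrank_self] at h2
  omega

/-- A homogeneous prime `P`, not irrelevant, such that `P + (l)` is irrelevant for a linear form
`l`, is the ideal of a point. -/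
theorem exists_eq_pointIdeal {P : Ideal (MvPolynomial ι ℂ)} (hP : IsHomog P) [P.IsPrime]
    {l : MvPolynomial ι ℂ} (hl : l.IsHomogeneous 1) {N : ℕ}
    (hN : ∀ f : MvPolynomial ι ℂ, f.IsHomogeneous (N + 1) → f ∈ P ⊔ Ideal.span {l})
    {i₀ : ι} (hi₀ : MvPolynomial.X i₀ ∉ P) : ∃ x, P = pointIdeal x := by
  have hlP : l ∉ P := by
    intro h
    have h1 := hN _ (isHomogeneous_X_pow i₀ (N + 1))
    rw [sup_eq_left.mpr ((Ideal.span_singleton_le_iff_mem _).mpr h)] at h1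
    exact hi₀ (Ideal.IsPrime.mem_of_pow_mem inferInstance _ h1)
  set mk := Ideal.Quotient.mkₐ ℂ P with hmk
  have hmk0 : ∀ f, mk f = 0 ↔ f ∈ P := fun f => Ideal.Quotient.eq_zero_iff_mem
  have hl0 : mk l ≠ 0 := fun h => hlP ((hmk0 l).mp h)
  let V : Submodule ℂ (MvPolynomial ι ℂ ⧸ P) := (homogeneousSubmodule ι ℂ N).map mk.toLinearMap
  have hVnt : Nontrivial V := by
    refine ⟨⟨⟨mk (l ^ N), l ^ N, ?_, rfl⟩, 0, ?_⟩⟩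
    · have := hl.pow N
      rwa [one_mul] at this
    · intro h
      have := congrArg Subtype.val h
      simp only [map_pow, Submodule.coe_zero] at this
      exact hl0 (eq_zero_of_pow_eq_zero this)
  let L : V →ₗ[ℂ] (MvPolynomial ι ℂ ⧸ P) := (LinearMap.mulLeft ℂ (mk l)).domRestrict V
  have hL : Function.Injective L := by
    rw [injective_iff_map_eq_zero]
    rintro ⟨v, hv⟩ h
    have : mk l * v = 0 := h
    exact Subtype.ext ((mul_eq_zero.mp this).resolve_left hl0)
  -- With `V` the degree `N` part of the domain `A/P`, the hypothesis gives `X_i V ⊆ l V`, so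
  -- division by `l` makes `X_i` an endomorphism of `V`. An eigenvector `v` satisfies `X_i v = c l
  -- v`, and `v` cancels. All coordinates are thus multiples of the single element `l`.
  have hc : ∀ i, ∃ c : ℂ, mk (MvPolynomial.X i) = algebraMap ℂ _ c * mk l := by
    intro i
    let Z : V →ₗ[ℂ] LinearMap.range L :=
      ((LinearMap.mulLeft ℂ (mk (MvPolynomial.X i))).domRestrict V).codRestrict _ (by
        rintro ⟨_, f, hf, rfl⟩
        have h1 : (f * MvPolynomial.X i).IsHomogeneous (N + 1) :=
          IsHomogeneous.mul hf (isHomogeneous_X ℂ i)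
        obtain ⟨g, hg, hgf⟩ := exists_component_of_mem_sup hP hl h1 (hN _ h1)
        refine ⟨⟨mk g, g, hg, rfl⟩, ?_⟩
        have h2 := (hmk0 _).mpr hgf
        rw [map_sub, sub_eq_zero, map_mul, map_mul] at h2
        change mk l * mk g = mk (MvPolynomial.X i) * mk f
        rw [mul_comm, ← h2, mul_comm])
    let φ : Module.End ℂ V := (LinearEquiv.ofInjective L hL).symm.toLinearMap ∘ₗ Z
    obtain ⟨c, hc⟩ := Module.End.exists_eigenvalue φ
    obtain ⟨v, hv⟩ := hc.exists_hasEigenvector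
    refine ⟨c, ?_⟩
    have h1 : Z v = LinearEquiv.ofInjective L hL (c • v) := by
      rw [← hv.apply_eq_smul]
      exact ((LinearEquiv.ofInjective L hL).apply_symm_apply (Z v)).symm
    have h2 : mk (MvPolynomial.X i) * v.1 = mk l * (c • v.1) := congrArg Subtype.val h1
    have hv0 : v.1 ≠ 0 := fun h => hv.2 (Subtype.ext h)
    have h3 : c • v.1 = algebraMap ℂ _ c * v.1 := Algebra.smul_def c v.1
    rw [h3] at h2
    refine mul_right_cancel₀ hv0 (h2.trans ?_)
    ring
  choose c hc using hc
  have hc0 : c ≠ 0 := by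
    rintro rfl
    refine hi₀ ((hmk0 _).mp ?_)
    rw [hc, Pi.zero_apply, map_zero, zero_mul]
  have hmkf : ∀ {k : ℕ} {f : MvPolynomial ι ℂ}, f.IsHomogeneous k →
      (f ∈ P ↔ MvPolynomial.eval c f = 0) := by
    intro k f hf
    have h1 : mk = MvPolynomial.aeval (fun i => algebraMap ℂ _ (c i) * mk l) := by
      refine MvPolynomial.algHom_ext fun i => ?_
      rw [MvPolynomial.aeval_X, hc]
    rw [← hmk0]
    have h2 := aeval_mul_of_isHomogeneous c (mk l) hf
    rw [← h1] at h2
    rw [h2, mul_eq_zero_iff_right (pow_ne_zero _ hl0)]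
    exact map_eq_zero_iff _ (algebraMap ℂ (MvPolynomial ι ℂ ⧸ P)).injective
  refine ⟨Projectivization.mk ℂ c hc0, le_antisymm ?_ ?_⟩
  · intro f hf
    refine mem_of_components fun k => ?_
    rw [mem_pointIdeal_mk_iff hc0 (homogeneousComponent_isHomogeneous k f),
      ← hmkf (homogeneousComponent_isHomogeneous k f)]
    exact hP.component_mem hf k
  · intro f hf
    refine mem_of_components fun k => ?_
    rw [hmkf (homogeneousComponent_isHomogeneous k f),
      ← mem_pointIdeal_mk_iff hc0 (homogeneousComponent_isHomogeneous k f)]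
    exact (isHomog_pointIdeal _).component_mem hf k

end Points

/-! ### Zero-dimensional schemes -/

section ZeroDimensional

open MvPolynomial

attribute [local instance] MvPolynomial.gradedAlgebra

variable {ι : Type} [Fintype ι] [DecidableEq ι]

/-- A proper homogeneous ideal has a homogeneous prime quotient `(Q : f)`, `f` a form. -/
theorem exists_colon_isPrime {Q : Ideal (MvPolynomial ι ℂ)} (hQ : IsHomog Q) (hne : Q ≠ ⊤) :
    ∃ (e : ℕ) (f : MvPolynomial ι ℂ), f.IsHomogeneous e ∧ f ∉ Q ∧ (Q.colon {f}).IsPrime := by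
  have h1 : (1 : MvPolynomial ι ℂ) ∉ Q := fun h => hne ((Ideal.eq_top_iff_one Q).mpr h)
  -- A maximal annihilator of a form is prime: if `x f ∉ Q`, then `(Q : xf)` contains `(Q : f)` and
  -- equals it by maximality. For a homogeneous ideal, primality need only be tested on forms.
  obtain ⟨_, ⟨e, f, hf, hfQ, rfl⟩, hmax⟩ := set_has_maximal_iff_noetherian.mpr
    (inferInstance : IsNoetherian (MvPolynomial ι ℂ) (MvPolynomial ι ℂ))
    {P : Ideal (MvPolynomial ι ℂ) | ∃ (e : ℕ) (f : MvPolynomial ι ℂ), f.IsHomogeneous e ∧ f ∉ Q ∧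
      Q.colon {f} = P} ⟨_, 0, 1, isHomogeneous_one ι ℂ, h1, rfl⟩
  refine ⟨e, f, hf, hfQ, (isHomog_colon hQ hf).isPrime_of_homogeneous_mem_or_mem ?_ ?_⟩
  · intro h
    have := (Ideal.eq_top_iff_one _).mp h
    rw [Submodule.mem_colon_singleton, one_smul] at this
    exact hfQ this
  · rintro x y ⟨a, hx⟩ - hxy
    by_contra! hcon
    obtain ⟨hxP, hyP⟩ := hcon
    rw [Submodule.mem_colon_singleton, smul_eq_mul] at hxP hyP hxy
    refine hmax (Q.colon {x * f}) ⟨a + e, x * f, IsHomogeneous.mul hx hf, hxP, rfl⟩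
      (lt_of_le_of_ne (fun g hg => ?_) fun h => hyP ?_)
    · rw [Submodule.mem_colon_singleton, smul_eq_mul] at hg ⊢
      rw [mul_left_comm]
      exact Q.mul_mem_left _ hg
    · have : y ∈ Q.colon {x * f} := by
        rw [Submodule.mem_colon_singleton, smul_eq_mul, ← mul_assoc, mul_comm y x]
        exact hxy
      rwa [← h, Submodule.mem_colon_singleton, smul_eq_mul] at this

/-- The ideal of a point on the scheme contains a minimal prime of `Q`. This prime is homogeneous
and not irrelevant, so it is itself a point ideal and coincides with the given one; minimal primes
are finite in number. -/
theorem finite_points {Q : Ideal (MvPolynomial ι ℂ)} (hQ : IsHomog Q)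
    {l : MvPolynomial ι ℂ} (hl : l.IsHomogeneous 1) {N : ℕ}
    (hN : ∀ f : MvPolynomial ι ℂ, f.IsHomogeneous (N + 1) → f ∈ Q ⊔ Ideal.span {l}) :
    {x : ℙ ℂ (ι → ℂ) | Q ≤ pointIdeal x}.Finite := by
  refine Set.Finite.of_finite_image (f := pointIdeal)
    ((Ideal.finite_minimalPrimes_of_isNoetherianRing _ Q).subset ?_)
    (fun x _ y _ h => eq_of_pointIdeal_le h.le)
  rintro _ ⟨x, hx, rfl⟩
  obtain ⟨P, hP, hPx⟩ := Ideal.exists_minimalPrimes_le (show Q ≤ pointIdeal x from hx)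
  have hprime : P.IsPrime := hP.1.1
  -- The homogeneous core of `P` is prime and still contains `Q`, so minimality identifies it with
  -- `P`.
  have hcore : (P.homogeneousCore (homogeneousSubmodule ι ℂ)).toIdeal = P :=
    le_antisymm (Ideal.toIdeal_homogeneousCore_le _ _)
      (hP.2 ⟨hprime.homogeneousCore, hQ.toIdeal_homogeneousCore_eq_self.symm.trans_le
        (Ideal.homogeneousCore_mono _ hP.1.2)⟩ (Ideal.toIdeal_homogeneousCore_le _ _))
  have hhom : IsHomog P := hcore ▸ HomogeneousIdeal.isHomogeneous _
  obtain ⟨i, hi⟩ := exists_X_notMem_pointIdeal x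
  obtain ⟨y, rfl⟩ := exists_eq_pointIdeal hhom hl
    (fun f hf => (sup_le_sup_right hP.1.2 _) (hN f hf)) (fun h => hi (hPx h))
  rwa [← eq_of_pointIdeal_le hPx]

/-- Noetherian induction from above along `0 → A/P → A/Q' → A/(Q' + (f)) → 0` with `P` a homogeneous
prime. The finite set `X` stays fixed, since every ideal that occurs contains `Q`. -/
theorem exists_sum_localLength {Q : Ideal (MvPolynomial ι ℂ)} {l : MvPolynomial ι ℂ}
    (hl : l.IsHomogeneous 1) {N : ℕ}
    (hN : ∀ f : MvPolynomial ι ℂ, f.IsHomogeneous (N + 1) → f ∈ Q ⊔ Ideal.span {l})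
    {X : Finset (ℙ ℂ (ι → ℂ))} (hX : ∀ x, Q ≤ pointIdeal x → x ∈ X)
    (Q' : Ideal (MvPolynomial ι ℂ)) (hQQ' : Q ≤ Q') (hQ' : IsHomog Q') :
    ∃ k₀, ∀ k, k₀ ≤ k → ∑ x ∈ X, localLength (pointIdeal x) Q' = (quotDim Q' k : ℕ∞) := by
  classical
  induction Q' using (inferInstance : WellFoundedGT (Ideal (MvPolynomial ι ℂ))).wf.induction with
  | _ Q' ih =>
  by_cases htop : Q' = ⊤
  · subst htop
    refine ⟨0, fun k _ => ?_⟩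
    rw [quotDim_eq_zero fun _ _ => Submodule.mem_top]
    simp [localLength_top]
  obtain ⟨e, f, hf, hfQ, hprime⟩ := exists_colon_isPrime hQ' htop
  obtain ⟨k₀, hk₀⟩ := ih (Q' ⊔ Ideal.span {f})
    (lt_of_le_of_ne le_sup_left fun h => hfQ
      (h ▸ Ideal.mem_sup_right (Ideal.mem_span_singleton_self f)))
    (hQQ'.trans le_sup_left) (isHomog_sup_span hQ' hf)
  set P := Q'.colon {f} with hPdef
  have hmemP : ∀ g, g ∈ P ↔ g * f ∈ Q' := fun g => by
    rw [hPdef, Submodule.mem_colon_singleton, smul_eq_mul]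
  have hdim : ∀ k, quotDim (Q' ⊔ Ideal.span {f}) (k + e) + quotDim P k = quotDim Q' (k + e) :=
    fun k => quotDim_sup_span hQ' hf fun g _ => hmemP g
  have hQP : Q ≤ P := fun g hg => (hmemP g).mpr (Ideal.mul_mem_right _ _ (hQQ' hg))
  have hother : ∀ x : ℙ ℂ (ι → ℂ), ¬ P ≤ pointIdeal x →
      localLength (pointIdeal x) (Q' ⊔ Ideal.span {f}) = localLength (pointIdeal x) Q' := by
    intro x hx
    obtain ⟨g, hgP, hgx⟩ := SetLike.not_le_iff_exists.mp hx
    exact localLength_sup_span_of_notMem hgx ((hmemP g).mp hgP)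
  by_cases hirr : ∀ i, (MvPolynomial.X i : MvPolynomial ι ℂ) ∈ P
  -- An irrelevant `P` lies in no point ideal and has zero Hilbert function in positive degrees, so
  -- neither side changes.
  · refine ⟨k₀ + 1 + e, fun k hk => ?_⟩
    obtain ⟨j, rfl⟩ := Nat.exists_eq_add_of_le (show e ≤ k by omega)
    have h1 : quotDim P j = 0 := by
      refine quotDim_eq_zero fun g hg => mem_of_forall_isHomogeneous_le (show 1 ≤ j by omega)
        (fun u hu => ?_) hg
      have hu' : u ∈ homogeneousSubmodule ι ℂ 1 := hu
      rw [homogeneousSubmodule_one_eq_span_X] at hu'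
      have : Submodule.span ℂ (Set.range (MvPolynomial.X : ι → MvPolynomial ι ℂ)) ≤
          P.restrictScalars ℂ := by
        rw [Submodule.span_le]
        rintro _ ⟨i, rfl⟩
        exact hirr i
      exact this hu'
    have h2 := hdim j
    rw [h1, add_zero, add_comm j e] at h2
    rw [← h2, ← hk₀ _ (by omega)]
    refine Finset.sum_congr rfl fun x _ => (hother x fun hle => ?_).symm
    obtain ⟨i, hi⟩ := exists_X_notMem_pointIdeal x
    exact hi (hle (hirr i))
  · push Not at hirr
    obtain ⟨i, hi⟩ := hirr
    -- Otherwise `P` is the ideal of a point. It contributes one to the length at that point, one to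
    -- the Hilbert function, and nothing at the other points.
    obtain ⟨x₀, hx₀⟩ := exists_eq_pointIdeal (isHomog_colon hQ' hf) hl
      (fun f hf => (sup_le_sup_right hQP _) (hN f hf)) hi
    rw [← hPdef] at hx₀
    have hx₀X : x₀ ∈ X := hX x₀ (hx₀ ▸ hQP)
    refine ⟨k₀ + e, fun k hk => ?_⟩
    obtain ⟨j, rfl⟩ := Nat.exists_eq_add_of_le (show e ≤ k by omega)
    have h2 := hdim j
    rw [hx₀, quotDim_pointIdeal, add_comm j e] at h2
    rw [← h2, Nat.cast_add, ← hk₀ _ (by omega), ← Finset.add_sum_erase _ _ hx₀X,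
      ← Finset.add_sum_erase _ _ hx₀X,
      localLength_of_colon_eq (p := pointIdeal x₀) (Q := Q') (f := f) (hx₀ ▸ hmemP),
      Finset.sum_congr rfl fun x hx => (hother x fun hle => ?_).symm]
    · rw [Nat.cast_one]
      abel
    · rw [hx₀] at hle
      exact (Finset.ne_of_mem_erase hx) (eq_of_pointIdeal_le hle).symm

/-- The multiplicities of the points of a zero-dimensional projective scheme add up to its
Hilbert polynomial. -/
theorem finsum_localLength {Q : Ideal (MvPolynomial ι ℂ)} (hQ : IsHomog Q)
    {l : MvPolynomial ι ℂ} (hl : l.IsHomogeneous 1) {N : ℕ}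
    (hN : ∀ f : MvPolynomial ι ℂ, f.IsHomogeneous (N + 1) → f ∈ Q ⊔ Ideal.span {l}) {d : ℕ}
    (hd : ∀ᶠ k in Filter.atTop, quotDim Q k = d) :
    ∑ᶠ x ∈ {x : ℙ ℂ (ι → ℂ) | Q ≤ pointIdeal x}, localLength (pointIdeal x) Q = (d : ℕ∞) := by
  have hfin := finite_points hQ hl hN
  obtain ⟨k₀, hk₀⟩ := exists_sum_localLength hl hN (X := hfin.toFinset)
    (fun x hx => hfin.mem_toFinset.mpr hx) Q le_rfl hQ
  obtain ⟨k₁, hk₁⟩ := Filter.eventually_atTop.mp hd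
  rw [finsum_mem_eq_finite_toFinset_sum _ hfin, hk₀ (max k₀ k₁) (le_max_left _ _),
    hk₁ _ (le_max_right _ _)]

end ZeroDimensional

/-! ### Linear sections of a variety covered by affine spaces -/

section Cover

open MvPolynomial

attribute [local instance] MvPolynomial.gradedAlgebra

variable {ι : Type} [Fintype ι] [DecidableEq ι]

/-- A cover of the projective variety with homogeneous ideal `I` by affine spaces with coordinates
indexed by `σ`, the complements of the hyperplanes `form b`. -/
structure AffineSpaceCover (I : Ideal (MvPolynomial ι ℂ)) (σ β : Type) where
  chart : β → MvPolynomial ι ℂ →ₐ[ℂ] MvPolynomial σ ℂ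
  form : β → MvPolynomial ι ℂ
  isHomogeneous_form : ∀ b, (form b).IsHomogeneous 1
  chart_form : ∀ b, chart b (form b) = 1
  surjective : ∀ b, Function.Surjective (chart b)
  chart_eq_zero_iff : ∀ b {k : ℕ} {f : MvPolynomial ι ℂ}, f.IsHomogeneous k →
    (chart b f = 0 ↔ f ∈ I)
  cover : ∀ c : ι → ℂ, (∀ f ∈ I, MvPolynomial.eval c f = 0) →
    (∀ b, MvPolynomial.eval c (form b) = 0) → c = 0

variable {I : Ideal (MvPolynomial ι ℂ)} {σ β : Type}

theorem pow_mul_mem_of_le {a : Ideal (MvPolynomial ι ℂ)} {ℓ f : MvPolynomial ι ℂ} {m M : ℕ}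
    (h : m ≤ M) (hm : ℓ ^ m * f ∈ a) : ℓ ^ M * f ∈ a := by
  obtain ⟨j, rfl⟩ := Nat.exists_eq_add_of_le h
  rw [add_comm, pow_add, mul_assoc]
  exact a.mul_mem_left _ hm

namespace AffineSpaceCover

variable (c : AffineSpaceCover I σ β)

/-- Lift the chart expression of `f` to some `h ∈ a` and bring the components of `h` to a common
degree with powers of the form `b`. The result differs from a power of that form times `f` by a form
that is zero on the chart, hence in `I`. -/
theorem exists_pow_mul_mem {a : Ideal (MvPolynomial ι ℂ)} (ha : IsHomog a) (hIa : I ≤ a) (b : β)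
    {f : MvPolynomial ι ℂ} {k : ℕ} (hf : f.IsHomogeneous k)
    (h : c.chart b f ∈ a.map (c.chart b)) : ∃ M, c.form b ^ M * f ∈ a := by
  obtain ⟨h, ha', hhf⟩ := (Ideal.mem_map_iff_of_surjective _ (c.surjective b)).mp h
  refine ⟨h.totalDegree, ?_⟩
  set D := h.totalDegree with hD
  have hform : ∀ j, (c.form b ^ j).IsHomogeneous j := fun j => by
    have := (c.isHomogeneous_form b).pow j
    rwa [one_mul] at this
  have hsum : (∑ j ∈ Finset.range (D + 1),
      c.form b ^ (D + k - j) * homogeneousComponent j h).IsHomogeneous (D + k) := by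
    refine IsHomogeneous.sum _ _ _ fun j hj => ?_
    rw [Finset.mem_range] at hj
    have := (hform (D + k - j)).mul (homogeneousComponent_isHomogeneous j h)
    rwa [Nat.sub_add_cancel (by omega)] at this
  have hmem : ∑ j ∈ Finset.range (D + 1),
      c.form b ^ (D + k - j) * homogeneousComponent j h ∈ a :=
    Ideal.sum_mem _ fun j _ => Ideal.mul_mem_left _ _ (ha.component_mem ha' j)
  have h0 := (c.chart_eq_zero_iff b (((hform D).mul hf).sub hsum)).mp (by
    rw [map_sub, map_mul, map_pow, c.chart_form, one_pow, one_mul, map_sum, ← hhf]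
    have hh := congrArg (c.chart b) (sum_homogeneousComponent h)
    rw [map_sum] at hh
    rw [sub_eq_zero, ← hh, ← hD]
    refine Finset.sum_congr rfl fun j _ => ?_
    rw [map_mul, map_pow, c.chart_form, one_pow, one_mul])
  have := a.add_mem (hIa h0) hmem
  rwa [sub_add_cancel] at this

/-- If a linear form is a nonzerodivisor modulo `a` on all charts, it is one in large degrees. -/
theorem exists_regular [Finite β] {a : Ideal (MvPolynomial ι ℂ)} (ha : IsHomog a) (hIa : I ≤ a)
    {u : MvPolynomial ι ℂ} (hu : u.IsHomogeneous 1)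
    (hreg : ∀ b z, c.chart b u * z ∈ a.map (c.chart b) → z ∈ a.map (c.chart b)) :
    ∃ N, ∀ k, N ≤ k → ∀ f : MvPolynomial ι ℂ, f.IsHomogeneous k → u * f ∈ a → f ∈ a := by
  classical
  have hK := isHomog_colon ha hu
  have hpt : ∀ b f, f ∈ a.colon {u} → ∃ M, c.form b ^ M * f ∈ a := by
    intro b f hf
    have hj : ∀ j, ∃ M, c.form b ^ M * homogeneousComponent j f ∈ a := fun j => by
      refine c.exists_pow_mul_mem ha hIa b (homogeneousComponent_isHomogeneous j f) (hreg b _ ?_)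
      have := hK.component_mem hf j
      rw [Submodule.mem_colon_singleton, smul_eq_mul, mul_comm] at this
      rw [← map_mul]
      exact Ideal.mem_map_of_mem _ this
    choose M hM using hj
    refine ⟨(Finset.range (f.totalDegree + 1)).sup M, ?_⟩
    have := Ideal.sum_mem a fun j hj => pow_mul_mem_of_le
      (Finset.le_sup (s := Finset.range (f.totalDegree + 1)) hj) (hM j)
    rwa [← Finset.mul_sum, sum_homogeneousComponent] at this
  -- Finite generation of `(a : u)` makes the exponent independent of the element. Since the forms
  -- of the charts have no common zero on the variety, the Nullstellensatz then shows that `(a : u)`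
  -- and `a` agree in large degrees.
  have hunif : ∀ b, ∃ M, c.form b ^ M ∈ a.colon (a.colon {u} : Set (MvPolynomial ι ℂ)) := by
    intro b
    obtain ⟨s, hs⟩ := (IsNoetherian.noetherian (a.colon {u}) : (a.colon {u}).FG)
    have hs' : ∀ f : s, ∃ M, c.form b ^ M * f ∈ a := fun f =>
      hpt b f (hs ▸ Submodule.subset_span f.2)
    choose M hM using hs'
    refine ⟨Finset.univ.sup M, Submodule.mem_colon.mpr fun f hf => ?_⟩
    have hle : Submodule.span (MvPolynomial ι ℂ) (s : Set (MvPolynomial ι ℂ)) ≤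
        a.colon {c.form b ^ Finset.univ.sup M} := by
      rw [Submodule.span_le]
      intro g hg
      rw [SetLike.mem_coe, Submodule.mem_colon_singleton, smul_eq_mul, mul_comm]
      exact pow_mul_mem_of_le (Finset.le_sup (Finset.mem_univ _)) (hM ⟨g, hg⟩)
    rw [hs] at hle
    have := hle hf
    rwa [Submodule.mem_colon_singleton, smul_eq_mul, mul_comm] at this
  obtain ⟨N, hN⟩ := exists_forall_mem_of_zeros
    (I := a.colon (a.colon {u} : Set (MvPolynomial ι ℂ))) fun v hv => by
      refine c.cover v (fun f hf => hv f (Ideal.le_colon (hIa hf))) fun b => ?_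
      obtain ⟨M, hM⟩ := hunif b
      have := hv _ hM
      rw [map_pow] at this
      exact eq_zero_of_pow_eq_zero this
  obtain ⟨N', hN'⟩ := exists_forall_mem_of_torsion (I := a) hK fun i =>
    ⟨N, hN N le_rfl _ (isHomogeneous_X_pow i N)⟩
  refine ⟨N', fun k hk f hf huf => hN' k hk f hf ?_⟩
  rwa [Submodule.mem_colon_singleton, smul_eq_mul, mul_comm]

/-- A zero-dimensional linear section meets every chart in a finite scheme. -/
theorem finite_quotient {Q : Ideal (MvPolynomial ι ℂ)} (hQ : IsHomog Q)
    {l : MvPolynomial ι ℂ} (hl : l.IsHomogeneous 1) {N : ℕ}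
    (hN : ∀ k, N ≤ k → ∀ f : MvPolynomial ι ℂ, f.IsHomogeneous (k + 1) → f ∈ Q ⊔ Ideal.span {l})
    (b : β) : Module.Finite ℂ (MvPolynomial σ ℂ ⧸ Q.map (c.chart b)) := by
  set J := Q.map (c.chart b) with hJ
  let ψ : MvPolynomial ι ℂ →ₐ[ℂ] MvPolynomial σ ℂ ⧸ J := (Ideal.Quotient.mkₐ ℂ J).comp (c.chart b)
  have hψ : Function.Surjective ψ :=
    (Ideal.Quotient.mk_surjective (I := J)).comp (c.surjective b)
  have hψQ : ∀ f ∈ Q, ψ f = 0 := fun f hf =>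
    Ideal.Quotient.eq_zero_iff_mem.mpr (Ideal.mem_map_of_mem _ hf)
  have hψ1 : ψ (c.form b) = 1 := by
    have : ψ (c.form b) = Ideal.Quotient.mkₐ ℂ J (c.chart b (c.form b)) := rfl
    rw [this, c.chart_form, map_one]
  -- These images of the degree `k` forms increase with `k`, because the form of the chart becomes
  -- `1`. For `k ≥ N` the dimension cannot grow, since the next image lies in `l` times the present
  -- one. So they stabilize and exhaust the quotient.
  let B : ℕ → Submodule ℂ (MvPolynomial σ ℂ ⧸ J) := fun k =>
    (homogeneousSubmodule ι ℂ k).map ψ.toLinearMap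
  have hBfin : ∀ k, Module.Finite ℂ (B k) := fun k => Module.Finite.map _ _
  have hmono : Monotone B := by
    refine monotone_nat_of_le_succ fun k => ?_
    rintro _ ⟨f, hf, rfl⟩
    refine ⟨f * c.form b, IsHomogeneous.mul hf (c.isHomogeneous_form b), ?_⟩
    rw [AlgHom.toLinearMap_apply, map_mul, hψ1, mul_one]
    rfl
  have hdec : ∀ k, N ≤ k → Module.finrank ℂ (B (k + 1)) ≤ Module.finrank ℂ (B k) := by
    intro k hk
    have hle : B (k + 1) ≤ (B k).map (LinearMap.mulRight ℂ (ψ l)) := by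
      rintro _ ⟨f, hf, rfl⟩
      obtain ⟨g, hg, hgf⟩ := exists_component_of_mem_sup hQ hl hf (hN k hk f hf)
      refine ⟨ψ g, ⟨g, hg, rfl⟩, ?_⟩
      have := hψQ _ hgf
      rw [map_sub, sub_eq_zero, map_mul] at this
      exact this.symm
    have : Module.Finite ℂ ((B k).map (LinearMap.mulRight ℂ (ψ l))) := Module.Finite.map _ _
    exact (Submodule.finrank_mono hle).trans (Submodule.finrank_map_le _ _)
  have hconst : ∀ k, N ≤ k → B k = B N := by
    intro k hk
    induction k, hk using Nat.le_induction with
    | base => rfl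
    | succ k hk ih =>
      rw [← ih]
      exact (Submodule.eq_of_le_of_finrank_le (hmono (Nat.le_succ k)) (hdec k hk)).symm
  have htop : B N = ⊤ := by
    rw [eq_top_iff]
    intro x _
    obtain ⟨f, rfl⟩ := hψ x
    rw [← hconst (max N f.totalDegree) (le_max_left _ _)]
    have : ∑ j ∈ Finset.range (f.totalDegree + 1), ψ (homogeneousComponent j f) ∈
        B (max N f.totalDegree) := Submodule.sum_mem _ fun j hj =>
      hmono (a := j) (by rw [Finset.mem_range] at hj; omega)
        ⟨_, homogeneousComponent_mem j f, rfl⟩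
    rwa [← map_sum, sum_homogeneousComponent] at this
  exact ⟨htop ▸ Module.Finite.iff_fg.mp (hBfin N)⟩

variable {V : Type*} [AddCommGroup V] [Module ℂ V] [Module.Finite ℂ V]

/-- Here `W` holds the sections already made and `m` counts those left. Positive depth on each chart
means that no nonzero residue class is killed by all of `θ(V)`, so a new `v ∉ W` can be found that
is regular on every chart. Cutting by it lowers `m`, the degree bound and the required depth by one.
-/
theorem quotDim_section_aux [Finite σ] [Finite β] (hI : IsHomog I) (θ : V →ₗ[ℂ] MvPolynomial ι ℂ)
    (hθ : ∀ v, (θ v).IsHomogeneous 1) (m : ℕ) (W : Submodule ℂ V)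
    (hW : Module.finrank ℂ W + m = Module.finrank ℂ V)
    (hdepth : ∀ b, HasDepth (Ideal.span (Set.range fun v => c.chart b (θ v))) m
      ((I ⊔ Ideal.span (θ '' W)).map (c.chart b)))
    {P : ℚ[X]} (hPm : P.natDegree ≤ m)
    (hP : ∀ᶠ k : ℕ in Filter.atTop, P.eval (k : ℚ) = quotDim (I ⊔ Ideal.span (θ '' W)) k) :
    ∀ᶠ k : ℕ in Filter.atTop, (quotDim (I ⊔ Ideal.span (Set.range θ)) k : ℚ) =
      m.factorial * P.coeff m := by
  induction m generalizing W P with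
  | zero =>
    have : W = ⊤ := Submodule.eq_top_of_finrank_eq hW
    subst this
    rw [Submodule.top_coe, Set.image_univ] at hP
    filter_upwards [hP] with k hk
    rw [← hk, Polynomial.eq_C_of_natDegree_le_zero hPm]
    simp
  | succ m ih =>
    set a := I ⊔ Ideal.span (θ '' W) with ha_def
    have ha : IsHomog a := hI.sup (isHomog_span (e := 1) (by
      rintro _ ⟨v, -, rfl⟩
      exact hθ v))
    obtain ⟨v, hvW, hv⟩ := exists_notMem_forall_regular (J := β)
      (S := fun _ => MvPolynomial σ ℂ) (fun b => (c.chart b).toLinearMap ∘ₗ θ)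
      (fun b => a.map (c.chart b)) (fun b z hz => by
        obtain ⟨x, hx, hxreg, -⟩ := hdepth b
        by_contra! hcon
        have hle : Ideal.span (Set.range fun v => c.chart b (θ v)) ≤
            (a.map (c.chart b)).colon {z} := by
          rw [Ideal.span_le]
          rintro _ ⟨v, rfl⟩
          rw [SetLike.mem_coe, Submodule.mem_colon_singleton, smul_eq_mul]
          exact hcon v
        have := hle hx
        rw [Submodule.mem_colon_singleton, smul_eq_mul] at this
        exact hz (hxreg z this)) W (by
        rintro rfl
        rw [finrank_top] at hW
        omega)
    have hva : a ⊔ Ideal.span {θ v} = I ⊔ Ideal.span (θ '' (W ⊔ Submodule.span ℂ {v} : Submodule ℂ V)) := by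
      rw [ha_def, sup_assoc, ← Ideal.span_union]
      congr 1
      refine le_antisymm (Ideal.span_mono ?_) (Ideal.span_le.mpr ?_)
      · rintro _ (⟨w, hw, rfl⟩ | rfl)
        · exact ⟨w, Submodule.mem_sup_left hw, rfl⟩
        · exact ⟨v, Submodule.mem_sup_right (Submodule.mem_span_singleton_self v), rfl⟩
      · rintro _ ⟨w, hw, rfl⟩
        obtain ⟨w₀, hw₀, w', hw', rfl⟩ := Submodule.mem_sup.mp hw
        obtain ⟨t, rfl⟩ := Submodule.mem_span_singleton.mp hw'
        rw [map_add, map_smul, SetLike.mem_coe, MvPolynomial.smul_eq_C_mul]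
        exact Ideal.add_mem _ (Ideal.subset_span (Or.inl ⟨w₀, hw₀, rfl⟩))
          (Ideal.mul_mem_left _ _ (Ideal.subset_span (Or.inr rfl)))
    obtain ⟨N, hN⟩ := c.exists_regular ha le_sup_left (hθ v) hv
    have hcoeff := coeff_sub_taylor hPm
    have hrank : Module.finrank ℂ (W ⊔ Submodule.span ℂ {v} : Submodule ℂ V) + m =
        Module.finrank ℂ V := by
      rw [Submodule.finrank_sup_span_singleton hvW]
      omega
    have := ih (W ⊔ Submodule.span ℂ {v}) hrank (fun b => by
      rw [← hva, Ideal.map_sup, Ideal.map_span, Set.image_singleton]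
      exact (hdepth b).sup_span (Ideal.subset_span ⟨v, rfl⟩) (hv b)) hcoeff.1 (by
      obtain ⟨M, hM⟩ := Filter.eventually_atTop.mp hP
      refine Filter.eventually_atTop.mpr ⟨max N M + 1, fun k hk => ?_⟩
      obtain ⟨j, rfl⟩ := Nat.exists_eq_add_of_le' (show 1 ≤ k by omega)
      have h1 := quotDim_sup_linear ha (hθ v) (hN j (by omega))
      have h2 := hM j (by omega)
      have h3 := hM (j + 1) (by omega)
      rw [← hva, Polynomial.eval_sub, h3, Polynomial.taylor_eval, ← h1]
      push_cast at h2 ⊢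
      rw [show (j : ℚ) + 1 + -1 = j by ring, h2]
      ring)
    filter_upwards [this] with k hk
    rw [hk, hcoeff.2, Nat.factorial_succ]
    push_cast
    ring

/-- The Hilbert polynomial of a zero-dimensional section by `r = dim` hyperplanes is the degree. -/
theorem quotDim_section (c : AffineSpaceCover I σ β) [Finite σ] [Finite β] (hI : IsHomog I) (θ : V →ₗ[ℂ] MvPolynomial ι ℂ)
    (hθ : ∀ v, (θ v).IsHomogeneous 1) (hV : Module.finrank ℂ V = Nat.card σ)
    {l : MvPolynomial ι ℂ} (hl : l.IsHomogeneous 1) {N : ℕ}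
    (hN : ∀ k, N ≤ k → ∀ f : MvPolynomial ι ℂ, f.IsHomogeneous (k + 1) →
      f ∈ I ⊔ Ideal.span (Set.range θ) ⊔ Ideal.span {l})
    {P : ℚ[X]} (hPm : P.natDegree ≤ Nat.card σ)
    (hP : ∀ᶠ k : ℕ in Filter.atTop, P.eval (k : ℚ) = quotDim I k) :
    ∀ᶠ k : ℕ in Filter.atTop, (quotDim (I ⊔ Ideal.span (Set.range θ)) k : ℚ) =
      (Nat.card σ).factorial * P.coeff (Nat.card σ) := by
  have hspan : Ideal.span (θ '' (⊥ : Submodule ℂ V)) = ⊥ := by simp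
  have hQ : IsHomog (I ⊔ Ideal.span (Set.range θ)) := hI.sup (isHomog_span (e := 1) (by
    rintro _ ⟨v, rfl⟩
    exact hθ v))
  have hmapI : ∀ b, I.map (c.chart b) = ⊥ := fun b => by
    rw [eq_bot_iff, Ideal.map_le_iff_le_comap]
    intro f hf
    rw [Ideal.mem_comap, Ideal.mem_bot, ← sum_homogeneousComponent f, map_sum]
    exact Finset.sum_eq_zero fun j _ =>
      (c.chart_eq_zero_iff b (homogeneousComponent_isHomogeneous j f)).mpr (hI.component_mem hf j)
  refine c.quotDim_section_aux hI θ hθ _ ⊥ (by rw [finrank_bot, hV, zero_add]) (fun b => ?_) hPm ?_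
  · rw [hspan, sup_bot_eq, hmapI]
    -- On a chart `I` becomes zero, so what has to have depth `r` is just the ideal of the linear
    -- section, and `finite_quotient` shows that it has finite codimension.
    refine hasDepth_of_finite _ ?_
    have := c.finite_quotient hQ hl hN b
    rwa [Ideal.map_sup, hmapI, bot_sup_eq, Ideal.map_span, ← Set.range_comp] at this
  · rwa [hspan, sup_bot_eq]

end AffineSpaceCover

end Cover

/-! ### Fibers of central projections -/

section Fibers

open MvPolynomial

attribute [local instance] MvPolynomial.gradedAlgebra

variable {ι : Type} [Fintype ι] [DecidableEq ι]

theorem le_pointIdeal_mk {I : Ideal (MvPolynomial ι ℂ)} (hI : IsHomog I) {v : ι → ℂ} (hv : v ≠ 0)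
    (h : ∀ f ∈ I, MvPolynomial.eval v f = 0) : I ≤ pointIdeal (Projectivization.mk ℂ v hv) :=
  fun f hf => mem_of_components fun k =>
    (mem_pointIdeal_mk_iff hv (homogeneousComponent_isHomogeneous k f)).mpr
      (h _ (hI.component_mem hf k))

/-- `linearForm` as a linear map. -/
def linearFormₗ : ((ι → ℂ) →ₗ[ℂ] ℂ) →ₗ[ℂ] MvPolynomial ι ℂ where
  toFun := linearForm
  map_add' g h := by
    simp only [linearForm, LinearMap.add_apply, map_add, add_mul, Finset.sum_add_distrib]
  map_smul' t g := by
    simp only [linearForm, LinearMap.smul_apply, smul_eq_mul, map_mul, RingHom.id_apply,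
      MvPolynomial.smul_eq_C_mul, Finset.mul_sum, mul_assoc]

theorem isHomogeneous_linearForm (g : (ι → ℂ) →ₗ[ℂ] ℂ) : (linearForm g).IsHomogeneous 1 :=
  IsHomogeneous.sum _ _ _ fun _ _ => isHomogeneous_C_mul_X _ _

theorem eval_linearForm (g : (ι → ℂ) →ₗ[ℂ] ℂ) (v : ι → ℂ) :
    MvPolynomial.eval v (linearForm g) = g v := by
  rw [LinearMap.pi_apply_eq_sum_univ g v]
  simp only [linearForm, map_sum, map_mul, MvPolynomial.eval_C, MvPolynomial.eval_X, smul_eq_mul]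
  refine Finset.sum_congr rfl fun i _ => ?_
  rw [mul_comm]
  congr 2
  funext j
  simp [Pi.single_apply, eq_comm]

theorem mem_span_of_forall_dual {W : Type*} [AddCommGroup W] [Module ℂ W] {y w : W}
    (h : ∀ g : W →ₗ[ℂ] ℂ, g y = 0 → g w = 0) : w ∈ Submodule.span ℂ {y} := by
  rw [← Subspace.forall_mem_dualAnnihilator_apply_eq_zero_iff]
  intro g hg
  refine h g ?_
  rw [Submodule.mem_dualAnnihilator] at hg
  exact hg y (Submodule.mem_span_singleton_self y)

/-- A vector on which all functionals vanishing at `y` vanish lies on the line `y`, by biduality. -/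
theorem fiberIdeal_le_pointIdeal_iff {W : Type} [AddCommGroup W] [Module ℂ W]
    (L : (ι → ℂ) →ₗ[ℂ] W) (y : ℙ ℂ W) {v : ι → ℂ} (hv : v ≠ 0) (hLv : L v ≠ 0) :
    fiberIdeal L y ≤ pointIdeal (Projectivization.mk ℂ v hv) ↔
      Projectivization.mk ℂ (L v) hLv = y := by
  rw [fiberIdeal, Ideal.span_le]
  constructor
  · intro h
    have h1 : L v ∈ Submodule.span ℂ {y.rep} := mem_span_of_forall_dual fun g hg => by
      have := h ⟨g, hg, rfl⟩
      rw [SetLike.mem_coe, mem_pointIdeal_mk_iff hv (isHomogeneous_linearForm _),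
        eval_linearForm] at this
      exact this
    obtain ⟨t, ht⟩ := Submodule.mem_span_singleton.mp h1
    conv_rhs => rw [← y.mk_rep]
    rw [Projectivization.mk_eq_mk_iff']
    exact ⟨t, ht⟩
  · rintro rfl _ ⟨g, hg, rfl⟩
    obtain ⟨a, ha⟩ := Projectivization.exists_smul_eq_mk_rep ℂ (L v) hLv
    rw [← ha, Units.smul_def, map_smul, smul_eq_mul, mul_eq_zero] at hg
    rw [SetLike.mem_coe, mem_pointIdeal_mk_iff hv (isHomogeneous_linearForm _), eval_linearForm]
    exact hg.resolve_left a.ne_zero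

/-- A finite linear projection of an `r`-dimensional projective variety covered by affine spaces
to `ℙ^r` is onto, and all its fibers have `deg` points, counted with multiplicity. -/
theorem surjective_and_fibersHaveCount {T : Set (ℙ ℂ (ι → ℂ))}
    (hT : ∀ x, homogeneousIdeal T ≤ pointIdeal x → x ∈ T) {σ β : Type} [Finite σ] [Finite β]
    (c : AffineSpaceCover (homogeneousIdeal T) σ β) {P : ℚ[X]} (hP : IsHilbertPolynomial T P)
    (hPσ : P.natDegree ≤ Nat.card σ) {d : ℕ} (hd0 : 0 < d)
    (hd : ((Nat.card σ).factorial : ℚ) * P.coeff (Nat.card σ) = d)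
    {W : Type} [AddCommGroup W] [Module ℂ W] [Module.Finite ℂ W]
    (hW : Module.finrank ℂ W = Nat.card σ + 1) (L : (ι → ℂ) →ₗ[ℂ] W)
    {S : Set (ℙ ℂ (ι → ℂ))} (hTS : S = T) (f : S → ℙ ℂ W)
    (hf : ∀ (v : ι → ℂ) (hv : v ≠ 0) (hS : Projectivization.mk ℂ v hv ∈ S),
      ∃ h : L v ≠ 0, f ⟨Projectivization.mk ℂ v hv, hS⟩ = Projectivization.mk ℂ (L v) h) :
    Function.Surjective f ∧ FibersHaveCount T S L f d := by
  have key : ∀ y : ℙ ℂ W, {x : S | f x = y}.Finite ∧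
      ∑ᶠ x ∈ {x : S | f x = y}, fiberMultiplicity T L y x.1 = (d : ℕ∞) := by
    intro y
    have hI := isHomog_homogeneousIdeal T
    let V := (Submodule.span ℂ {y.rep}).dualAnnihilator
    let θ : V →ₗ[ℂ] MvPolynomial ι ℂ :=
      linearFormₗ ∘ₗ (LinearMap.lcomp ℂ ℂ L) ∘ₗ V.subtype
    have hV : ∀ g : W →ₗ[ℂ] ℂ, g ∈ V ↔ g y.rep = 0 := fun g => by
      rw [Submodule.mem_dualAnnihilator]
      refine ⟨fun h => h _ (Submodule.mem_span_singleton_self _), fun h w hw => ?_⟩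
      obtain ⟨t, rfl⟩ := Submodule.mem_span_singleton.mp hw
      rw [map_smul, h, smul_zero]
    have hθ : ∀ g, θ g = linearForm (g.1 ∘ₗ L) := fun g => rfl
    have hfib : fiberIdeal L y = Ideal.span (Set.range θ) := by
      rw [fiberIdeal]
      congr 1
      ext q
      constructor
      · rintro ⟨g, hg, rfl⟩
        exact ⟨⟨g, (hV g).mpr hg⟩, rfl⟩
      · rintro ⟨g, rfl⟩
        exact ⟨g.1, (hV _).mp g.2, rfl⟩
    have hrank : Module.finrank ℂ V = Nat.card σ := by
      have h1 := Subspace.finrank_add_finrank_dualAnnihilator_eq (Submodule.span ℂ {y.rep})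
      rw [finrank_span_singleton y.rep_nonzero, hW] at h1
      change Module.finrank ℂ (Submodule.span ℂ {y.rep}).dualAnnihilator = _
      omega
    obtain ⟨g₀, hg₀⟩ : ∃ g₀ : W →ₗ[ℂ] ℂ, g₀ y.rep ≠ 0 := by
      by_contra! h
      exact y.rep_nonzero ((Module.forall_dual_apply_eq_zero_iff ℂ y.rep).mp h)
    -- On `T` the forms in `θ` force `L v` onto the line of `y`, and `g₀` forces it to be zero
    -- there. Since `L v ≠ 0` on `T`, the intersection is empty.
    obtain ⟨N, hN⟩ := exists_forall_mem_of_zeros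
      (I := homogeneousIdeal T ⊔ Ideal.span (Set.range θ) ⊔
        Ideal.span {linearForm (g₀ ∘ₗ L)}) fun v hv => by
        by_contra hv0
        have h1 : Projectivization.mk ℂ v hv0 ∈ T := hT _ (le_pointIdeal_mk hI hv0 fun q hq =>
          hv q (Ideal.mem_sup_left (Ideal.mem_sup_left hq)))
        obtain ⟨h2, -⟩ := hf v hv0 (hTS ▸ h1)
        have h3 : L v ∈ Submodule.span ℂ {y.rep} := mem_span_of_forall_dual fun g hg => by
          have := hv (θ ⟨g, (hV g).mpr hg⟩)
            (Ideal.mem_sup_left (Ideal.mem_sup_right (Ideal.subset_span ⟨_, rfl⟩)))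
          rw [hθ, eval_linearForm] at this
          exact this
        obtain ⟨t, ht⟩ := Submodule.mem_span_singleton.mp h3
        have h4 := hv _ (Ideal.mem_sup_right (Ideal.mem_span_singleton_self _))
        rw [eval_linearForm, LinearMap.comp_apply, ← ht, map_smul, smul_eq_mul, mul_eq_zero] at h4
        rw [h4.resolve_right hg₀, zero_smul] at ht
        exact h2 ht.symm
    have hQ : IsHomog (homogeneousIdeal T ⊔ fiberIdeal L y) := by
      rw [hfib]
      exact hI.sup (isHomog_span (e := 1) (by
        rintro _ ⟨v, rfl⟩
        exact isHomogeneous_linearForm _))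
    have hdim := c.quotDim_section hI θ (fun g => isHomogeneous_linearForm _) hrank
      (isHomogeneous_linearForm (g₀ ∘ₗ L)) (N := N)
      (fun k hk q hq => hN (k + 1) (by omega) q hq) hPσ hP
    rw [hd, ← hfib] at hdim
    rw [← hfib] at hN
    have hset : {x : ℙ ℂ (ι → ℂ) | homogeneousIdeal T ⊔ fiberIdeal L y ≤ pointIdeal x} =
        Subtype.val '' {x : S | f x = y} := by
      ext x
      obtain ⟨v, hv, rfl⟩ : ∃ v, ∃ hv : v ≠ 0, x = Projectivization.mk ℂ v hv :=
        ⟨x.rep, x.rep_nonzero, x.mk_rep.symm⟩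
      rw [Set.mem_ofPred_eq, sup_le_iff]
      constructor
      · rintro ⟨h1, h2⟩
        have hS : Projectivization.mk ℂ v hv ∈ S := hTS ▸ hT _ h1
        obtain ⟨h3, h4⟩ := hf v hv hS
        exact ⟨⟨_, hS⟩, h4.trans ((fiberIdeal_le_pointIdeal_iff L y hv h3).mp h2), rfl⟩
      · rintro ⟨⟨x, hS⟩, hx, hxv⟩
        change x = _ at hxv
        subst hxv
        obtain ⟨h3, h4⟩ := hf v hv hS
        refine ⟨iInf₂_le _ (hTS ▸ hS), (fiberIdeal_le_pointIdeal_iff L y hv h3).mpr ?_⟩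
        rw [← h4]
        exact hx
    have hN' : ∀ q : MvPolynomial ι ℂ, q.IsHomogeneous (N + 1) →
        q ∈ homogeneousIdeal T ⊔ fiberIdeal L y ⊔ Ideal.span {linearForm (g₀ ∘ₗ L)} :=
      fun q hq => hN (N + 1) (Nat.le_succ N) q hq
    have hfin := finite_points hQ (isHomogeneous_linearForm (g₀ ∘ₗ L)) hN'
    have hsum := finsum_localLength hQ (isHomogeneous_linearForm (g₀ ∘ₗ L)) hN' (d := d)
      (hdim.mono fun k hk => by exact_mod_cast hk)
    rw [hset] at hfin hsum
    refine ⟨hfin.of_finite_image Subtype.val_injective.injOn, ?_⟩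
    rw [finsum_mem_image Subtype.val_injective.injOn] at hsum
    exact hsum
  -- An empty fiber would have count zero, whereas `d` is positive.
  refine ⟨fun y => ?_, key⟩
  by_contra! hy
  have h1 := (key y).2
  have h2 : {x : S | f x = y} = ∅ := Set.eq_empty_iff_forall_notMem.mpr hy
  rw [h2, finsum_mem_empty] at h1
  have : d = 0 := by exact_mod_cast h1.symm
  omega

end Fibers

/-! ### Plücker coordinates -/

section Plucker

variable {n : ℕ}

theorem rowBlock_map {R R' : Type} [CommRing R] [CommRing R'] (φ : R →+* R')
    (A B : Matrix (Fin n) (Fin n) R) :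
    (rowBlock A B).map φ = rowBlock (A.map φ) (B.map φ) := by
  ext i k
  refine Fin.addCases (fun k => ?_) (fun k => ?_) k <;> simp [-Fin.natAdd_eq_addNat, rowBlock]

theorem mul_rowBlock {R : Type} [CommRing R] (C A B : Matrix (Fin n) (Fin n) R) :
    C * rowBlock A B = rowBlock (C * A) (C * B) := by
  ext i k
  refine Fin.addCases (fun k => ?_) (fun k => ?_) k <;>
    simp [-Fin.natAdd_eq_addNat, rowBlock, Matrix.mul_apply]

theorem exists_eq_rowBlock {R : Type} (M : Matrix (Fin n) (Fin (n + n)) R) :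
    ∃ A B, M = rowBlock A B := by
  refine ⟨M.submatrix id (Fin.castAdd n), M.submatrix id (Fin.natAdd n), ?_⟩
  ext i k
  refine Fin.addCases (fun k => ?_) (fun k => ?_) k <;> simp [-Fin.natAdd_eq_addNat, rowBlock]

theorem plucker_map {R R' : Type} [CommRing R] [CommRing R'] (φ : R →+* R')
    (M : Matrix (Fin n) (Fin (n + n)) R) (I : PluckerIndex n) :
    plucker (M.map φ) I = φ (plucker M I) := by
  rw [plucker, plucker, RingHom.map_det]
  rfl

theorem plucker_mul {R : Type} [CommRing R] (A : Matrix (Fin n) (Fin n) R)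
    (M : Matrix (Fin n) (Fin (n + n)) R) : plucker (A * M) = A.det • plucker M := by
  funext I
  rw [Pi.smul_apply, smul_eq_mul, plucker, plucker, ← Matrix.det_mul]
  rfl

theorem det_stack_rowBlock {R : Type} [CommRing R] (A B C D : Matrix (Fin n) (Fin n) R) :
    (stack (rowBlock A B) (rowBlock C D)).det = (Matrix.fromBlocks A B C D).det := by
  rw [← Matrix.det_submatrix_equiv_self (finSumFinEquiv (m := n) (n := n)).symm
    (Matrix.fromBlocks A B C D)]
  congr 1
  ext i k
  refine Fin.addCases (fun i => ?_) (fun i => ?_) i <;>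
    refine Fin.addCases (fun k => ?_) (fun k => ?_) k <;> simp [-Fin.natAdd_eq_addNat, stack, rowBlock]

theorem charPoly_apply (D N : Matrix (Fin n) (Fin n) ℂ[X]) (z : PluckerIndex n → ℂ) :
    charPoly D N z = ∑ I, z I • cofactorPoly D N I := by
  simp [charPoly]

theorem charPoly_plucker (D N : Matrix (Fin n) (Fin n) ℂ[X])
    (M : Matrix (Fin n) (Fin (n + n)) ℂ) :
    charPoly D N (plucker M) = (stack (rowBlock D N) (M.map Polynomial.C)).det := by
  rw [det_stack, charPoly_apply]
  refine Finset.sum_congr rfl fun I _ => ?_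
  rw [plucker_map, Polynomial.smul_eq_C_mul]

/-- The linear form in the Plücker coordinates of `M` given by `det [A B; M]`. -/
def blockForm (A B : Matrix (Fin n) (Fin n) ℂ) : (PluckerIndex n → ℂ) →ₗ[ℂ] ℂ :=
  Polynomial.lcoeff ℂ 0 ∘ₗ charPoly (A.map Polynomial.C) (B.map Polynomial.C)

theorem blockForm_plucker (A B C D : Matrix (Fin n) (Fin n) ℂ) :
    blockForm A B (plucker (rowBlock C D)) = (Matrix.fromBlocks A B C D).det := by
  rw [blockForm, LinearMap.comp_apply, charPoly_plucker, rowBlock_map, det_stack_rowBlock,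
    ← Matrix.fromBlocks_map, ← RingHom.mapMatrix_apply, ← RingHom.map_det,
    Polynomial.lcoeff_apply, Polynomial.coeff_C_zero]

theorem blockForm_one_plucker (B C D : Matrix (Fin n) (Fin n) ℂ) :
    blockForm 1 B (plucker (rowBlock C D)) = (D - C * B).det := by
  rw [blockForm_plucker, Matrix.det_fromBlocks_one₁₁]

/-- For distinct columns the minor is a Plücker coordinate up to the sign of the sorting
permutation; for a repeated column it is zero. -/
theorem exists_form_eq_det_submatrix (f : Fin n → Fin (n + n)) :
    ∃ g : (PluckerIndex n → ℂ) →ₗ[ℂ] ℂ, ∀ M : Matrix (Fin n) (Fin (n + n)) ℂ,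
      (M.submatrix id f).det = g (plucker M) := by
  by_cases hf : Function.Injective f
  · have hcard : (Finset.univ.image f).card = n := by
      rw [Finset.card_image_of_injective _ hf]; simp
    let I : PluckerIndex n := ⟨Finset.univ.image f, hcard⟩
    have hmem : ∀ i, ∃ j, I.1.orderEmbOfFin I.2 j = f i := fun i => by
      have : f i ∈ Set.range (I.1.orderEmbOfFin I.2) := by simp [I]
      exact this
    choose σ hσ using hmem
    have hinj : Function.Injective σ := fun a b hab => hf (by rw [← hσ a, ← hσ b, hab])
    let e : Equiv.Perm (Fin n) := Equiv.ofBijective σ (Finite.injective_iff_bijective.mp hinj)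
    refine ⟨((Equiv.Perm.sign e : ℤ) : ℂ) • LinearMap.proj I, fun M => ?_⟩
    have : M.submatrix id f = (M.submatrix id (I.1.orderEmbOfFin I.2)).submatrix id e := by
      ext i j
      simp [e, hσ]
    rw [this, Matrix.det_permute']
    rfl
  · refine ⟨0, fun M => ?_⟩
    rw [Function.Injective] at hf
    push Not at hf
    obtain ⟨i, j, hij, hne⟩ := hf
    rw [LinearMap.zero_apply]
    exact Matrix.det_zero_of_column_eq hne fun k => by simp [hij]

/-- The coordinates of the rows of `adj(M_K) M`, as linear forms in the Plücker coordinates. -/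
theorem exists_adjugate_forms (K : PluckerIndex n) :
    ∃ Y : Fin n → Fin (n + n) → (PluckerIndex n → ℂ) →ₗ[ℂ] ℂ,
      ∀ M : Matrix (Fin n) (Fin (n + n)) ℂ, (Matrix.of fun i k => Y i k (plucker M)) =
        (M.submatrix id (K.1.orderEmbOfFin K.2)).adjugate * M := by
  -- By Cramer's rule the entry `(i, k)` of `adj(M_K) M` is the minor on the columns `K` with the
  -- `i`-th one replaced by `k`.
  choose Y hY using fun (i : Fin n) (k : Fin (n + n)) =>
    exists_form_eq_det_submatrix (Function.update (K.1.orderEmbOfFin K.2) i k)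
  refine ⟨Y, fun M => ?_⟩
  ext i k
  have h1 : ((M.submatrix id (K.1.orderEmbOfFin K.2)).adjugate * M) i k =
      ((M.submatrix id (K.1.orderEmbOfFin K.2)).adjugate *ᵥ fun j => M j k) i := rfl
  rw [Matrix.of_apply, ← hY, h1, ← Matrix.cramer_eq_adjugate_mulVec, Matrix.cramer_apply]
  congr 1
  ext a b
  by_cases h : b = i
  · subst h; simp
  · simp [Matrix.updateCol_ne h, Function.update_of_ne h]

end Plucker

/-! ### Symmetric complements -/

section Complement

variable {n : ℕ}

theorem exists_dotProduct_ne_zero {a b : Fin n → ℂ} (ha : a ≠ 0) (hb : b ≠ 0) :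
    ∃ u : Fin n → ℂ, a ⬝ᵥ u ≠ 0 ∧ u ⬝ᵥ b ≠ 0 := by
  by_contra! hcon
  let p : Bool → Subspace ℂ (Fin n → ℂ) := fun t =>
    LinearMap.ker (dotProductBilin ℂ ℂ (if t then a else b))
  have hcov : ⋃ t, (p t : Set (Fin n → ℂ)) = Set.univ := by
    rw [Set.eq_univ_iff_forall]
    intro u
    rw [Set.mem_iUnion]
    by_cases h : a ⬝ᵥ u = 0
    · exact ⟨true, h⟩
    · refine ⟨false, ?_⟩
      have := hcon u h
      rw [dotProduct_comm] at this
      exact this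
  obtain ⟨t, ht⟩ := Subspace.exists_eq_top_of_iUnion_eq_univ hcov
  have key : ∀ c : Fin n → ℂ, (∀ u, c ⬝ᵥ u = 0) → c = 0 := fun c hc => dotProduct_eq_zero c hc
  cases t with
  | true => exact ha (key a fun u => (ht ▸ Submodule.mem_top : u ∈ p true))
  | false => exact hb (key b fun u => (ht ▸ Submodule.mem_top : u ∈ p false))

/-- Every `n`-dimensional subspace of `ℂ^(2n)` is transversal to the row space of some `[I B]`
with `B` symmetric. -/
theorem exists_symmetric_det_ne_zero (M₁ M₂ : Matrix (Fin n) (Fin n) ℂ)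
    (h : ∀ x, x ᵥ* M₁ = 0 → x ᵥ* M₂ = 0 → x = 0) :
    ∃ B : Matrix (Fin n) (Fin n) ℂ, Bᵀ = B ∧ (M₂ - M₁ * B).det ≠ 0 := by
  let r : {B : Matrix (Fin n) (Fin n) ℂ // Bᵀ = B} → ℕ := fun B =>
    Module.finrank ℂ (LinearMap.ker (M₂ - M₁ * B.1).mulVecLin)
  have : Nonempty {B : Matrix (Fin n) (Fin n) ℂ // Bᵀ = B} := ⟨⟨0, Matrix.transpose_zero⟩⟩
  -- Take `B` with smallest kernel. If the kernel is nonzero, adding `u uᵗ` shrinks it: `u` pairs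
  -- nontrivially with `x M₁`, `x` a left null vector, so new null vectors are orthogonal to `u` and
  -- hence old ones, while `u` is not orthogonal to the old null vector `y`.
  obtain ⟨⟨B, hB⟩, hmin⟩ : ∃ B, ∀ B', r B ≤ r B' :=
    ⟨Function.argmin r, fun B' => Function.argmin_le r B'⟩
  refine ⟨B, hB, fun hdet => ?_⟩
  obtain ⟨y, hy0, hy⟩ := Matrix.exists_mulVec_eq_zero_iff.mpr hdet
  obtain ⟨x, hx0, hx⟩ := Matrix.exists_vecMul_eq_zero_iff.mpr hdet
  have hxM : x ᵥ* M₁ ≠ 0 := by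
    intro h0
    refine hx0 (h x h0 ?_)
    rwa [Matrix.vecMul_sub, ← Matrix.vecMul_vecMul, h0, Matrix.zero_vecMul, sub_zero] at hx
  obtain ⟨u, hu1, hu2⟩ := exists_dotProduct_ne_zero hxM hy0
  have hsym : (B + vecMulVec u u)ᵀ = B + vecMulVec u u := by
    rw [Matrix.transpose_add, hB, Matrix.transpose_vecMulVec]
  refine absurd (hmin ⟨_, hsym⟩) (not_le.mpr (Submodule.finrank_lt_finrank_of_lt ?_))
  have hexp : ∀ v, (M₂ - M₁ * (B + vecMulVec u u)) *ᵥ v =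
      (M₂ - M₁ * B) *ᵥ v - (u ⬝ᵥ v) • (M₁ *ᵥ u) := fun v => by
    rw [mul_add, ← sub_sub, Matrix.sub_mulVec, ← Matrix.mulVec_mulVec, Matrix.vecMulVec_mulVec,
      op_smul_eq_smul, Matrix.mulVec_smul]
  have huv : ∀ v, (M₂ - M₁ * (B + vecMulVec u u)) *ᵥ v = 0 → u ⬝ᵥ v = 0 := fun v hv => by
    rw [hexp] at hv
    have := congrArg (fun w => x ⬝ᵥ w) hv
    simp only [dotProduct_sub, dotProduct_mulVec, hx, zero_dotProduct, dotProduct_smul, zero_sub,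
      dotProduct_zero, neg_eq_zero, smul_eq_mul, mul_eq_zero] at this
    exact this.resolve_right hu1
  refine lt_of_le_of_ne (fun v hv => ?_) fun heq => hu2 (huv y ?_)
  · rw [LinearMap.mem_ker, Matrix.mulVecLin_apply] at hv ⊢
    have h0 := huv v hv
    rwa [hexp, h0, zero_smul, sub_zero] at hv
  · have : y ∈ LinearMap.ker (M₂ - M₁ * B).mulVecLin := by
      rw [LinearMap.mem_ker, Matrix.mulVecLin_apply, hy]
    rw [← heq, LinearMap.mem_ker, Matrix.mulVecLin_apply] at this
    exact this

end Complement

/-! ### Affine charts of the Lagrangian Grassmannian -/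

section Charts

open MvPolynomial

attribute [local instance] MvPolynomial.gradedAlgebra

variable {n : ℕ}

/-- The symmetric matrix with given entries. -/
def symMat {R : Type} (p : Sym2 (Fin n) → R) : Matrix (Fin n) (Fin n) R :=
  Matrix.of fun i j => p s(i, j)

theorem symMat_transpose {R : Type} (p : Sym2 (Fin n) → R) : (symMat p)ᵀ = symMat p := by
  ext i j
  simp [symMat, Sym2.eq_swap]

theorem exists_eq_symMat {R : Type} {F : Matrix (Fin n) (Fin n) R} (hF : Fᵀ = F) :
    ∃ p, F = symMat p := by
  refine ⟨Sym2.lift ⟨fun i j => F i j, fun i j => congrFun (congrFun hF.symm i) j⟩, ?_⟩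
  ext i j
  simp [symMat]

/-- The coordinate ring of the space of symmetric matrices. -/
abbrev SymPoly (n : ℕ) : Type := MvPolynomial (Sym2 (Fin n)) ℂ

/-- The generic symmetric matrix. -/
def genericSym (n : ℕ) : Matrix (Fin n) (Fin n) (SymPoly n) := symMat MvPolynomial.X

theorem genericSym_map (p : Sym2 (Fin n) → ℂ) :
    (genericSym n).map (MvPolynomial.eval p) = symMat p := by
  ext i j
  simp [genericSym, symMat]

theorem map_C_map_eval (p : Sym2 (Fin n) → ℂ) (B : Matrix (Fin n) (Fin n) ℂ) :
    (B.map (MvPolynomial.C : ℂ →+* SymPoly n)).map (MvPolynomial.eval p) = B := by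
  ext i j
  simp

/-- The chart `F ↦ rowsp [F  I + F B]`. -/
def chartMap (B : Matrix (Fin n) (Fin n) ℂ) :
    MvPolynomial (PluckerIndex n) ℂ →ₐ[ℂ] SymPoly n :=
  MvPolynomial.aeval (plucker (rowBlock (genericSym n)
    (1 + genericSym n * B.map (MvPolynomial.C : ℂ →+* SymPoly n))))

theorem eval_chartMap (B : Matrix (Fin n) (Fin n) ℂ) (p : Sym2 (Fin n) → ℂ)
    (f : MvPolynomial (PluckerIndex n) ℂ) : MvPolynomial.eval p (chartMap B f) =
      MvPolynomial.eval (plucker (rowBlock (symMat p) (1 + symMat p * B))) f := by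
  have h : (rowBlock (genericSym n)
      (1 + genericSym n * B.map (MvPolynomial.C : ℂ →+* SymPoly n))).map (MvPolynomial.eval p) =
      rowBlock (symMat p) (1 + symMat p * B) := by
    rw [rowBlock_map, ← RingHom.mapMatrix_apply, ← RingHom.mapMatrix_apply, map_add, map_one,
      map_mul, RingHom.mapMatrix_apply, RingHom.mapMatrix_apply, genericSym_map, map_C_map_eval]
  rw [← h, chartMap, MvPolynomial.aeval_def, ← MvPolynomial.coe_eval₂Hom,
    ← RingHom.comp_apply, MvPolynomial.comp_eval₂Hom, MvPolynomial.coe_eval₂Hom]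
  have h2 : (MvPolynomial.eval p).comp (algebraMap ℂ (SymPoly n)) = RingHom.id ℂ := by
    ext x; simp
  rw [h2]
  simp only [← plucker_map]
  rfl

theorem chartMap_eq_zero_iff (B : Matrix (Fin n) (Fin n) ℂ)
    (f : MvPolynomial (PluckerIndex n) ℂ) : chartMap B f = 0 ↔
      ∀ F : Matrix (Fin n) (Fin n) ℂ, Fᵀ = F →
        MvPolynomial.eval (plucker (rowBlock F (1 + F * B))) f = 0 := by
  constructor
  · intro h F hF
    obtain ⟨p, rfl⟩ := exists_eq_symMat hF
    rw [← eval_chartMap, h, map_zero]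
  · intro h
    refine MvPolynomial.funext fun p => ?_
    rw [eval_chartMap, map_zero]
    exact h _ (symMat_transpose p)

/-- Where `1 + FB` is invertible, `[F 1 + F(B + B₀)]` has the row space of `[F' 1 + F'B₀]` with `F'
= (1 + FB)⁻¹F`, again symmetric. So `f` vanishes off the zeros of `q = det(1 + FB)`. This `q` is a
nonzero polynomial, and it cancels. -/
theorem chart_change {B B₀ : Matrix (Fin n) (Fin n) ℂ} (hB : Bᵀ = B)
    {f : MvPolynomial (PluckerIndex n) ℂ} {k : ℕ} (hf : f.IsHomogeneous k)
    (h : chartMap B₀ f = 0) : chartMap (B + B₀) f = 0 := by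
  set q : SymPoly n := (1 + genericSym n * B.map (MvPolynomial.C : ℂ →+* SymPoly n)).det with hq
  have hqe : ∀ p, MvPolynomial.eval p q = (1 + symMat p * B).det := fun p => by
    rw [hq, RingHom.map_det, map_add, map_one, map_mul, RingHom.mapMatrix_apply,
      RingHom.mapMatrix_apply, genericSym_map, map_C_map_eval]
  have hq0 : q ≠ 0 := by
    intro h0
    have h1 := hqe 0
    have h2 : symMat (0 : Sym2 (Fin n) → ℂ) = 0 := rfl
    rw [h0, map_zero, h2, zero_mul, add_zero, Matrix.det_one] at h1
    exact zero_ne_one h1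
  refine (mul_eq_zero.mp (?_ : q * chartMap (B + B₀) f = 0)).resolve_left hq0
  refine MvPolynomial.funext fun p => ?_
  rw [map_mul, eval_chartMap, hqe, map_zero]
  by_cases hdet : (1 + symMat p * B).det = 0
  · rw [hdet, zero_mul]
  set F := symMat p with hF
  have hFt : Fᵀ = F := symMat_transpose p
  have hu : IsUnit (1 + F * B).det := isUnit_iff_ne_zero.mpr hdet
  have hu' : IsUnit (1 + B * F).det := by
    rwa [← Matrix.det_one_add_mul_comm]
  have hcomm : (1 + F * B)⁻¹ * F = F * (1 + B * F)⁻¹ := by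
    have h1 : F * (1 + B * F) = (1 + F * B) * F := by noncomm_ring
    calc (1 + F * B)⁻¹ * F = (1 + F * B)⁻¹ * (F * (1 + B * F)) * (1 + B * F)⁻¹ := by
          rw [Matrix.mul_assoc, Matrix.mul_assoc F, Matrix.mul_nonsing_inv _ hu', Matrix.mul_one]
      _ = F * (1 + B * F)⁻¹ := by
          rw [h1, ← Matrix.mul_assoc, Matrix.nonsing_inv_mul _ hu, Matrix.one_mul]
  have hsym : ((1 + F * B)⁻¹ * F)ᵀ = (1 + F * B)⁻¹ * F := by
    rw [Matrix.transpose_mul, Matrix.transpose_nonsing_inv, Matrix.transpose_add,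
      Matrix.transpose_mul, Matrix.transpose_one, hFt, hB, hcomm]
  have hblock : rowBlock F (1 + F * (B + B₀)) = (1 + F * B) *
      rowBlock ((1 + F * B)⁻¹ * F) (1 + (1 + F * B)⁻¹ * F * B₀) := by
    have h1 : (1 + F * B) * ((1 + F * B)⁻¹ * F) = F := by
      rw [← Matrix.mul_assoc, Matrix.mul_nonsing_inv _ hu, Matrix.one_mul]
    rw [mul_rowBlock, Matrix.mul_add (1 + F * B) 1, ← Matrix.mul_assoc _ _ B₀, h1,
      Matrix.mul_one, Matrix.mul_add, add_assoc]
  rw [hblock, plucker_mul, eval_smul_of_isHomogeneous _ hf,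
    (chartMap_eq_zero_iff B₀ f).mp h _ hsym, mul_zero, mul_zero]

theorem homogeneousIdeal_zariskiClosure {ι : Type} [Fintype ι] [DecidableEq ι]
    (S : Set (ℙ ℂ (ι → ℂ))) : homogeneousIdeal (zariskiClosure S) = homogeneousIdeal S := by
  refine le_antisymm ?_ (le_iInf₂ fun x hx => hx)
  exact le_iInf₂ fun x hx => iInf₂_le x
    (show homogeneousIdeal S ≤ pointIdeal x from iInf₂_le x hx)

theorem mem_zariskiClosure {ι : Type} [Fintype ι] [DecidableEq ι] {S : Set (ℙ ℂ (ι → ℂ))}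
    {x : ℙ ℂ (ι → ℂ)} (h : homogeneousIdeal (zariskiClosure S) ≤ pointIdeal x) :
    x ∈ zariskiClosure S := by
  rwa [homogeneousIdeal_zariskiClosure] at h

theorem plucker_rowBlock_one_ne_zero (F : Matrix (Fin n) (Fin n) ℂ) :
    plucker (rowBlock F 1) ≠ 0 := by
  intro h
  have := blockForm_one_plucker 0 F 1
  rw [h, map_zero, mul_zero, sub_zero, Matrix.det_one] at this
  exact zero_ne_one this

theorem mem_homogeneousIdeal_LG_iff {f : MvPolynomial (PluckerIndex n) ℂ} {k : ℕ}
    (hf : f.IsHomogeneous k) : f ∈ homogeneousIdeal (LG n) ↔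
      ∀ F : Matrix (Fin n) (Fin n) ℂ, Fᵀ = F →
        MvPolynomial.eval (plucker (rowBlock F 1)) f = 0 := by
  rw [LG, homogeneousIdeal_zariskiClosure, homogeneousIdeal]
  simp only [Submodule.mem_iInf]
  constructor
  · intro h F hF
    exact (mem_pointIdeal_mk_iff _ hf).mp (h _ ⟨F, hF, plucker_rowBlock_one_ne_zero F, rfl⟩)
  · rintro h x ⟨F, hF, h0, rfl⟩
    exact (mem_pointIdeal_mk_iff _ hf).mpr (h F hF)

theorem chartMap_eq_zero_iff_mem {B : Matrix (Fin n) (Fin n) ℂ} (hB : Bᵀ = B)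
    {f : MvPolynomial (PluckerIndex n) ℂ} {k : ℕ} (hf : f.IsHomogeneous k) :
    chartMap B f = 0 ↔ f ∈ homogeneousIdeal (LG n) := by
  have h0 : chartMap 0 f = 0 ↔ f ∈ homogeneousIdeal (LG n) := by
    rw [chartMap_eq_zero_iff, mem_homogeneousIdeal_LG_iff hf]
    simp only [mul_zero, add_zero]
  rw [← h0]
  constructor
  · intro h
    have := chart_change (B := -B) (by rw [Matrix.transpose_neg, hB]) hf h
    rwa [neg_add_cancel] at this
  · intro h
    have := chart_change hB hf h
    rwa [add_zero] at this

/-- Taking `A = 0` gives the form that is `1` on the chart. Taking `A` an elementary matrix gives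
`1` plus one entry of `F`, so the chart coordinates are linear in the Plücker coordinates. -/
theorem eval_chartMap_blockForm (B A : Matrix (Fin n) (Fin n) ℂ) (p : Sym2 (Fin n) → ℂ) :
    MvPolynomial.eval p (chartMap B (linearForm (blockForm 1 (B - A)))) =
      (1 + symMat p * A).det := by
  rw [eval_chartMap, eval_linearForm, blockForm_one_plucker, Matrix.mul_sub]
  congr 1
  abel

theorem det_one_add_mul_single (F : Matrix (Fin n) (Fin n) ℂ) (i j : Fin n) :
    (1 + F * Matrix.single j i 1).det = 1 + F i j := by
  have h : F * Matrix.single j i 1 =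
      Matrix.replicateCol Unit (fun a => F a j) * Matrix.replicateRow Unit (Pi.single i (1 : ℂ) : Fin n → ℂ) := by
    ext a b
    simp [Matrix.mul_apply, Matrix.single_apply, Pi.single_apply, ite_and, eq_comm]
  rw [h, Matrix.det_one_add_replicateCol_mul_replicateRow, single_one_dotProduct]

theorem chartMap_form (B : Matrix (Fin n) (Fin n) ℂ) :
    chartMap B (linearForm (blockForm 1 B)) = 1 := by
  refine MvPolynomial.funext fun p => ?_
  have := eval_chartMap_blockForm B 0 p
  rw [sub_zero, mul_zero, add_zero, Matrix.det_one] at this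
  rw [this, map_one]

theorem exists_chartMap_eq_X (B : Matrix (Fin n) (Fin n) ℂ) (s : Sym2 (Fin n)) :
    ∃ w : MvPolynomial (PluckerIndex n) ℂ, w.IsHomogeneous 1 ∧
      chartMap B w = MvPolynomial.X s := by
  induction s using Sym2.ind with
  | _ i j =>
  refine ⟨linearForm (blockForm 1 (B - Matrix.single j i 1)) - linearForm (blockForm 1 B),
    (isHomogeneous_linearForm _).sub (isHomogeneous_linearForm _), ?_⟩
  refine MvPolynomial.funext fun p => ?_
  rw [map_sub, map_sub, eval_chartMap_blockForm, chartMap_form, map_one, det_one_add_mul_single]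
  simp [symMat]

/-- Every polynomial of degree at most `k` is the dehomogenization of a form of degree `k`. -/
theorem exists_homogenization (B : Matrix (Fin n) (Fin n) ℂ) (g : SymPoly n) {k : ℕ}
    (hk : g.totalDegree ≤ k) :
    ∃ f : MvPolynomial (PluckerIndex n) ℂ, f.IsHomogeneous k ∧ chartMap B f = g := by
  choose w hw hwX using exists_chartMap_eq_X B
  set u := linearForm (blockForm (n := n) 1 B) with hu
  have huh : u.IsHomogeneous 1 := isHomogeneous_linearForm _
  have hcomp : ∀ g : SymPoly n, chartMap B (MvPolynomial.aeval w g) = g := fun g => by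
    have : (chartMap B).comp (MvPolynomial.aeval w) = AlgHom.id ℂ _ :=
      MvPolynomial.algHom_ext fun s => by simp [hwX]
    exact congrArg (fun φ => φ g) this
  refine ⟨∑ j ∈ Finset.range (g.totalDegree + 1),
    u ^ (k - j) * MvPolynomial.aeval w (homogeneousComponent j g), ?_, ?_⟩
  · refine IsHomogeneous.sum _ _ _ fun j hj => ?_
    rw [Finset.mem_range] at hj
    have := (huh.pow (k - j)).mul ((homogeneousComponent_isHomogeneous j g).aeval w hw)
    rwa [one_mul, one_mul, Nat.sub_add_cancel (by omega)] at this
  · rw [map_sum]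
    simp only [map_mul, map_pow, hcomp, hu, chartMap_form, one_pow, one_mul]
    exact sum_homogeneousComponent g

theorem chartMap_surjective (B : Matrix (Fin n) (Fin n) ℂ) :
    Function.Surjective (chartMap B) := fun g => by
  obtain ⟨f, -, hf⟩ := exists_homogenization B g le_rfl
  exact ⟨f, hf⟩

/-! Points of the Zariski closure are decomposable. -/

theorem isHomogeneous_det {m : ℕ} {ι : Type} (M : Matrix (Fin m) (Fin m) (MvPolynomial ι ℂ))
    (hM : ∀ i j, (M i j).IsHomogeneous 1) : M.det.IsHomogeneous m := by
  rw [Matrix.det_apply]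
  refine IsHomogeneous.sum _ _ _ fun σ _ => ?_
  have h1 : (∏ i, M (σ i) i).IsHomogeneous (∑ _i : Fin m, 1) :=
    IsHomogeneous.prod _ _ _ fun i _ => hM _ _
  simp only [Finset.sum_const, Finset.card_univ, Fintype.card_fin, smul_eq_mul, mul_one] at h1
  exact (homogeneousSubmodule ι ℂ m).smul_of_tower_mem (Equiv.Perm.sign σ : ℤˣ) h1

/-- The Plücker vector of `adj(M_K) M` is `det(M_K)^(n-1)` times that of `M`. With the entries of
`adj(M_K) M` written as linear forms in Plücker coordinates, these are equations of degree `n` on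
the chart, so they persist on the closure. -/
theorem exists_plucker_eq_smul {v : PluckerIndex n → ℂ} (hv0 : v ≠ 0)
    (hv : ∀ f ∈ homogeneousIdeal (LG n), MvPolynomial.eval v f = 0) :
    ∃ (M : Matrix (Fin n) (Fin (n + n)) ℂ) (t : ℂ), t ≠ 0 ∧ plucker M = t • v := by
  obtain ⟨K, hK⟩ : ∃ K, v K ≠ 0 := by
    by_contra! h
    exact hv0 (funext h)
  -- For `n = 0` the truncated exponent `n - 1` would break the homogeneity of the equations.
  rcases Nat.eq_zero_or_pos n with hn | hn
  · subst hn
    refine ⟨0, (v K)⁻¹, inv_ne_zero hK, ?_⟩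
    funext I
    have : I = K := by
      refine Subtype.ext ?_
      rw [Finset.card_eq_zero.mp I.2, Finset.card_eq_zero.mp K.2]
    subst this
    rw [Pi.smul_apply, smul_eq_mul, inv_mul_cancel₀ hK, plucker, Matrix.det_isEmpty]
  obtain ⟨Y, hY⟩ := exists_adjugate_forms K
  refine ⟨Matrix.of fun i k => Y i k v, v K ^ (n - 1), pow_ne_zero _ hK, ?_⟩
  let 𝒴 : Matrix (Fin n) (Fin (n + n)) (MvPolynomial (PluckerIndex n) ℂ) :=
    Matrix.of fun i k => linearForm (Y i k)
  have h𝒴 : ∀ w, 𝒴.map (MvPolynomial.eval w) = Matrix.of fun i k => Y i k w := fun w => by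
    ext i k
    simp [𝒴, eval_linearForm]
  funext I
  have hh : (plucker 𝒴 I - MvPolynomial.X K ^ (n - 1) * MvPolynomial.X I).IsHomogeneous n := by
    refine (isHomogeneous_det _ fun i j => isHomogeneous_linearForm _).sub ?_
    have := (isHomogeneous_X_pow K (n - 1)).mul (isHomogeneous_X ℂ I)
    rwa [Nat.sub_add_cancel hn] at this
  have hmem := (mem_homogeneousIdeal_LG_iff hh).mpr fun F hF => by
    rw [map_sub, ← plucker_map, h𝒴, hY, plucker_mul, Matrix.det_adjugate, Fintype.card_fin,
      map_mul, map_pow, MvPolynomial.eval_X, MvPolynomial.eval_X]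
    exact sub_self _
  have := hv _ hmem
  rw [map_sub, ← plucker_map, h𝒴, sub_eq_zero, map_mul, map_pow, MvPolynomial.eval_X,
    MvPolynomial.eval_X] at this
  exact this

/-- The cover of `LG(n)` by the charts of Lagrangian subspaces transversal to `rowsp [I B]`. -/
def lagrangianCover (n : ℕ) : AffineSpaceCover (homogeneousIdeal (LG n)) (Sym2 (Fin n))
    {B : Matrix (Fin n) (Fin n) ℂ // Bᵀ = B} where
  chart B := chartMap B.1
  form B := linearForm (blockForm 1 B.1)
  isHomogeneous_form _ := isHomogeneous_linearForm _
  chart_form B := chartMap_form B.1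
  surjective B := chartMap_surjective B.1
  chart_eq_zero_iff B _ _ hf := chartMap_eq_zero_iff_mem B.2 hf
  cover v hv hform := by
    by_contra hv0
    obtain ⟨M, t, ht, hM⟩ := exists_plucker_eq_smul hv0 hv
    obtain ⟨M₁, M₂, rfl⟩ := exists_eq_rowBlock M
    obtain ⟨B, hB, hdet⟩ := exists_symmetric_det_ne_zero M₁ M₂ fun x h1 h2 => by
      by_contra hx
      have h3 : plucker (rowBlock M₁ M₂) = 0 := by
        funext I
        refine Matrix.exists_vecMul_eq_zero_iff.mp ⟨x, hx, ?_⟩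
        funext j
        have hj : ∀ k, (x ᵥ* rowBlock M₁ M₂) k = 0 := fun k => by
          refine Fin.addCases (fun k => ?_) (fun k => ?_) k
          · have := congrFun h1 k
            simpa [Matrix.vecMul, dotProduct, rowBlock] using this
          · have := congrFun h2 k
            simpa [Matrix.vecMul, dotProduct, rowBlock, -Fin.natAdd_eq_addNat] using this
        exact hj _
      rw [h3] at hM
      exact smul_ne_zero ht hv0 hM.symm
    rw [← blockForm_one_plucker, hM, map_smul, ← eval_linearForm, hform ⟨B, hB⟩, smul_zero] at hdet
    exact hdet rfl

/-- Finitely many chart forms generate the ideal of all of them and so have the same common zeros.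
Finiteness is needed to find hyperplanes that are regular on all charts together. -/
theorem AffineSpaceCover.exists_finite {ι : Type} [Fintype ι] [DecidableEq ι]
    {I : Ideal (MvPolynomial ι ℂ)} {σ β : Type} (c : AffineSpaceCover I σ β) :
    ∃ s : Finset β, Nonempty (AffineSpaceCover I σ s) := by
  classical
  obtain ⟨t, hts, ht⟩ := (Submodule.fg_span_iff_fg_span_finset_subset (Set.range c.form)).mp
    (IsNoetherian.noetherian (Ideal.span (Set.range c.form)))
  have hts' : ∀ f : t, ∃ b, c.form b = f := fun f => hts f.2
  choose b hb using hts'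
  refine ⟨Finset.univ.image b, ⟨{
    chart := fun j => c.chart j.1
    form := fun j => c.form j.1
    isHomogeneous_form := fun j => c.isHomogeneous_form j.1
    chart_form := fun j => c.chart_form j.1
    surjective := fun j => c.surjective j.1
    chart_eq_zero_iff := fun j _ _ hf => c.chart_eq_zero_iff j.1 hf
    cover := fun v hv hform => c.cover v hv fun j => ?_ }⟩⟩
  have hle : Submodule.span (MvPolynomial ι ℂ) (t : Set (MvPolynomial ι ℂ)) ≤
      RingHom.ker (MvPolynomial.eval v) := by
    rw [Submodule.span_le]
    intro f hf
    have := hform ⟨b ⟨f, hf⟩, Finset.mem_image_of_mem _ (Finset.mem_univ _)⟩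
    rwa [hb ⟨f, hf⟩] at this
  rw [← ht] at hle
  exact hle (Submodule.subset_span ⟨j, rfl⟩)

end Charts

/-! ### Dimension and degree of the Lagrangian Grassmannian -/

section Numerical

theorem leadingCoeff_nonneg_of_eventually {Q : ℚ[X]}
    (h : ∀ᶠ k : ℕ in Filter.atTop, 0 ≤ Q.eval (k : ℚ)) : 0 ≤ Q.leadingCoeff := by
  by_contra! hlc
  by_cases hd : 0 < Q.degree
  · have ht := (tendsto_atBot_of_leadingCoeff_nonpos Q hd hlc.le).comp
      (tendsto_natCast_atTop_atTop (R := ℚ))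
    obtain ⟨k, hk, hk'⟩ := (h.and (ht.eventually_lt_atBot 0)).exists
    exact absurd hk (not_le.mpr hk')
  · obtain ⟨k, hk⟩ := h.exists
    rw [eq_C_of_degree_le_zero (not_lt.mp hd)] at hk hlc
    rw [eval_C] at hk
    rw [leadingCoeff_C] at hlc
    exact absurd hk (not_le.mpr hlc)

theorem degree_le_of_eventually_eval_le {P Q : ℚ[X]} (hP : 0 < P.leadingCoeff)
    (h : ∀ᶠ k : ℕ in Filter.atTop, P.eval (k : ℚ) ≤ Q.eval (k : ℚ)) : P.degree ≤ Q.degree := by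
  by_contra! hlt
  have := leadingCoeff_nonneg_of_eventually (Q := Q - P) (h.mono fun k hk => by
    rw [eval_sub]; exact sub_nonneg.mpr hk)
  rw [leadingCoeff_sub_of_degree_lt' hlt] at this
  linarith

/-- This number is the `r`-th difference of `P`, and differences of integer values are integers. -/
theorem factorial_mul_coeff_mem_int {r : ℕ} : ∀ {P : ℚ[X]}, P.natDegree ≤ r →
    (∀ᶠ k : ℕ in Filter.atTop, ∃ z : ℤ, P.eval (k : ℚ) = z) →
      ∃ z : ℤ, (r.factorial : ℚ) * P.coeff r = z := by
  induction r with
  | zero =>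
    intro P hP h
    obtain ⟨k, z, hz⟩ := h.exists
    rw [eq_C_of_natDegree_le_zero hP, eval_C] at hz
    exact ⟨z, by rw [Nat.factorial_zero, Nat.cast_one, one_mul, hz]⟩
  | succ m ih =>
    intro P hP h
    obtain ⟨h1, h2⟩ := coeff_sub_taylor hP
    obtain ⟨z, hz⟩ := ih h1 (by
      obtain ⟨K, hK⟩ := Filter.eventually_atTop.mp h
      refine Filter.eventually_atTop.mpr ⟨K + 1, fun k hk => ?_⟩
      obtain ⟨a, ha⟩ := hK k (by omega)
      obtain ⟨b, hb⟩ := hK (k - 1) (by omega)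
      refine ⟨a - b, ?_⟩
      rw [Nat.cast_sub (by omega), Nat.cast_one] at hb
      rw [eval_sub, taylor_eval, ← sub_eq_add_neg, ha, hb, Int.cast_sub])
    refine ⟨z, ?_⟩
    rw [← hz, h2, Nat.factorial_succ, Nat.cast_mul, Nat.cast_succ]
    ring

end Numerical

/-! ### Bounds for the Hilbert function of the Lagrangian Grassmannian -/

section Dimension

open MvPolynomial

theorem finrank_restrictDegree {σ : Type} [Fintype σ] (m : ℕ) :
    Module.finrank ℂ (restrictDegree σ ℂ m) = (m + 1) ^ Nat.card σ := by
  classical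
  rw [restrictDegree, Module.finrank_eq_nat_card_basis (basisRestrictSupport ℂ _)]
  have e : {s : σ →₀ ℕ | ∀ i, s i ≤ m} ≃ (σ → Fin (m + 1)) :=
    { toFun := fun s i => ⟨s.1 i, Nat.lt_succ_of_le (s.2 i)⟩
      invFun := fun g => ⟨Finsupp.equivFunOnFinite.symm fun i => (g i : ℕ),
        fun i => Nat.le_of_lt_succ (g i).2⟩
      left_inv := fun s => by ext; rfl
      right_inv := fun g => by ext; rfl }
  rw [Nat.card_congr e, Nat.card_fun, Nat.card_fin]

theorem totalDegree_le_of_mem_restrictDegree {σ : Type} [Fintype σ] {m : ℕ}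
    {g : MvPolynomial σ ℂ} (hg : g ∈ restrictDegree σ ℂ m) :
    g.totalDegree ≤ Nat.card σ * m := by
  rw [mem_restrictDegree] at hg
  refine Finset.sup_le fun s hs => ?_
  rw [Finsupp.sum_fintype _ _ (fun _ => rfl), Nat.card_eq_fintype_card]
  exact (Finset.sum_le_card_nsmul _ _ m fun i _ => hg s hs i).trans (by simp)

theorem totalDegree_aeval_le {ι σ : Type} {f : MvPolynomial ι ℂ} {k m : ℕ}
    (hf : f.IsHomogeneous k) {g : ι → MvPolynomial σ ℂ} (hg : ∀ i, (g i).totalDegree ≤ m) :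
    (aeval g f).totalDegree ≤ m * k := by
  rw [MvPolynomial.aeval_def, MvPolynomial.eval₂_eq]
  refine totalDegree_finsetSum_le fun s hs => ?_
  refine (totalDegree_mul _ _).trans ?_
  rw [algebraMap_eq, totalDegree_C, zero_add]
  refine (totalDegree_finsetProd _ _).trans ?_
  have hk : s.degree = k := by
    have := hf (mem_support_iff.mp hs)
    rwa [Finsupp.degree_eq_weight_one]
  rw [← hk, Finsupp.degree_apply, Finset.mul_sum]
  refine Finset.sum_le_sum fun i _ => ?_
  refine (totalDegree_pow _ _).trans ?_
  rw [mul_comm]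
  exact Nat.mul_le_mul_right _ (hg i)

theorem totalDegree_det_le {m : ℕ} {σ : Type} {M : Matrix (Fin m) (Fin m) (MvPolynomial σ ℂ)}
    (hM : ∀ i j, (M i j).totalDegree ≤ 1) : M.det.totalDegree ≤ m := by
  rw [Matrix.det_apply]
  refine totalDegree_finsetSum_le fun τ _ => ?_
  rw [Units.smul_def]
  refine (totalDegree_smul_le _ _).trans ?_
  refine (totalDegree_finsetProd _ _).trans ?_
  exact (Finset.sum_le_card_nsmul _ _ 1 fun i _ => hM _ _).trans (by simp)

variable {n : ℕ}

theorem quotDim_LG (k : ℕ) : quotDim (homogeneousIdeal (LG n)) k =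
    Module.finrank ℂ ((homogeneousSubmodule (PluckerIndex n) ℂ k).map
      (chartMap (n := n) 0).toLinearMap) := by
  have h1 := quotDim_add (homogeneousIdeal (LG n)) k
  have h2 := finrank_map_add_finrank_inf_ker (chartMap (n := n) 0).toLinearMap
    (homogeneousSubmodule (PluckerIndex n) ℂ k)
  have h3 : (homogeneousSubmodule (PluckerIndex n) ℂ k ⊓
      LinearMap.ker (chartMap (n := n) 0).toLinearMap : Submodule ℂ _) =
      homogeneousSubmodule (PluckerIndex n) ℂ k ⊓
        (homogeneousIdeal (LG n)).restrictScalars ℂ := by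
    ext f
    rw [Submodule.mem_inf, Submodule.mem_inf, LinearMap.mem_ker, Submodule.restrictScalars_mem]
    exact and_congr_right fun hf =>
      chartMap_eq_zero_iff_mem (Matrix.transpose_zero) ((mem_homogeneousSubmodule _ _).mp hf)
  rw [h3] at h2
  omega

theorem totalDegree_chartMap_le {f : MvPolynomial (PluckerIndex n) ℂ} {k : ℕ}
    (hf : f.IsHomogeneous k) : (chartMap 0 f).totalDegree ≤ n * k := by
  refine totalDegree_aeval_le hf fun I => totalDegree_det_le fun i j => ?_
  have h : ∀ c, (rowBlock (genericSym n)
      (1 + genericSym n * (0 : Matrix (Fin n) (Fin n) ℂ).map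
        (MvPolynomial.C : ℂ →+* SymPoly n)) i c).totalDegree ≤ 1 := by
    intro c
    refine Fin.addCases (fun c => ?_) (fun c => ?_) c
    · simp [rowBlock, genericSym, symMat]
    · simp only [rowBlock, Matrix.submatrix_apply, finSumFinEquiv_symm_apply_natAdd, id,
        Matrix.fromCols_apply_inr, Matrix.map_zero _ (map_zero _), mul_zero, add_zero,
        Matrix.one_apply]
      split_ifs <;> simp
  exact h _

theorem quotDim_LG_le (k : ℕ) :
    quotDim (homogeneousIdeal (LG n)) k ≤ (n * k + 1) ^ Nat.card (Sym2 (Fin n)) := by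
  rw [quotDim_LG, ← finrank_restrictDegree]
  refine Submodule.finrank_mono ?_
  rintro _ ⟨f, hf, rfl⟩
  refine restrictTotalDegree_le_restrictDegree (R := ℂ) (σ := Sym2 (Fin n)) (n * k) ?_
  rw [mem_restrictTotalDegree]
  exact totalDegree_chartMap_le ((mem_homogeneousSubmodule _ _).mp hf)

/-- Polynomials of degree at most `m` in each of `r` variables have total degree at most `r m` and
can be homogenized. The factor `r + 1` instead of `r` keeps the degrees tending to infinity also
when `r = 0`. -/
theorem le_quotDim_LG (m : ℕ) : (m + 1) ^ Nat.card (Sym2 (Fin n)) ≤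
    quotDim (homogeneousIdeal (LG n)) ((Nat.card (Sym2 (Fin n)) + 1) * m) := by
  rw [quotDim_LG, ← finrank_restrictDegree]
  refine Submodule.finrank_mono fun g hg => ?_
  have hg' := totalDegree_le_of_mem_restrictDegree hg
  obtain ⟨f, hf, hfg⟩ := exists_homogenization 0 g
    (k := (Nat.card (Sym2 (Fin n)) + 1) * m) (hg'.trans (by gcongr; omega))
  exact ⟨f, (mem_homogeneousSubmodule _ _).mpr hf, hfg⟩

theorem natCard_sym2 (n : ℕ) : Nat.card (Sym2 (Fin n)) = (n + 1).choose 2 := by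
  rw [Nat.card_eq_fintype_card, Sym2.card, Fintype.card_fin]

end Dimension

/-- The lower bound along the degrees `(r + 1) m` and the upper bound `(n k + 1)^r` pin the degree
of the Hilbert polynomial to `r`; its values, being natural numbers, make the normalized leading
coefficient a positive integer. -/
theorem exists_dimension_degree_LG (n : ℕ) : ∃ (P : ℚ[X]) (d : ℕ),
    IsHilbertPolynomial (LG n) P ∧ P.degree = (Nat.card (Sym2 (Fin n)) : ℕ) ∧ 0 < d ∧
      ((Nat.card (Sym2 (Fin n))).factorial : ℚ) * P.leadingCoeff = d := by
  obtain ⟨P, hP⟩ := exists_hilbert_polynomial (homogeneousIdeal (LG n)) (isHomog_homogeneousIdeal _)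
  set r := Nat.card (Sym2 (Fin n)) with hr
  have hcomp : ∀ᶠ m : ℕ in Filter.atTop,
      ((X + 1) ^ r : ℚ[X]).eval (m : ℚ) ≤ (P.comp (Polynomial.C ((r : ℚ) + 1) * X)).eval (m : ℚ) := by
    have ht : Filter.Tendsto (fun m : ℕ => (r + 1) * m) Filter.atTop Filter.atTop :=
      Filter.tendsto_id.const_mul_atTop' (Nat.succ_pos r)
    refine (ht.eventually hP).mono fun m hm => ?_
    have h1 : (((m + 1) ^ r : ℕ) : ℚ) ≤ _ := Nat.cast_le.mpr (le_quotDim_LG (n := n) m)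
    rw [← hr, ← hm] at h1
    simpa using h1
  have hV : ((X + 1) ^ r : ℚ[X]).Monic := (monic_X_add_C (1 : ℚ)).pow r
  have hVd : ((X + 1) ^ r : ℚ[X]).degree = r := by
    rw [degree_pow, ← Polynomial.C_1, degree_X_add_C]
    simp
  have hge := degree_le_of_eventually_eval_le (by rw [hV.leadingCoeff]; exact one_pos) hcomp
  have hcd : (P.comp (Polynomial.C ((r : ℚ) + 1) * X)).natDegree = P.natDegree := by
    rw [natDegree_comp, natDegree_C_mul_X _ (by positivity), mul_one]
  have hP0 : P ≠ 0 := by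
    rintro rfl
    rw [zero_comp, hVd, Polynomial.degree_zero] at hge
    exact absurd hge (by simp)
  have hlc : 0 < P.leadingCoeff := (leadingCoeff_nonneg_of_eventually (hP.mono fun k hk => by
    rw [hk]; positivity)).lt_of_ne' (Polynomial.leadingCoeff_ne_zero.mpr hP0)
  have hle : P.degree ≤ ((Polynomial.C (n : ℚ) * X + 1) ^ r : ℚ[X]).degree :=
    degree_le_of_eventually_eval_le hlc (hP.mono fun k hk => by
      rw [hk]
      have h1 : ((quotDim (homogeneousIdeal (LG n)) k : ℕ) : ℚ) ≤ _ :=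
        Nat.cast_le.mpr (quotDim_LG_le (n := n) k)
      rw [← hr] at h1
      simpa using h1)
  have hdeg : P.natDegree = r := by
    refine le_antisymm ?_ ?_
    · refine (natDegree_le_natDegree hle).trans (natDegree_pow_le.trans ?_)
      refine (Nat.mul_le_mul_left r (m := 1) ?_).trans (by simp)
      exact natDegree_linear_le
    · rw [← hcd]
      refine Polynomial.le_natDegree_of_coe_le_degree ?_
      rwa [hVd] at hge
  obtain ⟨z, hz⟩ := factorial_mul_coeff_mem_int hdeg.le (hP.mono fun k hk => ⟨_, by
    rw [hk]; exact (Int.cast_natCast _).symm⟩)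
  have hcoeff : P.coeff r = P.leadingCoeff := by rw [Polynomial.leadingCoeff, hdeg]
  rw [hcoeff] at hz
  have hz0 : 0 < z := by
    have : (0 : ℚ) < z := by rw [← hz]; positivity
    exact_mod_cast this
  lift z to ℕ using hz0.le
  refine ⟨P, z, hP, ?_, by exact_mod_cast hz0, by rw [hz]; simp⟩
  rw [Polynomial.degree_eq_natDegree hP0, hdeg]

/-! ### Coprime factorizations and the characteristic polynomial -/

section Systems

variable {n : ℕ}

/-- The entrywise inclusion of polynomial matrices into matrices of rational functions. -/
def toRat (n : ℕ) : Matrix (Fin n) (Fin n) ℂ[X] →+* Matrix (Fin n) (Fin n) (RatFunc ℂ) :=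
  (algebraMap ℂ[X] (RatFunc ℂ)).mapMatrix

theorem toRat_injective : Function.Injective (toRat n) :=
  Matrix.map_injective (RatFunc.algebraMap_injective ℂ)

theorem det_toRat (A : Matrix (Fin n) (Fin n) ℂ[X]) :
    (toRat n A).det = algebraMap ℂ[X] (RatFunc ℂ) A.det :=
  (RingHom.map_det _ _).symm

/-- The substitution `s ↦ -s` on polynomials. -/
def negSubst : ℂ[X] →+* ℂ[X] := (Polynomial.compRingHom (-X))

theorem negArg_algebraMap (p : ℂ[X]) : negArg (algebraMap ℂ[X] (RatFunc ℂ) p) =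
    algebraMap ℂ[X] (RatFunc ℂ) (negSubst p) := by
  rw [negArg, IsFractionRing.ringEquivOfRingEquiv_algebraMap]
  rfl

theorem coeff_negSubst (p : ℂ[X]) (k : ℕ) : (negSubst p).coeff k = (-1) ^ k * p.coeff k := by
  have : (-X : ℂ[X]) = C (-1) * X := by rw [C_neg, C_1, neg_one_mul]
  rw [negSubst, coe_compRingHom_apply, this, comp_C_mul_X_coeff, mul_comm]

open Classical in
/-- The valuation at infinity. -/
def inftyVal : Valuation (RatFunc ℂ) (WithZero (Multiplicative ℤ)) := RatFunc.inftyValuation ℂ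

theorem inftyVal_of_ne_zero {x : RatFunc ℂ} (hx : x ≠ 0) :
    inftyVal x = WithZero.exp x.intDegree := by
  classical
  exact RatFunc.inftyValuation_of_nonzero ℂ hx

theorem inftyVal_le_one {G : Matrix (Fin n) (Fin n) (RatFunc ℂ)} (hG : IsStrictlyProper G)
    (i j : Fin n) : inftyVal (G i j) ≤ 1 := by
  by_cases h0 : G i j = 0
  · rw [h0, map_zero]; exact zero_le_one
  · rw [inftyVal_of_ne_zero h0,
      ← WithZero.exp_zero, WithZero.exp_le_exp, RatFunc.intDegree]
    have := natDegree_lt_natDegree (RatFunc.num_ne_zero h0) (hG i j)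
    omega

theorem valuation_det_le_one {K Γ : Type} [Field K] [LinearOrderedCommGroupWithZero Γ]
    (v : Valuation K Γ) {M : Matrix (Fin n) (Fin n) K} (hM : ∀ i j, v (M i j) ≤ 1) :
    v M.det ≤ 1 := by
  have h : M = (Matrix.of fun i j => (⟨M i j, hM i j⟩ : v.integer)).map v.integer.subtype := rfl
  rw [h, ← RingHom.mapMatrix_apply, ← RingHom.map_det]
  exact (Matrix.det _ : v.integer).2

theorem det_fromBlocks_mul {K : Type} [Field K] (D G A B : Matrix (Fin n) (Fin n) K) :
    (Matrix.fromBlocks D (D * G) A B).det = D.det * (B - A * G).det := by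
  have : Matrix.fromBlocks D (D * G) A B =
      Matrix.fromBlocks D 0 0 1 * Matrix.fromBlocks 1 G A B := by
    simp [Matrix.fromBlocks_multiply]
  rw [this, Matrix.det_mul, Matrix.det_fromBlocks_zero₂₁, Matrix.det_one, mul_one,
    Matrix.det_fromBlocks_one₁₁]

theorem natDegree_le_of_inftyVal_le {p q : ℂ[X]} (hq : q ≠ 0)
    (h : inftyVal (algebraMap ℂ[X] (RatFunc ℂ) p) ≤
      inftyVal (algebraMap ℂ[X] (RatFunc ℂ) q)) :
    p.natDegree ≤ q.natDegree := by
  by_cases hp : p = 0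
  · rw [hp, natDegree_zero]; exact Nat.zero_le _
  · rw [inftyVal_of_ne_zero (RatFunc.algebraMap_ne_zero hp), inftyVal_of_ne_zero
      (RatFunc.algebraMap_ne_zero hq), WithZero.exp_le_exp, RatFunc.intDegree_polynomial,
      RatFunc.intDegree_polynomial] at h
    exact_mod_cast h

variable {G : Matrix (Fin n) (Fin n) (RatFunc ℂ)} {D N : Matrix (Fin n) (Fin n) ℂ[X]}

theorem algebraMap_det_fromBlocks (h : IsLeftCoprimeFactorization G D N)
    (A B : Matrix (Fin n) (Fin n) ℂ[X]) :
    algebraMap ℂ[X] (RatFunc ℂ) (Matrix.fromBlocks D N A B).det =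
      algebraMap ℂ[X] (RatFunc ℂ) D.det * (toRat n B - toRat n A * G).det := by
  rw [RingHom.map_det, RingHom.mapMatrix_apply, Matrix.fromBlocks_map, ← h.mul_eq,
    det_fromBlocks_mul, ← det_toRat]
  rfl

/-- After division by `det D` the cofactor is `det (U₂ - U₁ G)`, whose entries are all bounded at
infinity. -/
theorem natDegree_cofactorPoly_le (hG : IsStrictlyProper G)
    (h : IsLeftCoprimeFactorization G D N) (I : PluckerIndex n) :
    (cofactorPoly D N I).natDegree ≤ D.det.natDegree := by
  obtain ⟨U₁, U₂, hU⟩ := exists_eq_rowBlock (unitRows I)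
  refine natDegree_le_of_inftyVal_le h.det_ne_zero ?_
  rw [cofactorPoly, hU, det_stack_rowBlock, algebraMap_det_fromBlocks h, map_mul]
  refine mul_le_of_le_one_right' (valuation_det_le_one _ fun i j => ?_)
  have hone : ∀ c, inftyVal
      (algebraMap ℂ[X] (RatFunc ℂ) (rowBlock U₁ U₂ i c)) ≤ 1 := fun c => by
    rw [← hU, unitRows, Matrix.of_apply]
    split_ifs <;> simp
  have h1 : ∀ k, inftyVal (toRat n U₁ i k) ≤ 1 := fun k => by
    simpa [rowBlock, toRat] using hone (Fin.castAdd n k)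
  have h2 : ∀ k, inftyVal (toRat n U₂ i k) ≤ 1 := fun k => by
    simpa [rowBlock, toRat, -Fin.natAdd_eq_addNat] using hone (Fin.natAdd n k)
  rw [Matrix.sub_apply]
  refine (Valuation.map_sub _ _ _).trans (max_le (h2 j) ?_)
  rw [Matrix.mul_apply]
  refine Valuation.map_sum_le _ fun k _ => ?_
  rw [map_mul]
  exact mul_le_one' (h1 k) (inftyVal_le_one hG k j)

theorem natDegree_charPoly_le (hG : IsStrictlyProper G)
    (h : IsLeftCoprimeFactorization G D N) (z : PluckerIndex n → ℂ) :
    (charPoly D N z).natDegree ≤ D.det.natDegree := by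
  rw [charPoly_apply]
  exact natDegree_sum_le_of_forall_le _ _ fun I _ =>
    (natDegree_smul_le _ _).trans (natDegree_cofactorPoly_le hG h I)

/-- The Bezout identity reads `D⁻¹ = P + G Q`, so `D' D⁻¹ = D' P + N' Q` is polynomial. -/
theorem IsLeftCoprimeFactorization.exists_mul_eq {D' N' : Matrix (Fin n) (Fin n) ℂ[X]}
    (h : IsLeftCoprimeFactorization G D N) (h' : IsLeftCoprimeFactorization G D' N') :
    ∃ U, U * D = D' := by
  obtain ⟨P, Q, hPQ⟩ := h.coprime
  have hinv : toRat n D * (toRat n P + G * toRat n Q) = 1 := by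
    rw [mul_add, ← mul_assoc, show toRat n D * G = toRat n N from h.mul_eq, ← map_mul, ← map_mul,
      ← map_add, hPQ, map_one]
  refine ⟨D' * P + N' * Q, toRat_injective ?_⟩
  rw [map_mul, map_add, map_mul, map_mul, ← show toRat n D' * G = toRat n N' from h'.mul_eq,
    mul_assoc, ← mul_add, mul_assoc, mul_eq_one_comm.mp hinv, mul_one]

theorem IsLeftCoprimeFactorization.natDegree_det {D' N' : Matrix (Fin n) (Fin n) ℂ[X]}
    (h : IsLeftCoprimeFactorization G D N) (h' : IsLeftCoprimeFactorization G D' N') :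
    D.det.natDegree = D'.det.natDegree := by
  obtain ⟨U, hU⟩ := h.exists_mul_eq h'
  obtain ⟨U', hU'⟩ := h'.exists_mul_eq h
  refine le_antisymm (natDegree_le_of_dvd ⟨U.det, ?_⟩ h'.det_ne_zero)
    (natDegree_le_of_dvd ⟨U'.det, ?_⟩ h.det_ne_zero)
  · rw [← hU, Matrix.det_mul, mul_comm]
  · rw [← hU', Matrix.det_mul, mul_comm]

theorem IsLeftCoprimeFactorization.natDegree_eq {δ : ℕ} (h : IsLeftCoprimeFactorization G D N)
    (hδ : HasMcMillanDegree G δ) : D.det.natDegree = δ := by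
  obtain ⟨D', N', h', rfl⟩ := hδ
  exact h.natDegree_det h'

/-- If `D⁻¹ N = N' D'⁻¹` with both factorizations coprime, then `det D` and `det D'` agree up to
a unit. -/
theorem exists_isUnit_mul_det {R : Type} [CommRing R]
    {D N P Q D' N' P' Q' : Matrix (Fin n) (Fin n) R} (h : D * P + N * Q = 1)
    (h' : P' * D' + Q' * N' = 1) (hc : D * N' = N * D') :
    ∃ u : R, IsUnit u ∧ u * D'.det = D.det := by
  -- The two Bezout identities make this block matrix times `[P -N'; Q D']` lower triangular with
  -- identity blocks on the diagonal. Times `[1 -N'; 0 D']` it is lower triangular with diagonal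
  -- blocks `D` and `1`.
  refine ⟨(Matrix.fromBlocks D N (-Q') P').det, ?_, ?_⟩
  · refine IsUnit.of_mul_eq_one (Matrix.fromBlocks P (-N') Q D').det ?_
    rw [← Matrix.det_mul, Matrix.fromBlocks_multiply, h, Matrix.mul_neg, hc, neg_add_cancel,
      neg_mul_neg, add_comm (Q' * N'), h', Matrix.det_fromBlocks_zero₁₂, Matrix.det_one, mul_one]
  · have h1 : (Matrix.fromBlocks 1 (-N') 0 D').det = D'.det := by
      rw [Matrix.det_fromBlocks_zero₂₁, Matrix.det_one, one_mul]
    rw [← h1, ← Matrix.det_mul, Matrix.fromBlocks_multiply, Matrix.mul_neg, hc, neg_add_cancel,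
      neg_mul_neg, add_comm (Q' * N'), h', Matrix.det_fromBlocks_zero₁₂, Matrix.det_one, mul_one,
      Matrix.mul_one, Matrix.mul_zero, add_zero]

/-- The symmetry turns `D(-s)ᵗ` and `N(-s)ᵗ` into a right coprime factorization of `G`, so the two
determinants differ by a constant, which comparison of leading coefficients determines. -/
theorem negSubst_det (hG : IsHamiltonianTransfer G) (h : IsLeftCoprimeFactorization G D N) :
    negSubst D.det = (-1) ^ D.det.natDegree * D.det := by
  obtain ⟨P, Q, hPQ⟩ := h.coprime
  have hneg : ∀ A : Matrix (Fin n) (Fin n) ℂ[X],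
      toRat n (A.map negSubst)ᵀ = ((toRat n A).map negArg)ᵀ := fun A => by
    ext i j
    exact (negArg_algebraMap _).symm
  have hG' : G * toRat n (D.map negSubst)ᵀ = toRat n (N.map negSubst)ᵀ := by
    rw [hneg, hneg, ← show toRat n D * G = toRat n N from h.mul_eq]
    have := Matrix.map_mul (L := toRat n D) (M := G) (f := (negArg : RatFunc ℂ →+* RatFunc ℂ))
    rw [show ((toRat n D * G).map negArg) = (toRat n D).map negArg * G.map negArg from this,
      Matrix.transpose_mul, show (G.map negArg)ᵀ = G from hG]
  have h' : (P.map negSubst)ᵀ * (D.map negSubst)ᵀ + (Q.map negSubst)ᵀ * (N.map negSubst)ᵀ = 1 := by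
    rw [← Matrix.transpose_mul, ← Matrix.transpose_mul, ← Matrix.transpose_add, ← Matrix.map_mul,
      ← Matrix.map_mul, ← RingHom.mapMatrix_apply, ← RingHom.mapMatrix_apply, ← map_add, hPQ,
      map_one, Matrix.transpose_one]
  have hc : D * (N.map negSubst)ᵀ = N * (D.map negSubst)ᵀ := toRat_injective <| by
    rw [map_mul, map_mul, ← hG', ← mul_assoc, show toRat n D * G = toRat n N from h.mul_eq]
  obtain ⟨u, hu, hud⟩ := exists_isUnit_mul_det hPQ h' hc
  obtain ⟨c, hc0, rfl⟩ := Polynomial.isUnit_iff.mp hu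
  rw [Matrix.det_transpose, ← RingHom.mapMatrix_apply, ← RingHom.map_det] at hud
  have hlc := congrArg (fun p => p.coeff D.det.natDegree) hud
  simp only [coeff_C_mul, coeff_negSubst] at hlc
  have hlc0 : D.det.coeff D.det.natDegree ≠ 0 := by
    rw [coeff_natDegree]; exact leadingCoeff_ne_zero.mpr h.det_ne_zero
  rw [← mul_assoc] at hlc
  have hcm : c * (-1) ^ D.det.natDegree = 1 := mul_right_cancel₀ hlc0 (by rw [hlc, one_mul])
  have hcm' : ((-1) ^ D.det.natDegree : ℂ[X]) * C c = 1 := by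
    rw [mul_comm, ← C_1 (R := ℂ), ← C_neg, ← C_pow, ← C_mul, hcm]
  nth_rewrite 3 [← hud]
  rw [← mul_assoc, hcm', one_mul]

theorem charPoly_plucker_symmetric (F : Matrix (Fin n) (Fin n) ℂ) :
    charPoly D N (plucker (rowBlock F 1)) = (Matrix.fromBlocks D N (F.map C) 1).det := by
  rw [charPoly_plucker, rowBlock_map, det_stack_rowBlock, Matrix.map_one _ C_0 C_1]

/-- In `det D · det (1 - F G)` the second factor is even: `s ↦ -s` turns `F G` into `F Gᵗ`, whose
transpose is `G F`, and `det (1 - G F) = det (1 - F G)`. -/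
theorem negSubst_charPoly_plucker (hG : IsHamiltonianTransfer G)
    (h : IsLeftCoprimeFactorization G D N) {F : Matrix (Fin n) (Fin n) ℂ} (hF : Fᵀ = F) :
    negSubst (charPoly D N (plucker (rowBlock F 1))) =
      (-1) ^ D.det.natDegree * charPoly D N (plucker (rowBlock F 1)) := by
  apply RatFunc.algebraMap_injective ℂ
  have hFt : (toRat n (F.map C))ᵀ = toRat n (F.map C) := by
    ext i j
    exact congrArg (fun c => algebraMap ℂ[X] (RatFunc ℂ) (C c)) (congrFun (congrFun hF i) j)
  have hFn : (toRat n (F.map C)).map negArg = toRat n (F.map C) := by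
    ext i j
    refine (negArg_algebraMap _).trans ?_
    simp [negSubst, toRat]
  have hdet : negArg (1 - toRat n (F.map C) * G).det = (1 - toRat n (F.map C) * G).det := by
    have h1 : negArg (1 - toRat n (F.map C) * G).det =
        (1 - (toRat n (F.map C)).map negArg * G.map negArg).det := by
      have := RingHom.map_det (negArg : RatFunc ℂ →+* RatFunc ℂ) (1 - toRat n (F.map C) * G)
      rw [map_sub, map_one, map_mul] at this
      exact this
    rw [h1, hFn, ← Matrix.det_transpose, Matrix.transpose_sub, Matrix.transpose_mul,
      Matrix.transpose_one, hFt, show (G.map negArg)ᵀ = G from hG, ← Matrix.det_one_sub_mul_comm]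
  rw [← negArg_algebraMap, charPoly_plucker_symmetric, algebraMap_det_fromBlocks h, map_one,
    map_mul, negArg_algebraMap, negSubst_det hG h, hdet, map_mul, map_mul, mul_assoc,
    algebraMap_det_fromBlocks h, map_one]

/-- Coprimeness makes `[D(0) N(0)]` of full row rank, so its row space is transversal to some `[F
I]` with `F` symmetric. -/
theorem exists_charPoly_eval_zero_ne_zero (h : IsLeftCoprimeFactorization G D N) :
    ∃ F : Matrix (Fin n) (Fin n) ℂ, Fᵀ = F ∧
      (charPoly D N (plucker (rowBlock F 1))).eval 0 ≠ 0 := by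
  obtain ⟨P, Q, hPQ⟩ := h.coprime
  let ε := (Polynomial.evalRingHom (0 : ℂ)).mapMatrix (m := Fin n)
  have hε : ε D * ε P + ε N * ε Q = 1 := by
    rw [← map_mul, ← map_mul, ← map_add, hPQ, map_one]
  obtain ⟨F, hF, hdet⟩ := exists_symmetric_det_ne_zero (ε N) (ε D) fun x h1 h2 => by
    rw [← Matrix.vecMul_one x, ← hε, Matrix.vecMul_add, ← Matrix.vecMul_vecMul,
      ← Matrix.vecMul_vecMul, h1, h2, Matrix.zero_vecMul, Matrix.zero_vecMul, add_zero]
  refine ⟨F, hF, ?_⟩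
  have hFε : ε (F.map C) = F := by
    ext i j
    simp [ε]
  rw [charPoly_plucker_symmetric, Matrix.det_fromBlocks_one₂₂, ← coe_evalRingHom, RingHom.map_det]
  change (ε (D - N * F.map C)).det ≠ 0
  rwa [map_sub, map_mul, hFε]

theorem even_natDegree_det (hG : IsHamiltonianTransfer G)
    (h : IsLeftCoprimeFactorization G D N) : Even D.det.natDegree := by
  by_contra hodd
  rw [Nat.not_even_iff_odd] at hodd
  obtain ⟨F, hF, hne⟩ := exists_charPoly_eval_zero_ne_zero h
  have h1 := congrArg (Polynomial.eval 0) (negSubst_charPoly_plucker hG h hF)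
  rw [hodd.neg_one_pow, negSubst, coe_compRingHom_apply, eval_comp, eval_neg, eval_X, neg_zero,
    neg_one_mul, eval_neg] at h1
  exact hne (self_eq_neg.mp h1)

theorem linearForm_vanishes {x : ℙ ℂ (PluckerIndex n → ℂ)} (hx : x ∈ LG n)
    (g : (PluckerIndex n → ℂ) →ₗ[ℂ] ℂ)
    (hg : ∀ F : Matrix (Fin n) (Fin n) ℂ, Fᵀ = F → g (plucker (rowBlock F 1)) = 0) :
    g x.rep = 0 := by
  have hm : linearForm g ∈ homogeneousIdeal (LG n) :=
    (mem_homogeneousIdeal_LG_iff (isHomogeneous_linearForm g)).mpr fun F hF => by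
      rw [eval_linearForm, hg F hF]
  have hle : homogeneousIdeal (LG n) ≤ pointIdeal x := iInf₂_le x hx
  have := hle hm
  rw [← x.mk_rep, mem_pointIdeal_mk_iff _ (isHomogeneous_linearForm g), eval_linearForm] at this
  exact this

theorem coeff_charPoly_of_odd (hG : IsHamiltonianTransfer G)
    (h : IsLeftCoprimeFactorization G D N) {x : ℙ ℂ (PluckerIndex n → ℂ)} (hx : x ∈ LG n)
    {k : ℕ} (hk : Odd k) : (charPoly D N x.rep).coeff k = 0 := by
  refine linearForm_vanishes hx (Polynomial.lcoeff ℂ k ∘ₗ charPoly D N) fun F hF => ?_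
  have h1 := congrArg (fun p => p.coeff k) (negSubst_charPoly_plucker hG h hF)
  simp only [(even_natDegree_det hG h).neg_one_pow, one_mul, coeff_negSubst, hk.neg_one_pow,
    neg_one_mul] at h1
  exact neg_eq_self.mp h1

theorem charPoly_comp_neg_X (hG : IsHamiltonianTransfer G)
    (h : IsLeftCoprimeFactorization G D N) {x : ℙ ℂ (PluckerIndex n → ℂ)} (hx : x ∈ LG n) :
    (charPoly D N x.rep).comp (-X) = charPoly D N x.rep := by
  ext k
  rw [← coe_compRingHom_apply, ← negSubst, coeff_negSubst]
  rcases Nat.even_or_odd k with hk | hk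
  · rw [hk.neg_one_pow, one_mul]
  · rw [coeff_charPoly_of_odd hG h hx hk, mul_zero]

end Systems

/-! ### The characteristic maps as central projections -/

section CentralProjection

variable {n : ℕ}

theorem mem_projectiveLocus_iff {ι : Type} {E : Submodule ℂ (ι → ℂ)} {x : ℙ ℂ (ι → ℂ)} :
    x ∈ projectiveLocus E ↔ x.rep ∈ E := by
  rw [projectiveLocus, Set.mem_ofPred_eq, Projectivization.submodule_eq,
    Submodule.span_singleton_le_iff_mem]

theorem isCentralProjection_toPoint {ι : Type} {m : ℕ} (L : (ι → ℂ) →ₗ[ℂ] (Fin (m + 1) → ℂ))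
    {E : Submodule ℂ (ι → ℂ)} (hE : LinearMap.ker L = E) {S : Set (ℙ ℂ (ι → ℂ))}
    (hS : ∀ x ∈ S, L x.rep ≠ 0) :
    IsCentralProjection L E S fun x => toPoint (L x.1.rep) := by
  refine ⟨hE, fun v hv hvS => ?_⟩
  obtain ⟨a, ha⟩ := Projectivization.exists_smul_eq_mk_rep ℂ v hv
  have h0 := hS _ hvS
  have hL : L (Projectivization.mk ℂ v hv).rep = a • L v := by
    rw [← ha, Units.smul_def, map_smul, Units.smul_def]
  have hLv : L v ≠ 0 := fun h => h0 (by rw [hL, h, smul_zero])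
  refine ⟨hLv, ?_⟩
  change toPoint (L (Projectivization.mk ℂ v hv).rep) = _
  rw [toPoint, dif_neg h0, Projectivization.mk_eq_mk_iff]
  exact ⟨a, hL.symm⟩

variable {G : Matrix (Fin n) (Fin n) (RatFunc ℂ)} {D N : Matrix (Fin n) (Fin n) ℂ[X]} {δ : ℕ}

theorem ker_coeffMap (h : ∀ z, (charPoly D N z).natDegree ≤ δ) :
    LinearMap.ker (coeffMap δ D N) = center D N := by
  ext z
  rw [center, LinearMap.mem_ker, LinearMap.mem_ker]
  constructor
  · intro hz
    ext k
    rw [coeff_zero]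
    by_cases hk : k < δ + 1
    · exact congrFun hz ⟨k, hk⟩
    · exact coeff_eq_zero_of_natDegree_lt ((h z).trans_lt (by omega))
  · intro hz
    funext k
    change (charPoly D N z).coeff k = 0
    rw [hz, coeff_zero]

theorem mem_evenCenter_iff {z : PluckerIndex n → ℂ} :
    z ∈ evenCenter D N ↔ ∀ k, (charPoly D N z).coeff (2 * k) = 0 := by
  rw [evenCenter, LinearMap.mem_ker]
  exact funext_iff

theorem ker_evenCoeffMap (h : ∀ z, (charPoly D N z).natDegree ≤ δ) :
    LinearMap.ker (evenCoeffMap δ D N) = evenCenter D N := by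
  ext z
  rw [mem_evenCenter_iff, LinearMap.mem_ker]
  constructor
  · intro hz k
    by_cases hk : k < δ / 2 + 1
    · exact congrFun hz ⟨k, hk⟩
    · exact coeff_eq_zero_of_natDegree_lt ((h z).trans_lt (by omega))
  · intro hz
    funext k
    exact hz k

theorem rep_mem_evenCenter_iff (hG : IsHamiltonianTransfer G)
    (h : IsLeftCoprimeFactorization G D N) {x : ℙ ℂ (PluckerIndex n → ℂ)} (hx : x ∈ LG n) :
    x.rep ∈ evenCenter D N ↔ x.rep ∈ center D N := by
  rw [mem_evenCenter_iff, center, LinearMap.mem_ker]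
  constructor
  · intro hz
    ext k
    rw [coeff_zero]
    rcases Nat.even_or_odd' k with ⟨c, rfl | rfl⟩
    · exact hz c
    · exact coeff_charPoly_of_odd hG h hx ⟨c, rfl⟩
  · intro hz k
    rw [hz, coeff_zero]

theorem regularLocus_eq (h : projectiveLocus (center D N) ∩ LG n = ∅) :
    regularLocus D N = LG n := by
  refine Set.ext fun x => ⟨fun hx => hx.1, fun hx => ⟨hx, fun hx' => ?_⟩⟩
  exact Set.notMem_empty x (h ▸ ⟨hx', hx⟩)

/-- A central projection of `LG(n)` onto a projective space of the same dimension whose center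
does not meet `LG(n)` is surjective, and its fibers have `deg LG(n)` points. -/
theorem surjective_and_fibersHaveCount_LG {P : ℚ[X]} {d m : ℕ} (hP : IsHilbertPolynomial (LG n) P)
    (hdeg : P.degree = (Nat.card (Sym2 (Fin n)) : ℕ)) (hd0 : 0 < d)
    (hd : ((Nat.card (Sym2 (Fin n))).factorial : ℚ) * P.leadingCoeff = d)
    (hm : (n + 1).choose 2 = m) (L : (PluckerIndex n → ℂ) →ₗ[ℂ] (Fin (m + 1) → ℂ))
    {E : Submodule ℂ (PluckerIndex n → ℂ)} {S : Set (ℙ ℂ (PluckerIndex n → ℂ))} (hS : S = LG n)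
    {f : S → ℙ ℂ (Fin (m + 1) → ℂ)} (hf : IsCentralProjection L E S f) :
    Function.Surjective f ∧ FibersHaveCount (LG n) S L f d := by
  obtain ⟨s, ⟨c⟩⟩ := (lagrangianCover n).exists_finite
  have hnd : P.natDegree = Nat.card (Sym2 (Fin n)) := natDegree_eq_of_degree_eq_some hdeg
  refine surjective_and_fibersHaveCount (fun x hx => mem_zariskiClosure hx) c hP hnd.le hd0
    (by rw [← hd, leadingCoeff, hnd]) ?_ L hS f hf.2
  rw [Module.finrank_fin_fun, natCard_sym2, hm]

end CentralProjection

end SymmetricPoles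

end

open SymmetricPoles

theorem mainTheorem3 (n : ℕ) :
    ∃ d : ℕ, HasDimensionAndDegree (LG n) ((n + 1).choose 2) d ∧
    ∀ (δ : ℕ) (G : Matrix (Fin n) (Fin n) (RatFunc ℂ)) (D N : Matrix (Fin n) (Fin n) ℂ[X]),
      IsStrictlyProper G → HasMcMillanDegree G δ → IsLeftCoprimeFactorization G D N →
      (IsSymmetricTransfer G →
        (∀ z, (charPoly D N z).natDegree ≤ δ) ∧
        IsCentralProjection (coeffMap δ D N) (center D N) (regularLocus D N) (chi δ D N) ∧
        (projectiveLocus (center D N) ∩ LG n = ∅ → (n + 1).choose 2 = δ →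
          Function.Surjective (chi δ D N) ∧
          FibersHaveCount (LG n) (regularLocus D N) (coeffMap δ D N) (chi δ D N) d)) ∧
      (IsHamiltonianTransfer G →
        Even δ ∧
        (∀ z, (charPoly D N z).natDegree ≤ δ) ∧
        (∀ x ∈ LG n, (charPoly D N x.rep).comp (-X) = charPoly D N x.rep) ∧
        projectiveLocus (center D N) ∩ LG n = projectiveLocus (evenCenter D N) ∩ LG n ∧
        IsCentralProjection (evenCoeffMap δ D N) (evenCenter D N) (regularLocus D N)
          (chiEven δ D N) ∧
        (projectiveLocus (center D N) ∩ LG n = ∅ → 2 * (n + 1).choose 2 = δ →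
          Function.Surjective (chiEven δ D N) ∧
          FibersHaveCount (LG n) (regularLocus D N) (evenCoeffMap δ D N) (chiEven δ D N) d)) := by
  obtain ⟨P, d, hP, hdeg, hd0, hd⟩ := exists_dimension_degree_LG n
  refine ⟨d, ⟨P, hP, by rw [hdeg, natCard_sym2], by rw [← hd, natCard_sym2]⟩,
    fun δ G D N hG hδ h => ?_⟩
  have hle : ∀ z, (charPoly D N z).natDegree ≤ δ := fun z => by
    rw [← h.natDegree_eq hδ]; exact natDegree_charPoly_le hG h z
  refine ⟨fun _ => ?_, fun hH => ?_⟩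
  · have hproj : IsCentralProjection (coeffMap δ D N) (center D N) (regularLocus D N)
        (chi δ D N) :=
      isCentralProjection_toPoint _ (ker_coeffMap hle) fun x hx h0 => by
        refine hx.2 (mem_projectiveLocus_iff.mpr ?_)
        rwa [← ker_coeffMap hle, LinearMap.mem_ker]
    exact ⟨hle, hproj, fun hempty hm =>
      surjective_and_fibersHaveCount_LG hP hdeg hd0 hd hm _ (regularLocus_eq hempty) hproj⟩
  · have hproj : IsCentralProjection (evenCoeffMap δ D N) (evenCenter D N) (regularLocus D N)
        (chiEven δ D N) :=
      isCentralProjection_toPoint _ (ker_evenCoeffMap hle) fun x hx h0 => by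
        refine hx.2 (mem_projectiveLocus_iff.mpr ((rep_mem_evenCenter_iff hH h hx.1).mp ?_))
        rwa [← ker_evenCoeffMap hle, LinearMap.mem_ker]
    refine ⟨h.natDegree_eq hδ ▸ even_natDegree_det hH h, hle,
      fun x hx => charPoly_comp_neg_X hH h hx, ?_, hproj, fun hempty hm =>
      -- The target has dimension `δ / 2` in natural number division, which `2 * (n + 1).choose 2 =
      -- δ` makes equal to `dim LG(n)`.
      surjective_and_fibersHaveCount_LG hP hdeg hd0 hd (by omega) _ (regularLocus_eq hempty) hproj⟩
    ext x
    rw [Set.mem_inter_iff, Set.mem_inter_iff, mem_projectiveLocus_iff, mem_projectiveLocus_iff]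
    exact and_congr_left fun hx => (rep_mem_evenCenter_iff hH h hx).symm
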